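/- Let $k$ be a field of characteristic different from $2$ and $3$. For $\Gamma=\operatorname{diag}(\gamma_1,\gamma_2,\gamma_3)\in GL_3(k)$ and a composition algebra $(C,N)$ over $k$ (a nonzero unital, not necessarily associative algebra with a non-degenerate multiplicative quadratic form $N$, and conjugation $x\mapsto\bar x$), let $\mathcal H_3(C,\Gamma)=\{X\in M_3(C):\Gamma^{-1}\overline{X}^{\,t}\Gamma=X\}$ with the product $X\cdot Y=\tfrac12(XY+YX)$; these are the reduced Freudenthal algebras over $k$. In particular, $k$ with the norm $x\mapsto x^2$ is a composition algebra. A (not necessarily associative) $k$-algebra $A$ is a Freudenthal algebra if, for some field extension $K/k$, $A\otimes_kK$ is isomorphic to a reduced Freudenthal algebra over $K$. A quaternion algebra over $k$ is a composition algebra of dimension $4$; isomorphisms of quaternion algebras are isomorphisms of the underlying algebras. Let $V=k^6$ with basis $e_1,\dots,e_6$, let $Sp_6=\{g\in GL_6: gMg^t=M\}$ with $M=\begin{pmatrix}0&I_3\\-I_3&0\end{pmatrix}$, let $X(k)\subset\wedge^3V$ be the span of the $Sp_6(k)$-orbit of $e_1\wedge e_2\wedge e_3$, and let $X_2(k)$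 be the set of all $x\in X(k)$ that lie, over the algebraic closure $\bar k$, in the $Sp_6(\bar k)$-orbit of $e_1\wedge e_4\wedge e_3+e_5\wedge e_2\wedge e_3+e_1\wedge e_2\wedge e_6$. Then: 1. There is a bijection $\Phi$ from the set of isomorphism classes of the algebras $\mathcal H_3(k,\Gamma)$, where $\Gamma=\operatorname{diag}(\gamma_1,\gamma_2,\gamma_3)$ varies over the diagonal matrices in $GL_3(k)$, onto the set of isomorphism classes of quaternion algebras over $k$, such that $\Phi$ maps the class of $\mathcal H_3(k,\Gamma)$ to the class of $Q$ if and only if the norm form of $Q$ is isometric to $\langle 1,\gamma_2\gamma_3^{-1},\gamma_3\gamma_1^{-1},\gamma_1\gamma_2^{-1}\rangle$. 2. There is a bijection $\Psi$ from the orbit space $X_2(k)/Sp_6(k)$ onto the set of isomorphism classes of quaternion algebras over $k$ such that, for all $a,b,c\in k^\times$, the element $x=a\,e_4\wedge e_2\wedge e_3+b\,e_1\wedge e_5\wedge e_3+c\,e_1\wedge e_2\wedge e_6$ lies in $X_2(k)$, and $\Psi$ maps the orbit of $x$ to the class of $Q$ if and only if the norm form of $Q$ is isometric to $\langle 1,bc,ca,ab\rangle$.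 3. A $k$-algebra $A$ is a Freudenthal algebra of dimension $6$ over $k$ if and only if $A\cong\mathcal H_3(k,\Gamma)$ for some $\Gamma=\operatorname{diag}(\gamma_1,\gamma_2,\gamma_3)\in GL_3(k)$. -/

import Mathlib

open scoped TensorProduct

universe u v

set_option linter.unusedSectionVars false

namespace Freud

/-! ### Composition algebras -/

section Composition

variable {k C : Type*} [Field k] [NonAssocRing C] [Module k C]
  [IsScalarTower k C C] [SMulCommClass k C C]

/-- `(C, N)` is a composition algebra over `k`: a nonzero unital, not necessarily associative
`k`-algebra `C` with a non-degenerate multiplicative quadratic form `N`.  Non-degeneracy refers to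
the bilinear form `b_N(x, y) = N(x + y) - N(x) - N(y)`. -/
class IsComposition (N : QuadraticForm k C) : Prop where
  nontrivial : Nontrivial C
  nondegenerate : ∀ x : C, (∀ y : C, QuadraticMap.polar N x y = 0) → x = 0
  map_mul : ∀ x y : C, N (x * y) = N x * N y

/-- The conjugation `x ↦ b_N(x, 1) 1 - x` of a composition algebra. -/
def conj (N : QuadraticForm k C) : C →ₗ[k] C :=
  (LinearMap.toSpanSingleton k C 1).comp (N.polarBilin.flip 1) - LinearMap.id

theorem conj_apply (N : QuadraticForm k C) (x : C) :
    conj N x = QuadraticMap.polar N x 1 • (1 : C) - x := by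
  simp [conj]

section

variable (N : QuadraticForm k C) [hN : IsComposition N]

theorem map_one_eq : N 1 = 1 := by
  by_contra h
  have h0 : ∀ x, N x = 0 := by
    intro x
    have := hN.map_mul 1 x
    rw [one_mul] at this
    by_contra hx
    exact h (mul_right_cancel₀ hx (by rw [one_mul]; exact this.symm))
  obtain ⟨x, y, hxy⟩ := hN.nontrivial.exists_pair_ne
  have hz : ∀ z : C, z = 0 := fun z =>
    hN.nondegenerate z fun w => by simp [QuadraticMap.polar, h0]
  exact hxy ((hz x).trans (hz y).symm)

theorem polar_mul_left (x y z : C) :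
    QuadraticMap.polar N (x * y) (x * z) = N x * QuadraticMap.polar N y z := by
  simp only [QuadraticMap.polar, ← mul_add, hN.map_mul, mul_sub]

theorem polar_mul_add (x w y z : C) :
    QuadraticMap.polar N (x * y) (w * z) + QuadraticMap.polar N (w * y) (x * z) =
      QuadraticMap.polar N x w * QuadraticMap.polar N y z := by
  have h := polar_mul_left N (x + w) y z
  have hx := polar_mul_left N x y z
  have hw := polar_mul_left N w y z
  simp only [add_mul, QuadraticMap.polar_add_left, QuadraticMap.polar_add_right] at h
  have e : N (x + w) = QuadraticMap.polar N x w + N x + N w := by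
    simp only [QuadraticMap.polar]; ring
  rw [e] at h
  linear_combination h - hx - hw

theorem polar_mul_eq_left (x y z : C) :
    QuadraticMap.polar N (x * y) z = QuadraticMap.polar N y (conj N x * z) := by
  have h := polar_mul_add N x 1 y z
  simp only [one_mul] at h
  rw [conj_apply, sub_mul, smul_mul_assoc, one_mul, QuadraticMap.polar_sub_right,
    QuadraticMap.polar_smul_right, smul_eq_mul]
  linear_combination h

theorem polar_mul_eq_right (x y z : C) :
    QuadraticMap.polar N (x * y) z = QuadraticMap.polar N x (z * conj N y) := by
  have h := polar_mul_add N x z y 1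
  simp only [mul_one] at h
  rw [conj_apply, mul_sub, mul_smul_comm, mul_one, QuadraticMap.polar_sub_right,
    QuadraticMap.polar_smul_right, smul_eq_mul]
  rw [QuadraticMap.polar_comm N (z * y) x] at h
  linear_combination h

theorem conj_conj (x : C) : conj N (conj N x) = x := by
  have h1 : QuadraticMap.polar N (1 : C) 1 = 2 := by
    have := QuadraticMap.polar_self N (1 : C)
    rw [map_one_eq N] at this
    simpa using this
  rw [conj_apply N (conj N x), conj_apply N x, QuadraticMap.polar_sub_left,
    QuadraticMap.polar_smul_left, h1, smul_eq_mul,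
    show QuadraticMap.polar N x 1 * 2 - QuadraticMap.polar N x 1 = QuadraticMap.polar N x 1 by ring]
  abel

theorem polar_conj (x y : C) :
    QuadraticMap.polar N (conj N x) y = QuadraticMap.polar N x (conj N y) := by
  rw [conj_apply, conj_apply, QuadraticMap.polar_sub_left, QuadraticMap.polar_sub_right,
    QuadraticMap.polar_smul_left, QuadraticMap.polar_smul_right, smul_eq_mul, smul_eq_mul,
    QuadraticMap.polar_comm N 1 y]
  ring

theorem conj_mul (x y : C) : conj N (x * y) = conj N y * conj N x := by
  rw [← sub_eq_zero]
  refine hN.nondegenerate _ fun z => ?_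
  rw [QuadraticMap.polar_sub_left, sub_eq_zero, polar_conj, QuadraticMap.polar_comm,
    polar_mul_eq_left N (conj N y), conj_conj, QuadraticMap.polar_comm N (conj N x),
    polar_mul_eq_right N y z, QuadraticMap.polar_comm N y, polar_mul_eq_left N (conj N x),
    conj_conj]

end

/-- The `k`-algebra `k` with the norm `x ↦ x ^ 2` is a composition algebra. -/
instance isComposition_sq [NeZero (2 : k)] :
    IsComposition (QuadraticMap.sq : QuadraticForm k k) where
  nontrivial := inferInstance
  nondegenerate x h := by
    have h1 := h 1
    simp only [QuadraticMap.polar, QuadraticMap.sq_apply] at h1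
    have h2 : (2 : k) * x = 0 := by linear_combination h1
    exact (mul_eq_zero.mp h2).resolve_left (NeZero.ne _)
  map_mul x y := by simp only [QuadraticMap.sq_apply]; ring

/-! ### Reduced Freudenthal algebras -/

/-- The map `X ↦ Γ⁻¹ X̄ᵗ Γ` on `M₃(C)`, where `Γ = diag(γ₀, γ₁, γ₂) ∈ GL₃(k)`. -/
def starGamma (N : QuadraticForm k C) (γ : Fin 3 → kˣ) (X : Matrix (Fin 3) (Fin 3) C) :
    Matrix (Fin 3) (Fin 3) C :=
  Matrix.of fun i j => (((γ i)⁻¹ * γ j : kˣ) : k) • conj N (X j i)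

/-- The subspace `H₃(C, Γ) = {X ∈ M₃(C) | Γ⁻¹ X̄ᵗ Γ = X}` of `M₃(C)`. -/
def H3 (N : QuadraticForm k C) (γ : Fin 3 → kˣ) : Submodule k (Matrix (Fin 3) (Fin 3) C) where
  carrier := {X | starGamma N γ X = X}
  add_mem' {X Y} hX hY := by
    have hX' : starGamma N γ X = X := hX
    have hY' : starGamma N γ Y = Y := hY
    change starGamma N γ (X + Y) = X + Y
    conv_rhs => rw [← hX', ← hY']
    ext i j
    simp [starGamma]
  zero_mem' := by
    change starGamma N γ 0 = 0
    ext i j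
    simp [starGamma]
  smul_mem' c X hX := by
    have hX' : starGamma N γ X = X := hX
    change starGamma N γ (c • X) = c • X
    conv_rhs => rw [← hX']
    ext i j
    simp only [starGamma, Matrix.of_apply, Matrix.smul_apply, map_smul]
    rw [smul_comm]

theorem starGamma_mul (N : QuadraticForm k C) [IsComposition N] (γ : Fin 3 → kˣ)
    (X Y : Matrix (Fin 3) (Fin 3) C) :
    starGamma N γ (X * Y) = starGamma N γ Y * starGamma N γ X := by
  ext i j
  simp only [starGamma, Matrix.of_apply, Matrix.mul_apply, map_sum, conj_mul, Finset.smul_sum]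
  refine Finset.sum_congr rfl fun l _ => ?_
  rw [smul_mul_smul_comm, ← Units.val_mul]
  congr 2
  group

theorem jordan_mem (N : QuadraticForm k C) [IsComposition N] (γ : Fin 3 → kˣ)
    {X Y : Matrix (Fin 3) (Fin 3) C} (hX : X ∈ H3 N γ) (hY : Y ∈ H3 N γ) :
    (2⁻¹ : k) • (X * Y + Y * X) ∈ H3 N γ := by
  refine (H3 N γ).smul_mem _ ?_
  have hX' : starGamma N γ X = X := hX
  have hY' : starGamma N γ Y = Y := hY
  change starGamma N γ (X * Y + Y * X) = X * Y + Y * X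
  have hadd : starGamma N γ (X * Y + Y * X) = starGamma N γ (X * Y) + starGamma N γ (Y * X) := by
    ext i j
    simp [starGamma]
  rw [hadd, starGamma_mul, starGamma_mul, hX', hY', add_comm]

/-- The product `X . Y = (XY + YX) / 2` on `H₃(C, Γ)`. -/
instance (N : QuadraticForm k C) [IsComposition N] (γ : Fin 3 → kˣ) : Mul (H3 N γ) where
  mul X Y := ⟨(2⁻¹ : k) • (X.1 * Y.1 + Y.1 * X.1), jordan_mem N γ X.2 Y.2⟩

theorem coe_mul (N : QuadraticForm k C) [IsComposition N] (γ : Fin 3 → kˣ) (X Y : H3 N γ) :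
    ((X * Y : H3 N γ) : Matrix (Fin 3) (Fin 3) C) = (2⁻¹ : k) • (X.1 * Y.1 + Y.1 * X.1) := rfl

instance (N : QuadraticForm k C) [IsComposition N] (γ : Fin 3 → kˣ) :
    NonUnitalNonAssocRing (H3 N γ) :=
  { (inferInstance : AddCommGroup (H3 N γ)), (inferInstance : Mul (H3 N γ)) with
    left_distrib := fun X Y Z => by
      apply Subtype.ext
      simp only [coe_mul, Submodule.coe_add, mul_add, add_mul, ← smul_add]
      congr 1
      abel
    right_distrib := fun X Y Z => by
      apply Subtype.ext
      simp only [coe_mul, Submodule.coe_add, mul_add, add_mul, ← smul_add]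
      congr 1
      abel
    zero_mul := fun X => by
      apply Subtype.ext
      simp [coe_mul]
    mul_zero := fun X => by
      apply Subtype.ext
      simp [coe_mul] }

end Composition

/-- Two (not necessarily associative or unital) `k`-algebras are isomorphic. -/
def AlgIso (k A B : Type*) [Field k] [NonUnitalNonAssocRing A] [Module k A]
    [NonUnitalNonAssocRing B] [Module k B] : Prop :=
  ∃ f : A →ₙₐ[k] B, Function.Bijective f

theorem AlgIso.refl (k A : Type*) [Field k] [NonUnitalNonAssocRing A] [Module k A] :
    AlgIso k A A :=
  ⟨NonUnitalAlgHom.id k A, Function.bijective_id⟩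

theorem AlgIso.symm {k A B : Type*} [Field k] [NonUnitalNonAssocRing A] [Module k A]
    [NonUnitalNonAssocRing B] [Module k B] (h : AlgIso k A B) : AlgIso k B A := by
  obtain ⟨f, hf⟩ := h
  obtain ⟨g, hg1, hg2⟩ := Function.bijective_iff_has_inverse.mp hf
  exact ⟨f.inverse g hg1 hg2, Function.bijective_iff_has_inverse.mpr ⟨f, hg2, hg1⟩⟩

theorem AlgIso.trans {k A B D : Type*} [Field k] [NonUnitalNonAssocRing A] [Module k A]
    [NonUnitalNonAssocRing B] [Module k B] [NonUnitalNonAssocRing D] [Module k D]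
    (h : AlgIso k A B) (h' : AlgIso k B D) : AlgIso k A D := by
  obtain ⟨f, hf⟩ := h
  obtain ⟨g, hg⟩ := h'
  exact ⟨g.comp f, hg.comp hf⟩

/-- A `k`-algebra `A` is a Freudenthal algebra if `K ⊗ A` is isomorphic to a reduced Freudenthal
algebra `H₃(C, Γ)` over `K`, for some field extension `K / k` and some composition algebra `C`
over `K`. -/
def IsFreudenthal (k : Type u) (A : Type v) [Field k] [NonUnitalNonAssocRing A] [Module k A]
    [IsScalarTower k A A] [SMulCommClass k A A] : Prop :=
  ∃ (K : Type u) (_ : Field K) (_ : Algebra k K) (C : Type u) (_ : NonAssocRing C) (_ : Module K C)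
    (_ : IsScalarTower K C C) (_ : SMulCommClass K C C) (N : QuadraticForm K C)
    (_ : IsComposition N) (γ : Fin 3 → Kˣ), AlgIso K (K ⊗[k] A) (H3 N γ)

/-- `H₃(k, Γ)`, where `k` is the one-dimensional composition algebra with norm `x ↦ x ^ 2`. -/
abbrev H3k {k : Type u} [Field k] (γ : Fin 3 → kˣ) : Submodule k (Matrix (Fin 3) (Fin 3) k) :=
  H3 (QuadraticMap.sq : QuadraticForm k k) γ

/-- `Γ ∼ Γ'` if and only if `H₃(k, Γ) ≃ H₃(k, Γ')`. -/
def h3Setoid (k : Type u) [Field k] [NeZero (2 : k)] : Setoid (Fin 3 → kˣ) where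
  r γ γ' := AlgIso k (H3k γ) (H3k γ')
  iseqv := ⟨fun _ => AlgIso.refl _ _, fun h => h.symm, fun h h' => h.trans h'⟩

/-- The isomorphism classes of the algebras `H₃(k, Γ)`. -/
abbrev H3Classes (k : Type u) [Field k] [NeZero (2 : k)] : Type u := Quotient (h3Setoid k)

/-! ### Quaternion algebras -/

/-- A quaternion algebra over `k`: a composition algebra of dimension `4`. -/
structure QuatAlg (k : Type u) [Field k] where
  carrier : Type u
  [ring : NonAssocRing carrier]
  [module : Module k carrier]
  [scalarTower : IsScalarTower k carrier carrier]
  [smulComm : SMulCommClass k carrier carrier]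
  norm : QuadraticForm k carrier
  isComposition : IsComposition norm
  finrank_eq : Module.finrank k carrier = 4

attribute [instance] QuatAlg.ring QuatAlg.module QuatAlg.scalarTower QuatAlg.smulComm

/-- An isomorphism of quaternion algebras is an isomorphism of the underlying algebras. -/
def quatSetoid (k : Type u) [Field k] : Setoid (QuatAlg k) where
  r Q Q' := AlgIso k Q.carrier Q'.carrier
  iseqv := ⟨fun _ => AlgIso.refl _ _, fun h => h.symm, fun h h' => h.trans h'⟩

/-- The isomorphism classes of quaternion algebras over `k`. -/
abbrev QuatClasses (k : Type u) [Field k] : Type (u + 1) := Quotient (quatSetoid k)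

/-! ### The representation of `Sp₆` -/

section Representation

/-- `Λ³ V` for `V = F⁶`, with the basis `e₁, …, e₆` of `V` indexed by `Fin 3 ⊕ Fin 3`. -/
abbrev Trivec (F : Type*) [Field F] := ⋀[F]^3 (Fin 3 ⊕ Fin 3 → F)

/-- The basis vectors `e₁, e₂, e₃` of `V`, with indices `0, 1, 2`. -/
def eL (F : Type*) [Field F] (i : Fin 3) : Fin 3 ⊕ Fin 3 → F := Pi.single (Sum.inl i) 1

/-- The basis vectors `e₄, e₅, e₆` of `V`, with indices `0, 1, 2`. -/
def eR (F : Type*) [Field F] (i : Fin 3) : Fin 3 ⊕ Fin 3 → F := Pi.single (Sum.inr i) 1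

/-- The trivector `u ∧ v ∧ w`. -/
noncomputable def wedge {F : Type*} [Field F] (u v w : Fin 3 ⊕ Fin 3 → F) : Trivec F :=
  exteriorPower.ιMulti F 3 ![u, v, w]

/-- The action of `Sp₆(F)` on `Λ³ V` induced by its natural action on `V`. -/
noncomputable def spAct {F : Type*} [Field F] (g : Matrix.symplecticGroup (Fin 3) F) :
    Trivec F →ₗ[F] Trivec F :=
  exteriorPower.map 3 (Matrix.toLin' (g : Matrix (Fin 3 ⊕ Fin 3) (Fin 3 ⊕ Fin 3) F))

theorem spAct_one {F : Type*} [Field F] (x : Trivec F) :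
    spAct (1 : Matrix.symplecticGroup (Fin 3) F) x = x := by
  simp [spAct, Matrix.toLin'_one]

theorem spAct_mul {F : Type*} [Field F] (g h : Matrix.symplecticGroup (Fin 3) F)
    (x : Trivec F) : spAct (g * h) x = spAct g (spAct h x) := by
  simp only [spAct, Submonoid.coe_mul, Matrix.toLin'_mul]
  rw [exteriorPower.map_comp, LinearMap.comp_apply]

/-- The representation `X` of `Sp₆`: the span of the orbit of `e₁ ∧ e₂ ∧ e₃`. -/
def X (F : Type*) [Field F] : Submodule F (Trivec F) :=
  Submodule.span F (Set.range fun g : Matrix.symplecticGroup (Fin 3) F =>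
    spAct g (wedge (eL F 0) (eL F 1) (eL F 2)))

/-- The extension of scalars `Λ³ (k⁶) → Λ³ (K⁶)`, `u ∧ v ∧ w ↦ u ∧ v ∧ w`. -/
noncomputable def extend (k K : Type*) [Field k] [Field K] [Algebra k K] :
    Trivec k →ₗ[k] Trivec K :=
  exteriorPower.alternatingMapLinearEquiv
    (AlternatingMap.compLinearMap
      { (exteriorPower.ιMulti K 3 (M := Fin 3 ⊕ Fin 3 → K)).toMultilinearMap.restrictScalars k with
        map_eq_zero_of_eq' := (exteriorPower.ιMulti K 3).map_eq_zero_of_eq' }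
      ((Algebra.linearMap k K).compLeft (Fin 3 ⊕ Fin 3)))

theorem extend_wedge (k K : Type*) [Field k] [Field K] [Algebra k K]
    (u v w : Fin 3 ⊕ Fin 3 → k) :
    extend k K (wedge u v w) =
      wedge (algebraMap k K ∘ u) (algebraMap k K ∘ v) (algebraMap k K ∘ w) := by
  rw [extend, wedge, exteriorPower.alternatingMapLinearEquiv_apply_ιMulti]
  change exteriorPower.ιMulti K 3 _ = _
  congr 1
  funext i
  fin_cases i <;> rfl

/-- The element `a e₄ ∧ e₂ ∧ e₃ + b e₁ ∧ e₅ ∧ e₃ + c e₁ ∧ e₂ ∧ e₆`. -/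
noncomputable def diagElt {F : Type*} [Field F] (a b c : F) : Trivec F :=
  a • wedge (eR F 0) (eL F 1) (eL F 2) + b • wedge (eL F 0) (eR F 1) (eL F 2) +
    c • wedge (eL F 0) (eL F 1) (eR F 2)

/-- `X₂(k)`: the `k`-rational points of the `Sp₆`-orbit (over the algebraic closure) of
`e₁ ∧ e₄ ∧ e₃ + e₅ ∧ e₂ ∧ e₃ + e₁ ∧ e₂ ∧ e₆`. -/
def X2 (k : Type u) [Field k] : Set (Trivec k) :=
  {x | x ∈ X k ∧ ∃ g : Matrix.symplecticGroup (Fin 3) (AlgebraicClosure k),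
    extend k (AlgebraicClosure k) x =
      spAct g (wedge (eL _ 0) (eR _ 0) (eL _ 2) + wedge (eR _ 1) (eL _ 1) (eL _ 2) +
        wedge (eL _ 0) (eL _ 1) (eR _ 2))}

/-- Two points of `X₂(k)` are equivalent if they lie in the same `Sp₆(k)`-orbit. -/
def x2Setoid (k : Type u) [Field k] : Setoid (X2 k) where
  r x y := ∃ g : Matrix.symplecticGroup (Fin 3) k, spAct g x.1 = y.1
  iseqv := by
    refine ⟨fun x => ⟨1, spAct_one _⟩, ?_, ?_⟩
    · rintro x y ⟨g, hg⟩
      exact ⟨g⁻¹, by rw [← hg, ← spAct_mul, inv_mul_cancel, spAct_one]⟩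
    · rintro x y z ⟨g, hg⟩ ⟨h, hh⟩
      exact ⟨h * g, by rw [spAct_mul, hg, hh]⟩

/-- The orbit space `X₂(k) / Sp₆(k)`. -/
abbrev X2Orbits (k : Type u) [Field k] : Type u := Quotient (x2Setoid k)

end Representation

/-- The diagonal quaternary quadratic form `⟨a, b, c, d⟩`. -/
abbrev diagForm {k : Type u} [Field k] (a b c d : k) : QuadraticForm k (Fin 4 → k) :=
  QuadraticMap.weightedSumSquares k ![a, b, c, d]

end Freud

open Freud

open Freud

/-! ### Diagonal quadratic forms -/

section DiagonalForms

variable {k : Type*} [Field k] {n : Type*} [Fintype n] [DecidableEq n]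

open Matrix

/-! All three statements come down to ternary quadratic forms up to isometry. A quaternion algebra
is determined by its norm form ⟨1, a, b, ab⟩ (`quatSetoid_iff`), all such forms with a, b ≠ 0 occur,
and Witt cancellation (`equivalent_of_vecCons`) replaces the norm form by its pure part ⟨a, b, ab⟩.
`exists_equiv_quatClasses` then turns any complete invariant with values in these forms into a
bijection with quaternion algebras.

For H₃(k, Γ), the trace of left multiplication is twice the matrix trace, so the form Y ↦ tr(Y²) is
an invariant of the algebra. It is ⟨1, 1, 1⟩ plus twice the ternary form of ratios of the γ's, so
cancellation recovers the ternary form. That form is det(Γ)Γ up to squares; an isometry P therefore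
makes Γ and Γ' similar, and Y ↦ PYP⁻¹ is an isomorphism of the algebras.

For X₂, the main tool is a quadratic equivariant map `covariant` from trivectors to symmetric 6 × 6
matrices, x ↦ K, with g acting by K ↦ gKgᵀ. On X₂ the matrix K has rank 3 and Lagrangian column
space, as may be checked at one point over the algebraic closure. Moving that Lagrangian to L = ⟨e₁,
e₂, e₃⟩ and diagonalizing K puts x into L ∧ L ∧ V. There x consists of a 3 × 3 matrix S, symmetric
because x lies in X, and a multiple of e₁ ∧ e₂ ∧ e₃, and K is −4 adj(S). So S is diagonal, and a
unipotent element removes the remaining multiple. For S = diag(a, b, c), K is −4⟨bc, ca, ab⟩ on L.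
Conversely, an isometry of two such forms, with its sign adjusted, lifts to the Levi subgroup of the
stabilizer of L.

For Freudenthal algebras of dimension 6, dimension count forces C = K, so A embeds as a k-form
inside the symmetric 3 × 3 matrices over an algebraic closure of K. Commutators of elements of A are
alternating matrices, that is, vectors s, and identities in the Jordan algebra put ssᵀ and stᵀ + tsᵀ
into A, while dot products s · t lie in k because traces do. Three independent such vectors, the
rows of a matrix S with Gram matrix G over k, give A = Sᵀ Sym₃(k) S, with product governed by G.
Diagonalizing G over k yields H₃(k, Γ) (`exists_transpose_mul_mul_mem`,
`exists_algIso_H3k_of_range`). -/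

theorem weightedSumSquares_eq_dotProduct (w x : n → k) :
    QuadraticMap.weightedSumSquares k w x = x ⬝ᵥ (diagonal w *ᵥ x) := by
  simp only [QuadraticMap.weightedSumSquares_apply, dotProduct, mulVec_diagonal, smul_eq_mul]
  exact Finset.sum_congr rfl fun i _ => by ring

theorem polar_weightedSumSquares (w x y : n → k) :
    QuadraticMap.polar (QuadraticMap.weightedSumSquares k w) x y =
      2 * (x ⬝ᵥ (diagonal w *ᵥ y)) := by
  simp only [QuadraticMap.polar, QuadraticMap.weightedSumSquares_apply, dotProduct,
    mulVec_diagonal, smul_eq_mul, Pi.add_apply, ← Finset.sum_sub_distrib, Finset.mul_sum]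
  exact Finset.sum_congr rfl fun i _ => by ring

theorem equivalent_weightedSumSquares_of_congr {w w' : n → k} {P : Matrix n n k}
    (hP : IsUnit P.det) (h : Pᵀ * diagonal w' * P = diagonal w) :
    QuadraticMap.Equivalent (QuadraticMap.weightedSumSquares k w)
      (QuadraticMap.weightedSumSquares k w') := by
  refine ⟨⟨(LinearEquiv.ofIsUnitDet (f := toLin' P) (v := Pi.basisFun k n) (v' := Pi.basisFun k n)
    ?_), fun x => ?_⟩⟩
  · rwa [LinearMap.toMatrix_eq_toMatrix', LinearMap.toMatrix'_toLin']
  · simp only [AddHom.toFun_eq_coe, LinearMap.coe_toAddHom, LinearEquiv.coe_coe,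
      LinearEquiv.ofIsUnitDet_apply, toLin'_apply]
    rw [weightedSumSquares_eq_dotProduct, weightedSumSquares_eq_dotProduct, ← h]
    simp only [← mulVec_mulVec, dotProduct_mulVec, vecMul_mulVec, vecMul_transpose]

theorem exists_congr_of_equivalent_weightedSumSquares [NeZero (2 : k)] {w w' : n → k}
    (h : QuadraticMap.Equivalent (QuadraticMap.weightedSumSquares k w)
      (QuadraticMap.weightedSumSquares k w')) :
    ∃ P : Matrix n n k, IsUnit P.det ∧ Pᵀ * diagonal w' * P = diagonal w := by
  obtain ⟨f⟩ := h
  refine ⟨LinearMap.toMatrix' f.toLinearEquiv.toLinearMap, ?_, ?_⟩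
  · exact LinearEquiv.isUnit_det' f.toLinearEquiv |> fun h => by
      rwa [← LinearMap.det_toMatrix'] at h
  · set P := LinearMap.toMatrix' f.toLinearEquiv.toLinearMap with hPdef
    have hPx : ∀ x, P *ᵥ x = f x := fun x => by
      rw [hPdef, LinearMap.toMatrix'_mulVec]; rfl
    have key : ∀ x y, x ⬝ᵥ ((Pᵀ * diagonal w' * P) *ᵥ y) = x ⬝ᵥ (diagonal w *ᵥ y) := by
      intro x y
      refine mul_left_cancel₀ (NeZero.ne (2 : k)) ?_
      rw [← polar_weightedSumSquares]
      have : QuadraticMap.polar (QuadraticMap.weightedSumSquares k w) x y =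
          QuadraticMap.polar (QuadraticMap.weightedSumSquares k w') (f x) (f y) := by
        simp only [QuadraticMap.polar, ← map_add, QuadraticMap.IsometryEquiv.map_app]
      rw [this, polar_weightedSumSquares, ← hPx, ← hPx]
      simp only [← mulVec_mulVec, dotProduct_mulVec, vecMul_mulVec, vecMul_transpose]
    ext i j
    have := key (Pi.single i 1) (Pi.single j 1)
    rwa [single_one_dotProduct, single_one_dotProduct, mulVec_single_one, mulVec_single_one] at this

theorem equivalent_weightedSumSquares_of_sq {w w' : n → k} (c : n → k) (hc : ∀ i, c i ≠ 0)
    (h : ∀ i, w i = w' i * c i ^ 2) :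
    QuadraticMap.Equivalent (QuadraticMap.weightedSumSquares k w)
      (QuadraticMap.weightedSumSquares k w') := by
  refine equivalent_weightedSumSquares_of_congr (P := diagonal c) ?_ ?_
  · rw [det_diagonal, isUnit_iff_ne_zero]
    exact Finset.prod_ne_zero_iff.mpr fun i _ => hc i
  · rw [diagonal_transpose, diagonal_mul_diagonal, diagonal_mul_diagonal]
    congr 1
    funext i
    rw [h]; ring

/-- Every symmetric matrix over a field of characteristic not two is congruent to a diagonal one. -/
theorem exists_eq_mul_diagonal_mul_transpose [NeZero (2 : k)] (S : Matrix n n k) (hS : Sᵀ = S) :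
    ∃ (P : Matrix n n k) (d : n → k), IsUnit P.det ∧ S = P * diagonal d * Pᵀ := by
  have : Invertible (2 : k) := invertibleOfNonzero (NeZero.ne _)
  have hsymm : LinearMap.IsSymm (Matrix.toBilin' S) := ⟨fun x y => by
    simp only [RingHom.id_apply]
    rw [Matrix.toBilin'_apply', Matrix.toBilin'_apply', dotProduct_mulVec, ← mulVec_transpose, hS,
      dotProduct_comm]⟩
  obtain ⟨v, hv⟩ := LinearMap.BilinForm.exists_orthogonal_basis hsymm
  let e : Fin (Module.finrank k (n → k)) ≃ n := Fintype.equivOfCardEq (by simp)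
  let b := v.reindex e
  have hb : ∀ i j, i ≠ j → Matrix.toBilin' S (b i) (b j) = 0 := by
    intro i j hij
    simp only [b, Module.Basis.reindex_apply]
    exact hv (fun h => hij (e.symm.injective h))
  let B : Matrix n n k := (Pi.basisFun k n).toMatrix b
  have hBdet : IsUnit B.det := by
    have h := (Pi.basisFun k n).isUnit_det b
    rwa [Module.Basis.det_apply] at h
  have hBS : Bᵀ * S * B = diagonal fun i => Matrix.toBilin' S (b i) (b i) := by
    ext i j
    have h1 : (Bᵀ * S * B) i j = Matrix.toBilin' S (b i) (b j) := by
      rw [Matrix.toBilin'_apply', Matrix.mul_assoc]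
      simp only [Matrix.mul_apply, dotProduct, mulVec, transpose_apply]
      rfl
    rw [h1]
    by_cases hij : i = j
    · subst hij; simp
    · rw [hb i j hij, diagonal_apply_ne _ hij]
  refine ⟨(B⁻¹)ᵀ, fun i => Matrix.toBilin' S (b i) (b i), ?_, ?_⟩
  rotate_left 1
  · rw [← hBS, transpose_transpose]
    simp only [← Matrix.mul_assoc, ← Matrix.transpose_mul]
    rw [Matrix.mul_nonsing_inv _ hBdet, Matrix.transpose_one, Matrix.one_mul, Matrix.mul_assoc,
      Matrix.mul_nonsing_inv _ hBdet, Matrix.mul_one]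
  · rw [Matrix.det_transpose]
    exact Matrix.isUnit_nonsing_inv_det _ hBdet

/-- A quadratic form admits an isometry moving any anisotropic vector to any other vector of the
same norm. -/
theorem exists_isometryEquiv_apply_eq [NeZero (2 : k)] {V : Type*} [AddCommGroup V] [Module k V]
    (Q : QuadraticForm k V) {x y : V} (hxy : Q x = Q y) (hx : Q x ≠ 0) :
    ∃ r : Q.IsometryEquiv Q, r x = y := by
  -- The reflection in an anisotropic vector z is an isometry.
  have refl : ∀ z : V, Q z ≠ 0 → ∃ r : Q.IsometryEquiv Q,
      ∀ t, r t = t - (QuadraticMap.polar Q t z / Q z) • z := by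
    intro z hz
    have h2 : ((Q z)⁻¹ • Q.polarBilin.flip z) z = 2 := by
      simp only [LinearMap.smul_apply, LinearMap.flip_apply, QuadraticMap.polarBilin_apply_apply,
        QuadraticMap.polar_self, smul_eq_mul, nsmul_eq_mul]
      field_simp
      norm_num
    have happ : ∀ t, Module.reflection h2 t = t - (QuadraticMap.polar Q t z / Q z) • z := by
      intro t
      rw [Module.reflection_apply]
      simp [div_eq_inv_mul]
    refine ⟨⟨Module.reflection h2, fun t => ?_⟩, happ⟩
    change Q (Module.reflection h2 t) = Q t
    rw [happ, sub_eq_add_neg, ← neg_smul, QuadraticMap.map_add Q, QuadraticMap.map_smul,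
      QuadraticMap.polar_smul_right]
    simp only [smul_eq_mul]
    field_simp
    ring
  -- By the parallelogram law Q(x − y) + Q(x + y) = 4Q(x) ≠ 0, so one of x ± y is anisotropic.
  -- Reflection in x − y sends x to y; reflection in x + y sends x to −y, to be followed by −1.
  by_cases h : Q (x - y) = 0
  · have hne : Q (x + y) ≠ 0 := by
      intro h'
      have h1 : Q (x - y) + Q (x + y) = 2 * (2 * Q x) := by
        rw [sub_eq_add_neg, QuadraticMap.map_add Q, QuadraticMap.map_add Q, QuadraticMap.map_neg,
          QuadraticMap.polar_neg_right, ← hxy]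
        ring
      rw [h, h', add_zero] at h1
      have h2 := NeZero.ne (2 : k)
      exact mul_ne_zero h2 (mul_ne_zero h2 hx) h1.symm
    obtain ⟨r, hr⟩ := refl _ hne
    refine ⟨⟨r.toLinearEquiv.trans (LinearEquiv.neg k), fun t => ?_⟩, ?_⟩
    · change Q (-(r t)) = Q t
      rw [QuadraticMap.map_neg, r.map_app]
    · change -(r x) = y
      have h1 : QuadraticMap.polar Q x (x + y) = Q (x + y) := by
        rw [QuadraticMap.polar_add_right, QuadraticMap.polar_self, QuadraticMap.map_add Q, ← hxy,
          two_nsmul]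
      rw [hr, h1, div_self hne, one_smul]
      abel
  · obtain ⟨r, hr⟩ := refl _ h
    refine ⟨r, ?_⟩
    have h1 : QuadraticMap.polar Q x (x - y) = Q (x - y) := by
      rw [sub_eq_add_neg, QuadraticMap.polar_add_right, QuadraticMap.polar_self,
        QuadraticMap.map_add Q, QuadraticMap.map_neg, ← hxy, two_nsmul]
    rw [hr, h1, div_self h, one_smul]
    abel

/-- Witt cancellation of a one-dimensional form from diagonal forms. -/
theorem equivalent_of_vecCons [NeZero (2 : k)] {m : ℕ} {a : k} (ha : a ≠ 0) {w w' : Fin m → k}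
    (h : QuadraticMap.Equivalent (QuadraticMap.weightedSumSquares k (vecCons a w))
      (QuadraticMap.weightedSumSquares k (vecCons a w'))) :
    QuadraticMap.Equivalent (QuadraticMap.weightedSumSquares k w)
      (QuadraticMap.weightedSumSquares k w') := by
  obtain ⟨f⟩ := h
  let e : Fin (m + 1) → k := vecCons 1 0
  have hcons : ∀ (v : Fin m → k) (t : k) (x : Fin m → k),
      QuadraticMap.weightedSumSquares k (vecCons a v) (vecCons t x) =
        a * (t * t) + QuadraticMap.weightedSumSquares k v x := by
    intro v t x
    simp [QuadraticMap.weightedSumSquares_apply, Fin.sum_univ_succ]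
  have he : ∀ v : Fin m → k, QuadraticMap.weightedSumSquares k (vecCons a v) e = a := by
    intro v; rw [hcons]; simp
  obtain ⟨r, hr⟩ := exists_isometryEquiv_apply_eq
    (QuadraticMap.weightedSumSquares k (vecCons a w')) (x := f e) (y := e)
    (by rw [f.map_app, he, he]) (by rw [f.map_app, he]; exact ha)
  let g := f.trans r
  have hge : g e = e := hr
  -- As g fixes e, it preserves the orthogonal complement of e, which is the hyperplane of vectors
  -- with head 0 because 2a ≠ 0.
  have hzero : ∀ x : Fin m → k, g (vecCons 0 x) 0 = 0 := by
    intro x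
    have hp : QuadraticMap.polar (QuadraticMap.weightedSumSquares k (vecCons a w'))
        (g (vecCons 0 x)) (g e) =
        QuadraticMap.polar (QuadraticMap.weightedSumSquares k (vecCons a w)) (vecCons 0 x) e := by
      simp only [QuadraticMap.polar, ← map_add, QuadraticMap.IsometryEquiv.map_app]
    rw [hge, polar_weightedSumSquares, polar_weightedSumSquares] at hp
    simp only [dotProduct, mulVec_diagonal, Fin.sum_univ_succ, e, cons_val_zero, cons_val_succ,
      Pi.zero_apply, mul_zero, mul_one, zero_mul, Finset.sum_const_zero, add_zero] at hp
    rcases mul_eq_zero.mp hp with h | h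
    · exact absurd h (NeZero.ne _)
    · exact (mul_eq_zero.mp h).resolve_right ha
  have hg : ∀ x : Fin m → k, g (vecCons 0 x) = vecCons 0 (vecTail (g (vecCons 0 x))) := by
    intro x
    conv_lhs => rw [← cons_head_tail (g (vecCons 0 x))]
    congr 1
    exact hzero x
  let l : (Fin m → k) →ₗ[k] (Fin m → k) :=
    { toFun := fun x => vecTail (g (vecCons 0 x))
      map_add' := fun x y => by
        have : (vecCons 0 (x + y) : Fin (m + 1) → k) = vecCons 0 x + vecCons 0 y := by simp
        rw [this, map_add]; rfl
      map_smul' := fun c x => by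
        have : (vecCons 0 (c • x) : Fin (m + 1) → k) = c • vecCons 0 x := by simp
        rw [this, map_smul]; rfl }
  have hinj : Function.Injective l := by
    intro x y hxy
    have h1 : g (vecCons 0 x) = g (vecCons 0 y) := by
      rw [hg x, hg y]; exact congrArg (vecCons 0) hxy
    exact (vecCons_inj.mp (g.toLinearEquiv.injective h1)).2
  refine ⟨⟨LinearEquiv.ofInjectiveEndo l hinj, fun x => ?_⟩⟩
  change QuadraticMap.weightedSumSquares k w' (vecTail (g (vecCons 0 x))) = _
  have h1 := g.map_app (vecCons 0 x)
  rw [hg x, hcons, hcons] at h1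
  simpa using h1

end DiagonalForms

/-! ### Composition algebras of dimension four -/

section QuaternionTable

variable {k C : Type*} [Field k] [NonAssocRing C] [Module k C]
  [IsScalarTower k C C] [SMulCommClass k C C] (N : QuadraticForm k C) [hN : IsComposition N]

/-- Left multiplication by x̄ is adjoint to left multiplication by x, so both sides pair equally
with every z; non-degeneracy concludes. This and its mirror image stand in for associativity below.
-/
theorem conj_mul_mul_self (x y : C) : conj N x * (x * y) = N x • y := by
  rw [← sub_eq_zero]
  refine hN.nondegenerate _ fun z => ?_
  rw [QuadraticMap.polar_sub_left, polar_mul_eq_left, conj_conj, polar_mul_left,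
    QuadraticMap.polar_smul_left, smul_eq_mul, sub_self]

theorem mul_self_mul_conj (x y : C) : y * x * conj N x = N x • y := by
  have h := congrArg (conj N) (conj_mul_mul_self N (conj N x) (conj N y))
  rw [Freud.conj_mul, Freud.conj_mul, conj_conj, conj_conj, map_smul, conj_conj] at h
  rw [h]
  congr 1
  rw [← sub_eq_zero]
  -- Both norms are read off from x x̄ and x̄ x, which agree since x̄ is a scalar minus x.
  have hx : N (conj N x) • (1 : C) = N x • 1 := by
    have h1 := conj_mul_mul_self N (conj N x) 1
    have h2 := conj_mul_mul_self N x 1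
    rw [mul_one, conj_conj] at h1
    rw [mul_one] at h2
    rw [← h1, ← h2, conj_apply, sub_mul, mul_sub, smul_mul_assoc, mul_smul_comm, one_mul, mul_one]
  rw [← sub_eq_zero, ← sub_smul] at hx
  have := hN.nontrivial
  exact (smul_eq_zero.mp hx).resolve_right one_ne_zero

variable {N}

theorem conj_eq_neg {x : C} (hx : QuadraticMap.polar N x 1 = 0) : conj N x = -x := by
  rw [conj_apply, hx, zero_smul, zero_sub]

theorem mul_mul_self_of_pure {x : C} (hx : QuadraticMap.polar N x 1 = 0) (y : C) :
    x * (x * y) = -N x • y := by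
  have := conj_mul_mul_self N x y
  rw [conj_eq_neg hx, neg_mul] at this
  rw [neg_smul, ← this, neg_neg]

theorem mul_self_mul_of_pure {x : C} (hx : QuadraticMap.polar N x 1 = 0) (y : C) :
    y * x * x = -N x • y := by
  have := mul_self_mul_conj N x y
  rw [conj_eq_neg hx, mul_neg] at this
  rw [neg_smul, ← this, neg_neg]

theorem mul_self_of_pure {x : C} (hx : QuadraticMap.polar N x 1 = 0) :
    x * x = -N x • (1 : C) := by
  simpa using mul_mul_self_of_pure hx 1

/-- Linearization of x² = −N(x) on the pure elements. -/
theorem mul_comm_neg_of_pure {x y : C} (hx : QuadraticMap.polar N x 1 = 0)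
    (hy : QuadraticMap.polar N y 1 = 0) (hxy : QuadraticMap.polar N x y = 0) :
    y * x = -(x * y) := by
  have h1 : QuadraticMap.polar N (x + y) 1 = 0 := by
    rw [QuadraticMap.polar_add_left, hx, hy, add_zero]
  have h := mul_self_of_pure h1
  rw [QuadraticMap.map_add N, hxy, add_zero, mul_add, add_mul, add_mul, mul_self_of_pure hx,
    mul_self_of_pure hy] at h
  have h2 : y * x + x * y = 0 := by
    have : y * x + x * y = -N x • (1 : C) + y * x + (x * y + -N y • 1) -
      (-N x • (1 : C) + -N y • 1) := by abel
    rw [this, h]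
    module
  exact eq_neg_of_add_eq_zero_left h2

theorem polar_one_one : QuadraticMap.polar N (1 : C) 1 = 2 := by
  rw [QuadraticMap.polar_self, map_one_eq, nsmul_eq_mul, Nat.cast_ofNat, mul_one]

open Quaternion in
/-- The linear map `ℍ[k, -N i, -N j] → C` sending the standard basis to `1, i, j, ij`. -/
def ofQuaternion (N : QuadraticForm k C) (i j : C) : ℍ[k, -N i, 0, -N j] →ₗ[k] C where
  toFun q := q.re • (1 : C) + q.imI • i + q.imJ • j + q.imK • (i * j)
  map_add' p q := by
    simp only [QuaternionAlgebra.re_add, QuaternionAlgebra.imI_add,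
      QuaternionAlgebra.imJ_add, QuaternionAlgebra.imK_add]
    module
  map_smul' c q := by
    simp only [QuaternionAlgebra.re_smul, QuaternionAlgebra.imI_smul, QuaternionAlgebra.imJ_smul,
      QuaternionAlgebra.imK_smul, RingHom.id_apply, smul_eq_mul]
    module

theorem ofQuaternion_apply (i j : C) (q) :
    ofQuaternion N i j q = q.re • (1 : C) + q.imI • i + q.imJ • j + q.imK • (i * j) := rfl

theorem polar_mul_basis {i j : C} (hi : QuadraticMap.polar N i 1 = 0)
    (hj : QuadraticMap.polar N j 1 = 0) (hij : QuadraticMap.polar N i j = 0) :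
    QuadraticMap.polar N (i * j) 1 = 0 ∧ QuadraticMap.polar N (i * j) i = 0 ∧
      QuadraticMap.polar N (i * j) j = 0 := by
  refine ⟨?_, ?_, ?_⟩
  · rw [polar_mul_eq_left, mul_one, conj_eq_neg hi, QuadraticMap.polar_neg_right,
      QuadraticMap.polar_comm, hij, neg_zero]
  · have := polar_mul_left N i j 1
    rwa [mul_one, hj, mul_zero] at this
  · rw [polar_mul_eq_right, conj_eq_neg hj, mul_neg, mul_self_of_pure hj,
      QuadraticMap.polar_neg_right, QuadraticMap.polar_smul_right, hi, smul_zero, neg_zero]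

/-- The whole multiplication table of 1, i, j, ij is forced by the alternative laws for pure
elements and by ji = −ij; no associativity is needed. -/
theorem ofQuaternion_mul {i j : C} (hi : QuadraticMap.polar N i 1 = 0)
    (hj : QuadraticMap.polar N j 1 = 0) (hij : QuadraticMap.polar N i j = 0) (p q) :
    ofQuaternion N i j (p * q) = ofQuaternion N i j p * ofQuaternion N i j q := by
  have hji := mul_comm_neg_of_pure hi hj hij
  have hki : i * j * i = N i • j := by
    rw [← neg_neg (i * j), ← hji, neg_mul, mul_self_mul_of_pure hi, neg_smul, neg_neg]
  have hjk : j * (i * j) = N j • i := by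
    rw [← neg_neg (i * j), ← hji, mul_neg, mul_mul_self_of_pure hj, neg_smul, neg_neg]
  obtain ⟨hk1, -, -⟩ := polar_mul_basis hi hj hij
  simp only [ofQuaternion_apply, QuaternionAlgebra.re_mul, QuaternionAlgebra.imI_mul,
    QuaternionAlgebra.imJ_mul, QuaternionAlgebra.imK_mul, add_mul, mul_add, smul_mul_assoc,
    mul_smul_comm, one_mul, mul_one, mul_self_of_pure hi, mul_self_of_pure hj, hji, hki, hjk,
    mul_mul_self_of_pure hi, mul_self_mul_of_pure hj, mul_self_of_pure hk1, hN.map_mul]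
  module

theorem map_ofQuaternion {i j : C} (hi : QuadraticMap.polar N i 1 = 0)
    (hj : QuadraticMap.polar N j 1 = 0) (hij : QuadraticMap.polar N i j = 0) (q) :
    N (ofQuaternion N i j q) =
      QuadraticMap.weightedSumSquares k ![1, N i, N j, N i * N j]
        ![q.re, q.imI, q.imJ, q.imK] := by
  have h1 := map_one_eq N
  obtain ⟨hk1, hki, hkj⟩ := polar_mul_basis hi hj hij
  rw [QuadraticMap.polar_comm] at hk1 hki hkj hi hj
  rw [ofQuaternion_apply]
  simp only [QuadraticMap.map_add N, QuadraticMap.map_smul, QuadraticMap.polar_add_left,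
    QuadraticMap.polar_smul_left, QuadraticMap.polar_smul_right, smul_eq_mul, h1, hki, hkj, hij,
    hi, hj, hk1, hN.map_mul, QuadraticMap.weightedSumSquares_apply, Fin.sum_univ_four]
  simp
  ring

/-- The elements 1, i, j, ij are pairwise orthogonal and anisotropic, so pairing a relation with
each of them isolates one coefficient. -/
theorem ofQuaternion_injective [NeZero (2 : k)] {i j : C} (hi : QuadraticMap.polar N i 1 = 0)
    (hj : QuadraticMap.polar N j 1 = 0) (hij : QuadraticMap.polar N i j = 0)
    (hNi : N i ≠ 0) (hNj : N j ≠ 0) : Function.Injective (ofQuaternion N i j) := by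
  have h2 := NeZero.ne (2 : k)
  rw [← LinearMap.ker_eq_bot, LinearMap.ker_eq_bot']
  intro q hq
  obtain ⟨hk1, hki, hkj⟩ := polar_mul_basis hi hj hij
  have hi' := hi
  have hj' := hj
  have hij' := hij
  have hk1' := hk1
  have hki' := hki
  have hkj' := hkj
  rw [QuadraticMap.polar_comm] at hk1' hki' hkj' hi' hj' hij'
  have key : ∀ y, QuadraticMap.polar N (ofQuaternion N i j q) y = 0 := by
    intro y; rw [hq, QuadraticMap.polar_zero_left]
  have e1 := key 1
  have e2 := key i
  have e3 := key j
  have e4 := key (i * j)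
  simp only [ofQuaternion_apply, QuadraticMap.polar_add_left, QuadraticMap.polar_smul_left, hi, hj,
    hij, hk1, hki, hkj, hi', hj', hij', hk1', hki', hkj', QuadraticMap.polar_self, map_one_eq N,
    hN.map_mul, nsmul_eq_mul, smul_eq_mul, mul_zero, add_zero, zero_add, Nat.cast_ofNat,
    mul_eq_zero, hNi, hNj, h2, one_ne_zero, or_false] at e1 e2 e3 e4
  ext <;> assumption

theorem algIso_quaternion [NeZero (2 : k)] {i j : C} (hi : QuadraticMap.polar N i 1 = 0)
    (hj : QuadraticMap.polar N j 1 = 0) (hij : QuadraticMap.polar N i j = 0)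
    (hNi : N i ≠ 0) (hNj : N j ≠ 0) (hfin : Module.finrank k C = 4) :
    AlgIso k (QuaternionAlgebra k (-N i) 0 (-N j)) C := by
  have : Module.Finite k C := Module.finite_of_finrank_pos (by omega)
  have hinj := ofQuaternion_injective hi hj hij hNi hNj
  have hsurj := (LinearMap.injective_iff_surjective_of_finrank_eq_finrank
      (by rw [hfin, QuaternionAlgebra.finrank_eq_four])).mp hinj
  exact ⟨{ toFun := ofQuaternion N i j
           map_smul' := fun c q => map_smul _ c q
           map_zero' := map_zero _
           map_add' := map_add _
           map_mul' := ofQuaternion_mul hi hj hij }, hinj, hsurj⟩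

theorem equivalent_norm_diagForm [NeZero (2 : k)] {i j : C}
    (hi : QuadraticMap.polar N i 1 = 0)
    (hj : QuadraticMap.polar N j 1 = 0) (hij : QuadraticMap.polar N i j = 0)
    (hNi : N i ≠ 0) (hNj : N j ≠ 0) (hfin : Module.finrank k C = 4) :
    QuadraticMap.Equivalent N
      (QuadraticMap.weightedSumSquares k ![1, N i, N j, N i * N j]) := by
  have : Module.Finite k C := Module.finite_of_finrank_pos (by omega)
  let f := (LinearEquiv.ofInjectiveOfFinrankEq (ofQuaternion N i j)
    (ofQuaternion_injective hi hj hij hNi hNj)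
      (by rw [hfin, QuaternionAlgebra.finrank_eq_four]))
  refine QuadraticMap.Equivalent.symm
    ⟨⟨(QuaternionAlgebra.linearEquivTuple (-N i) 0 (-N j)).symm.trans f, fun x => ?_⟩⟩
  obtain ⟨q, rfl⟩ := (QuaternionAlgebra.linearEquivTuple (-N i) 0 (-N j)).surjective x
  change N (f ((QuaternionAlgebra.linearEquivTuple (-N i) 0 (-N j)).symm
    (QuaternionAlgebra.linearEquivTuple (-N i) 0 (-N j) q))) = _
  rw [LinearEquiv.symm_apply_apply]
  exact map_ofQuaternion hi hj hij q

/-- A composition algebra of dimension four contains two orthogonal anisotropic pure elements. -/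
theorem exists_orthogonal_pure [NeZero (2 : k)] (hfin : Module.finrank k C = 4) :
    ∃ i j : C, QuadraticMap.polar N i 1 = 0 ∧ QuadraticMap.polar N j 1 = 0 ∧
      QuadraticMap.polar N i j = 0 ∧ N i ≠ 0 ∧ N j ≠ 0 := by
  have h2 := NeZero.ne (2 : k)
  have : Module.Finite k C := Module.finite_of_finrank_pos (by omega)
  have pol : ∀ (p : C → Prop), (∀ x y, p x → p y → p (x + y)) → (∀ x, p x → N x = 0) →
      ∀ x y, p x → p y → QuadraticMap.polar N x y = 0 := by
    intro p hp h0 x y hx hy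
    rw [QuadraticMap.polar, h0 _ (hp x y hx hy), h0 x hx, h0 y hy]; ring
  obtain ⟨i, hi, hNi⟩ : ∃ i, QuadraticMap.polar N i 1 = 0 ∧ N i ≠ 0 := by
    -- Otherwise N, hence its polar form, vanishes on the pure elements. A nonzero pure x is then
    -- orthogonal to all pure elements and to 1, hence to all of C.
    by_contra! hcon
    have hker : LinearMap.ker (N.polarBilin.flip 1) ≠ ⊥ :=
      LinearMap.ker_ne_bot_of_finrank_lt (by rw [hfin, Module.finrank_self]; norm_num)
    obtain ⟨x, hx, hx0⟩ := (Submodule.ne_bot_iff _).mp hker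
    have hx1 : QuadraticMap.polar N x 1 = 0 := hx
    refine hx0 (hN.nondegenerate x fun y => ?_)
    have := pol (fun z => QuadraticMap.polar N z 1 = 0)
      (fun a b ha hb => by rw [QuadraticMap.polar_add_left, ha, hb, add_zero]) hcon x
      (y - (QuadraticMap.polar N y 1 / 2) • 1) hx1
      (by rw [QuadraticMap.polar_sub_left, QuadraticMap.polar_smul_left, polar_one_one,
            smul_eq_mul, div_mul_cancel₀ _ h2, sub_self])
    rwa [QuadraticMap.polar_sub_right, QuadraticMap.polar_smul_right, hx1, smul_zero,
      sub_zero] at this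
  obtain ⟨j, ⟨hj, hij⟩, hNj⟩ : ∃ j, (QuadraticMap.polar N j 1 = 0 ∧
      QuadraticMap.polar N j i = 0) ∧ N j ≠ 0 := by
    by_contra! hcon
    -- The same argument in the orthogonal complement of 1 and i, with a general y projected off
    -- both.
    have hker : LinearMap.ker ((N.polarBilin.flip 1).prod (N.polarBilin.flip i)) ≠ ⊥ :=
      LinearMap.ker_ne_bot_of_finrank_lt (by
        rw [hfin, Module.finrank_prod, Module.finrank_self]; norm_num)
    obtain ⟨x, hx, hx0⟩ := (Submodule.ne_bot_iff _).mp hker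
    obtain ⟨hx1, hxi⟩ : QuadraticMap.polar N x 1 = 0 ∧ QuadraticMap.polar N x i = 0 := by
      simpa using hx
    refine hx0 (hN.nondegenerate x fun y => ?_)
    have := pol (fun z => QuadraticMap.polar N z 1 = 0 ∧ QuadraticMap.polar N z i = 0)
      (fun a b ha hb => by
        simp only [QuadraticMap.polar_add_left, ha, hb, add_zero, and_self])
      hcon x (y - (QuadraticMap.polar N y 1 / 2) • 1 - (QuadraticMap.polar N y i / (2 * N i)) • i)
      ⟨hx1, hxi⟩ (by
        have hi' := hi
        rw [QuadraticMap.polar_comm] at hi'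
        simp only [QuadraticMap.polar_sub_left, QuadraticMap.polar_smul_left, map_one_eq N,
          smul_eq_mul, hi, hi', QuadraticMap.polar_self, nsmul_eq_mul, Nat.cast_ofNat]
        constructor <;> field_simp <;> ring)
    rwa [QuadraticMap.polar_sub_right, QuadraticMap.polar_sub_right, QuadraticMap.polar_smul_right,
      QuadraticMap.polar_smul_right, hx1, hxi, smul_zero, smul_zero, sub_zero, sub_zero] at this
  exact ⟨i, j, hi, hj, by rwa [QuadraticMap.polar_comm], hNi, hNj⟩

end QuaternionTable

/-! ### Isomorphism of quaternion algebras and isometry of norm forms. -/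

section QuaternionIsomorphism

variable {k C C' : Type*} [Field k] [NonAssocRing C] [Module k C]
  [IsScalarTower k C C] [SMulCommClass k C C] [NonAssocRing C'] [Module k C']
  [IsScalarTower k C' C'] [SMulCommClass k C' C'] (N : QuadraticForm k C) [hN : IsComposition N]
  (N' : QuadraticForm k C') [hN' : IsComposition N']

theorem mul_self_eq (x : C) : x * x = QuadraticMap.polar N x 1 • x - N x • (1 : C) := by
  have h := conj_mul_mul_self N x 1
  rw [mul_one, conj_apply, sub_mul, smul_mul_assoc, one_mul] at h
  rw [← h, sub_sub_cancel]

/-- Isomorphisms of composition algebras preserve the norm. -/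
theorem norm_map_of_bijective (f : C →ₙₐ[k] C') (hf : Function.Bijective f) (x : C) :
    N' (f x) = N x := by
  have := hN'.nontrivial
  have h1 : f 1 = 1 := by
    obtain ⟨y, hy⟩ := hf.2 1
    rw [← mul_one (f 1), ← hy, ← map_mul, one_mul]
  have e1 := mul_self_eq N' (f x)
  have e2 := congrArg f (mul_self_eq N x)
  rw [map_mul, map_sub, map_smul, map_smul, h1, e1] at e2
  have e3 : (QuadraticMap.polar N' (f x) 1 - QuadraticMap.polar N x 1) • f x =
      (N' (f x) - N x) • (1 : C') := by
    rw [sub_smul, sub_smul, sub_eq_sub_iff_sub_eq_sub, e2]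
  -- The quadratic equations of x and of f x have been subtracted. If the traces agree, so do the
  -- norms; otherwise f x is a scalar, and so is x by injectivity, with the same value.
  by_cases ht : QuadraticMap.polar N' (f x) 1 - QuadraticMap.polar N x 1 = 0
  · rw [ht, zero_smul] at e3
    exact sub_eq_zero.mp ((smul_eq_zero.mp e3.symm).resolve_right one_ne_zero)
  · obtain ⟨c, hc⟩ : ∃ c : k, f x = c • (1 : C') :=
      ⟨(QuadraticMap.polar N' (f x) 1 - QuadraticMap.polar N x 1)⁻¹ * (N' (f x) - N x), by
        rw [mul_smul, ← e3, smul_smul, inv_mul_cancel₀ ht, one_smul]⟩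
    have hx : x = c • (1 : C) := hf.1 (by rw [hc, map_smul, h1])
    rw [hc, hx, QuadraticMap.map_smul, QuadraticMap.map_smul, map_one_eq, map_one_eq]

theorem equivalent_norm_of_algIso (h : AlgIso k C C') : QuadraticMap.Equivalent N N' := by
  obtain ⟨f, hf⟩ := h
  exact ⟨⟨LinearEquiv.ofBijective (f : C →ₗ[k] C') hf, fun x => norm_map_of_bijective N N' f hf x⟩⟩

/-- An isometry f need not fix 1, but f 1 has norm 1, and left multiplication by its conjugate
corrects this. The corrected isometry carries an orthogonal pure pair to an orthogonal pure pair
with the same norms, so both algebras have the same quaternion table. -/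
theorem algIso_of_equivalent_norm [NeZero (2 : k)] (hfin : Module.finrank k C = 4)
    (h : QuadraticMap.Equivalent N N') : AlgIso k C C' := by
  obtain ⟨f⟩ := h
  have hfin' : Module.finrank k C' = 4 := by rw [← f.toLinearEquiv.finrank_eq, hfin]
  obtain ⟨i, j, hi, hj, hij, hNi, hNj⟩ := exists_orthogonal_pure (N := N) hfin
  have hu : N' (f 1) = 1 := by rw [f.map_app, map_one_eq]
  let g : C →ₗ[k] C' := (LinearMap.mulLeft k (conj N' (f 1))).comp f.toLinearEquiv.toLinearMap
  have hg1 : g 1 = 1 := by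
    have := conj_mul_mul_self N' (f 1) 1
    rwa [mul_one, hu, one_smul] at this
  have hNu : N' (conj N' (f 1)) = 1 := by
    have := congrArg N' hg1
    change N' (conj N' (f 1) * f 1) = N' 1 at this
    rwa [hN'.map_mul, hu, mul_one, map_one_eq] at this
  have hg : ∀ x, N' (g x) = N x := fun x => by
    change N' (conj N' (f 1) * f x) = N x
    rw [hN'.map_mul, hNu, one_mul, f.map_app]
  have hpol : ∀ x y, QuadraticMap.polar N' (g x) (g y) = QuadraticMap.polar N x y := fun x y => by
    simp only [QuadraticMap.polar, ← map_add, hg]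
  have := algIso_quaternion (N := N') (i := g i) (j := g j) (by rw [← hg1, hpol, hi])
    (by rw [← hg1, hpol, hj]) (by rw [hpol, hij]) (by rwa [hg]) (by rwa [hg]) hfin'
  rw [hg, hg] at this
  exact (algIso_quaternion hi hj hij hNi hNj hfin).symm.trans this

end QuaternionIsomorphism

/-! ### Quaternion algebras classified by the forms ⟨1, a, b, ab⟩. -/

section QuaternionClasses

variable {k : Type u} [Field k] [NeZero (2 : k)]

theorem quatSetoid_iff (Q Q' : QuatAlg k) :
    (quatSetoid k).r Q Q' ↔ QuadraticMap.Equivalent Q.norm Q'.norm := by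
  have := Q.isComposition
  have := Q'.isComposition
  exact ⟨equivalent_norm_of_algIso _ _, algIso_of_equivalent_norm _ _ Q.finrank_eq⟩

theorem exists_norm_equivalent_diagForm (Q : QuatAlg k) :
    ∃ a b : k, a ≠ 0 ∧ b ≠ 0 ∧ QuadraticMap.Equivalent Q.norm (diagForm 1 a b (a * b)) := by
  have := Q.isComposition
  obtain ⟨i, j, hi, hj, hij, hNi, hNj⟩ := exists_orthogonal_pure (N := Q.norm) Q.finrank_eq
  exact ⟨_, _, hNi, hNj, equivalent_norm_diagForm hi hj hij hNi hNj Q.finrank_eq⟩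

/-- The norm form `⟨1, a, b, ab⟩` of the quaternion algebra `ℍ[k, -a, -b]`. -/
def quaternionNorm (a b : k) : QuadraticForm k (QuaternionAlgebra k (-a) 0 (-b)) :=
  (diagForm 1 a b (a * b)).comp (QuaternionAlgebra.linearEquivTuple (-a) 0 (-b)).toLinearMap

theorem quaternionNorm_apply (a b : k) (q : QuaternionAlgebra k (-a) 0 (-b)) :
    quaternionNorm a b q = q.re ^ 2 + a * q.imI ^ 2 + b * q.imJ ^ 2 + a * b * q.imK ^ 2 := by
  change diagForm 1 a b (a * b) ![q.re, q.imI, q.imJ, q.imK] = _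
  simp [QuadraticMap.weightedSumSquares_apply, Fin.sum_univ_four]
  ring

theorem isComposition_quaternionNorm {a b : k} (ha : a ≠ 0) (hb : b ≠ 0) :
    IsComposition (quaternionNorm a b) where
  nontrivial := inferInstance
  nondegenerate x h := by
    have h2 := NeZero.ne (2 : k)
    have e1 := h ⟨1, 0, 0, 0⟩
    have e2 := h ⟨0, 1, 0, 0⟩
    have e3 := h ⟨0, 0, 1, 0⟩
    have e4 := h ⟨0, 0, 0, 1⟩
    simp only [QuadraticMap.polar, quaternionNorm_apply, QuaternionAlgebra.re_add,
      QuaternionAlgebra.imI_add, QuaternionAlgebra.imJ_add, QuaternionAlgebra.imK_add] at e1 e2 e3 e4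
    ext
    · exact (mul_eq_zero.mp (by linear_combination e1 : 2 * x.re = 0)).resolve_left h2
    · exact (mul_eq_zero.mp (by linear_combination e2 : 2 * a * x.imI = 0)).resolve_left
        (mul_ne_zero h2 ha)
    · exact (mul_eq_zero.mp (by linear_combination e3 : 2 * b * x.imJ = 0)).resolve_left
        (mul_ne_zero h2 hb)
    · exact (mul_eq_zero.mp (by linear_combination e4 : 2 * (a * b) * x.imK = 0)).resolve_left
        (mul_ne_zero h2 (mul_ne_zero ha hb))
  map_mul x y := by
    simp only [quaternionNorm_apply, QuaternionAlgebra.re_mul, QuaternionAlgebra.imI_mul,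
      QuaternionAlgebra.imJ_mul, QuaternionAlgebra.imK_mul]
    ring

theorem exists_quatAlg_norm_equivalent {a b : k} (ha : a ≠ 0) (hb : b ≠ 0) :
    ∃ Q : QuatAlg k, QuadraticMap.Equivalent Q.norm (diagForm 1 a b (a * b)) :=
  ⟨{ carrier := QuaternionAlgebra k (-a) 0 (-b)
     norm := quaternionNorm a b
     isComposition := isComposition_quaternionNorm ha hb
     finrank_eq := QuaternionAlgebra.finrank_eq_four _ _ _ },
    ⟨⟨QuaternionAlgebra.linearEquivTuple (-a) 0 (-b), fun _ => rfl⟩⟩⟩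

/-- A family of quaternary forms that are the norm forms of the quaternion algebras classifies its
parameters by quaternion algebras. -/
theorem exists_equiv_quatClasses {α : Type*} (s : Setoid α)
    (F : α → QuadraticForm k (Fin 4 → k))
    (hs : ∀ x y, s.r x y ↔ QuadraticMap.Equivalent (F x) (F y))
    (hF : ∀ x, ∃ Q : QuatAlg k, QuadraticMap.Equivalent Q.norm (F x))
    (hQ : ∀ Q : QuatAlg k, ∃ x, QuadraticMap.Equivalent Q.norm (F x)) :
    ∃ Φ : Quotient s ≃ QuatClasses k, ∀ (x : α) (Q : QuatAlg k),
      Φ (Quotient.mk s x) = Quotient.mk (quatSetoid k) Q ↔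
        QuadraticMap.Equivalent Q.norm (F x) := by
  choose R hR using hF
  let φ : Quotient s → QuatClasses k := Quotient.lift (fun x => Quotient.mk (quatSetoid k) (R x))
    fun x y h => Quotient.sound ((quatSetoid_iff _ _).mpr
      ((hR x).trans (((hs x y).mp h).trans (hR y).symm)))
  have hφ : ∀ x Q, φ (Quotient.mk s x) = Quotient.mk (quatSetoid k) Q ↔
      QuadraticMap.Equivalent Q.norm (F x) := by
    intro x Q
    change Quotient.mk (quatSetoid k) (R x) = Quotient.mk (quatSetoid k) Q ↔ _
    rw [Quotient.eq]
    refine (quatSetoid_iff _ _).trans ⟨fun h => h.symm.trans (hR x), fun h => (hR x).trans h.symm⟩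
  refine ⟨Equiv.ofBijective φ ⟨?_, ?_⟩, hφ⟩
  · intro x y
    induction x, y using Quotient.inductionOn₂ with
    | _ x y =>
      intro h
      exact Quotient.sound ((hs x y).mpr ((hR x).symm.trans
        ((hφ y (R x)).mp h.symm)))
  · intro q
    induction q using Quotient.inductionOn with
    | _ Q =>
      obtain ⟨x, hx⟩ := hQ Q
      exact ⟨Quotient.mk s x, (hφ x Q).mpr hx⟩

end QuaternionClasses

/-! ### The algebras `H₃(k, Γ)` -/

section H3Algebra

instance {k C : Type*} [Field k] [NonAssocRing C] [Module k C] [IsScalarTower k C C]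
    [SMulCommClass k C C] (N : QuadraticForm k C) [IsComposition N] (γ : Fin 3 → kˣ) :
    IsScalarTower k (H3 N γ) (H3 N γ) where
  smul_assoc c X Y := by
    apply Subtype.ext
    simp only [smul_eq_mul, coe_mul, Submodule.coe_smul, Matrix.smul_mul, Matrix.mul_smul,
      ← smul_add]
    rw [smul_comm]

instance {k C : Type*} [Field k] [NonAssocRing C] [Module k C] [IsScalarTower k C C]
    [SMulCommClass k C C] (N : QuadraticForm k C) [IsComposition N] (γ : Fin 3 → kˣ) :
    SMulCommClass k (H3 N γ) (H3 N γ) where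
  smul_comm c X Y := by
    apply Subtype.ext
    simp only [smul_eq_mul, coe_mul, Submodule.coe_smul, Matrix.smul_mul, Matrix.mul_smul,
      ← smul_add]
    rw [smul_comm]

variable {k : Type u} [Field k]

theorem conj_sq (x : k) : conj (QuadraticMap.sq : QuadraticForm k k) x = x := by
  simp only [conj_apply, QuadraticMap.polar, QuadraticMap.sq_apply, smul_eq_mul]
  ring

theorem mem_H3k_iff (γ : Fin 3 → kˣ) (Y : Matrix (Fin 3) (Fin 3) k) :
    Y ∈ H3k γ ↔ ∀ i j, (γ i : k) * Y i j = γ j * Y j i := by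
  change starGamma _ γ Y = Y ↔ _
  constructor
  · intro h i j
    have := congrFun (congrFun h i) j
    simp only [starGamma, Matrix.of_apply, conj_sq, smul_eq_mul] at this
    rw [← this]
    simp [mul_assoc]
  · intro h
    ext i j
    simp only [starGamma, Matrix.of_apply, conj_sq, smul_eq_mul, Units.val_mul, mul_assoc, ← h]
    simp

theorem mem_H3k_iff_matrix (γ : Fin 3 → kˣ) {c : k} (hc : c ≠ 0) (Y : Matrix (Fin 3) (Fin 3) k) :
    Y ∈ H3k γ ↔
      Y.transpose * Matrix.diagonal (fun i => c * γ i) =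
        Matrix.diagonal (fun i => c * γ i) * Y := by
  rw [mem_H3k_iff, ← Matrix.ext_iff]
  simp only [Matrix.mul_diagonal, Matrix.diagonal_mul, Matrix.transpose_apply]
  constructor
  · intro h i j
    rw [mul_assoc, h i j]; ring
  · intro h i j
    refine mul_left_cancel₀ hc ?_
    rw [← mul_assoc, ← h i j]; ring

/-- The entries of an element of `H₃(k, Γ)` on and above (cyclically) the diagonal. -/
def h3Equiv (γ : Fin 3 → kˣ) : H3k γ ≃ₗ[k] (Fin 6 → k) where
  toFun Y := ![Y.1 0 0, Y.1 1 1, Y.1 2 2, Y.1 1 2, Y.1 2 0, Y.1 0 1]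
  map_add' Y Z := by simp
  map_smul' c Y := by simp
  invFun x := ⟨!![x 0, x 5, γ 2 / γ 0 * x 4; γ 0 / γ 1 * x 5, x 1, x 3;
      x 4, γ 1 / γ 2 * x 3, x 2], by
    rw [mem_H3k_iff]
    intro i j
    fin_cases i <;> fin_cases j <;> simp <;> field_simp⟩
  left_inv Y := by
    have h := (mem_H3k_iff γ Y.1).mp Y.2
    apply Subtype.ext
    have h1 := h 0 1
    have h2 := h 1 2
    have h3 := h 2 0
    ext i j
    fin_cases i <;> fin_cases j <;> simp <;> field_simp <;> assumption
  right_inv x := by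
    ext i
    fin_cases i <;> rfl

theorem h3Equiv_apply (γ : Fin 3 → kˣ) (Y : H3k γ) :
    h3Equiv γ Y = ![Y.1 0 0, Y.1 1 1, Y.1 2 2, Y.1 1 2, Y.1 2 0, Y.1 0 1] := rfl

theorem coe_h3Equiv_symm (γ : Fin 3 → kˣ) (x : Fin 6 → k) :
    ((h3Equiv γ).symm x).1 = !![x 0, x 5, γ 2 / γ 0 * x 4; γ 0 / γ 1 * x 5, x 1, x 3;
      x 4, γ 1 / γ 2 * x 3, x 2] := rfl

theorem finrank_H3k (γ : Fin 3 → kˣ) : Module.finrank k (H3k γ) = 6 := by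
  rw [(h3Equiv γ).finrank_eq]; simp

instance (γ : Fin 3 → kˣ) : Module.Finite k (H3k γ) := Module.Finite.equiv (h3Equiv γ).symm

/-- This expresses the matrix trace through the algebra structure alone, so that isomorphisms and
scalar extension respect it. -/
theorem trace_mulLeft_H3k [NeZero (2 : k)] (γ : Fin 3 → kˣ) (Y : H3k γ) :
    LinearMap.trace k (H3k γ) (LinearMap.mulLeft k Y) = 2 * Matrix.trace Y.1 := by
  have h2 := NeZero.ne (2 : k)
  rw [LinearMap.trace_eq_matrix_trace k (Module.Basis.ofEquivFun (h3Equiv γ))]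
  have key : ∀ i, LinearMap.toMatrix (Module.Basis.ofEquivFun (h3Equiv γ))
      (Module.Basis.ofEquivFun (h3Equiv γ)) (LinearMap.mulLeft k Y) i i =
      h3Equiv γ (Y * (h3Equiv γ).symm (Pi.single i 1)) i := by
    intro i
    rw [LinearMap.toMatrix_apply]
    simp
  simp only [Matrix.trace, Matrix.diag, key, Fin.sum_univ_six, Fin.sum_univ_three]
  simp [h3Equiv_apply, coe_h3Equiv_symm, coe_mul, Matrix.mul_apply, Fin.sum_univ_three,
    Matrix.vecMul, dotProduct]
  field_simp
  ring

theorem trace_mul_self_H3k (γ : Fin 3 → kˣ) (Y : H3k γ) :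
    Matrix.trace (Y.1 * Y.1) = QuadraticMap.weightedSumSquares k
      ![1, 1, 1, 2 * (γ 1 / γ 2 : k), 2 * (γ 2 / γ 0), 2 * (γ 0 / γ 1)] (h3Equiv γ Y) := by
  have h := (mem_H3k_iff γ Y.1).mp Y.2
  have h1 := h 0 1
  have h2 := h 1 2
  have h3 := h 2 0
  simp only [QuadraticMap.weightedSumSquares_apply, Fin.sum_univ_six, Matrix.trace, Matrix.diag,
    Matrix.mul_apply, Fin.sum_univ_three]
  have e1 : Y.1 1 0 = γ 0 / γ 1 * Y.1 0 1 := by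
    rw [div_mul_eq_mul_div, eq_div_iff (by simp)]; linear_combination -h1
  have e2 : Y.1 2 1 = γ 1 / γ 2 * Y.1 1 2 := by
    rw [div_mul_eq_mul_div, eq_div_iff (by simp)]; linear_combination -h2
  have e3 : Y.1 0 2 = γ 2 / γ 0 * Y.1 2 0 := by
    rw [div_mul_eq_mul_div, eq_div_iff (by simp)]; linear_combination -h3
  simp [h3Equiv_apply, e1, e2, e3]
  ring

theorem equivalent_vecCons {m : ℕ} (a : k) {w w' : Fin m → k}
    (h : QuadraticMap.Equivalent (QuadraticMap.weightedSumSquares k w)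
      (QuadraticMap.weightedSumSquares k w')) :
    QuadraticMap.Equivalent (QuadraticMap.weightedSumSquares k (Matrix.vecCons a w))
      (QuadraticMap.weightedSumSquares k (Matrix.vecCons a w')) := by
  obtain ⟨f⟩ := h
  refine ⟨⟨{ toFun := fun x => Matrix.vecCons (x 0) (f (Matrix.vecTail x))
             invFun := fun x => Matrix.vecCons (x 0) (f.symm (Matrix.vecTail x))
             map_add' := fun x y => ?_
             map_smul' := fun c x => ?_
             left_inv := fun x => ?_
             right_inv := fun x => ?_ }, fun x => ?_⟩⟩
  · have : Matrix.vecTail (x + y) = Matrix.vecTail x + Matrix.vecTail y := rfl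
    simp [this]
  · have : Matrix.vecTail (c • x) = c • Matrix.vecTail x := rfl
    simp [this]
  · simp only [Matrix.cons_val_zero, Matrix.tail_cons, QuadraticMap.IsometryEquiv.symm_apply_apply]
    exact Matrix.cons_head_tail x
  · simp only [Matrix.cons_val_zero, Matrix.tail_cons, QuadraticMap.IsometryEquiv.apply_symm_apply]
    exact Matrix.cons_head_tail x
  · have := f.map_app (Matrix.vecTail x)
    simp only [QuadraticMap.weightedSumSquares_apply, Matrix.vecTail, smul_eq_mul] at this
    simp [QuadraticMap.weightedSumSquares_apply, Fin.sum_univ_succ, this, Matrix.vecTail]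

variable [NeZero (2 : k)]

/-- An isomorphism preserves Y ↦ tr(Y²). In the coordinates of `h3Equiv` the three diagonal entries
contribute ⟨1, 1, 1⟩, which cancels, and the common factor 2 of the remaining entries is divided
out. -/
theorem equivalent_of_algIso_H3k {γ γ' : Fin 3 → kˣ} (h : AlgIso k (H3k γ) (H3k γ')) :
    QuadraticMap.Equivalent
      (QuadraticMap.weightedSumSquares k ![(γ 1 / γ 2 : k), γ 2 / γ 0, γ 0 / γ 1])
      (QuadraticMap.weightedSumSquares k ![(γ' 1 / γ' 2 : k), γ' 2 / γ' 0, γ' 0 / γ' 1]) := by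
  have h2 := NeZero.ne (2 : k)
  obtain ⟨f, hf⟩ := h
  let e : H3k γ ≃ₗ[k] H3k γ' := LinearEquiv.ofBijective (f : H3k γ →ₗ[k] H3k γ') hf
  have htr : ∀ Y, Matrix.trace (f Y).1 = Matrix.trace Y.1 := by
    intro Y
    refine mul_left_cancel₀ h2 ?_
    rw [← trace_mulLeft_H3k, ← trace_mulLeft_H3k, ← LinearMap.trace_conj' _ e]
    congr 1
    ext1 Z
    obtain ⟨Z, rfl⟩ := e.surjective Z
    simp only [LinearEquiv.conj_apply_apply, LinearEquiv.symm_apply_apply, LinearMap.mulLeft_apply]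
    exact (map_mul f Y Z).symm
  have hsq : ∀ Y : H3k γ, Matrix.trace ((f Y).1 * (f Y).1) = Matrix.trace (Y.1 * Y.1) := by
    have hcoe : ∀ (δ : Fin 3 → kˣ) (Y : H3k δ), (Y * Y).1 = Y.1 * Y.1 := by
      intro δ Y
      rw [coe_mul, ← two_smul k, smul_smul, inv_mul_cancel₀ h2, one_smul]
    intro Y
    rw [← hcoe, ← hcoe, ← map_mul, htr]
  have h6 : QuadraticMap.Equivalent
      (QuadraticMap.weightedSumSquares k
        ![1, 1, 1, 2 * (γ 1 / γ 2 : k), 2 * (γ 2 / γ 0), 2 * (γ 0 / γ 1)])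
      (QuadraticMap.weightedSumSquares k
        ![1, 1, 1, 2 * (γ' 1 / γ' 2 : k), 2 * (γ' 2 / γ' 0), 2 * (γ' 0 / γ' 1)]) := by
    refine ⟨⟨((h3Equiv γ).symm.trans e).trans (h3Equiv γ'), fun x => ?_⟩⟩
    obtain ⟨Y, rfl⟩ := (h3Equiv γ).surjective x
    change QuadraticMap.weightedSumSquares k _
      (h3Equiv γ' (e ((h3Equiv γ).symm (h3Equiv γ Y)))) = _
    rw [LinearEquiv.symm_apply_apply, ← trace_mul_self_H3k, ← trace_mul_self_H3k]
    exact hsq Y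
  have h3 := equivalent_of_vecCons one_ne_zero
    (equivalent_of_vecCons one_ne_zero (equivalent_of_vecCons one_ne_zero h6))
  obtain ⟨P, hP, hPw⟩ := exists_congr_of_equivalent_weightedSumSquares h3
  refine equivalent_weightedSumSquares_of_congr hP ?_
  have hd : ∀ δ : Fin 3 → kˣ,
      Matrix.diagonal ![2 * (δ 1 / δ 2 : k), 2 * (δ 2 / δ 0), 2 * (δ 0 / δ 1)] =
      (2 : k) • Matrix.diagonal ![(δ 1 / δ 2 : k), δ 2 / δ 0, δ 0 / δ 1] := by
    intro δ
    rw [← Matrix.diagonal_smul]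
    congr 1
    funext i
    fin_cases i <;> rfl
  rw [hd, hd, Matrix.mul_smul, Matrix.smul_mul] at hPw
  exact smul_right_injective _ h2 hPw

/-- Similar ternary forms define isomorphic algebras. -/
theorem algIso_H3k_of_congr {γ γ' : Fin 3 → kˣ} {c c' : k} (hc : c ≠ 0) (hc' : c' ≠ 0)
    {P : Matrix (Fin 3) (Fin 3) k} (hP : IsUnit P.det)
    (h : P.transpose * Matrix.diagonal (fun i => c' * γ' i) * P =
      Matrix.diagonal (fun i => c * γ i)) :
    AlgIso k (H3k γ) (H3k γ') := by
  have h1 : P * P⁻¹ = 1 := Matrix.mul_nonsing_inv _ hP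
  have h2 : P⁻¹ * P = 1 := Matrix.nonsing_inv_mul _ hP
  have h1t : (P⁻¹).transpose * P.transpose = 1 := by
    rw [← Matrix.transpose_mul, h1, Matrix.transpose_one]
  -- Membership in H₃(k, Γ) means being self-adjoint for cΓ; as P carries cΓ to c'Γ', conjugation by
  -- P carries self-adjoint matrices to self-adjoint ones.
  have hmem : ∀ Y : Matrix (Fin 3) (Fin 3) k, Y ∈ H3k γ ↔ P * Y * P⁻¹ ∈ H3k γ' := by
    intro Y
    rw [mem_H3k_iff_matrix γ hc, mem_H3k_iff_matrix γ' hc', ← h]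
    set D := Matrix.diagonal (fun i => c' * (γ' i : k))
    have e1 : (P * Y * P⁻¹).transpose * D =
        (P⁻¹).transpose * (Y.transpose * (P.transpose * D * P)) * P⁻¹ := by
      simp only [Matrix.transpose_mul, Matrix.mul_assoc, h1, Matrix.mul_one]
    have e2 : D * (P * Y * P⁻¹) =
        (P⁻¹).transpose * ((P.transpose * D * P) * Y) * P⁻¹ := by
      simp only [← Matrix.mul_assoc, h1t, Matrix.one_mul]
    rw [e1, e2]
    refine ⟨fun h => by rw [h], fun h => ?_⟩
    have := congrArg (fun Z => P.transpose * Z * P) h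
    have ht : P.transpose * (P⁻¹).transpose = 1 := by
      rw [← Matrix.transpose_mul, h2, Matrix.transpose_one]
    have e : ∀ Z, P.transpose * ((P⁻¹).transpose * Z * P⁻¹) * P = Z := by
      intro Z
      rw [Matrix.mul_assoc (P⁻¹).transpose, ← Matrix.mul_assoc P.transpose, ht, Matrix.one_mul,
        Matrix.mul_assoc, h2, Matrix.mul_one]
    simpa only [e] using this
  have hmul : ∀ Y Z : H3k γ, P * (Y * Z).1 * P⁻¹ =
      (2⁻¹ : k) • (P * Y.1 * P⁻¹ * (P * Z.1 * P⁻¹) + P * Z.1 * P⁻¹ * (P * Y.1 * P⁻¹)) := by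
    have e : ∀ Y Z : Matrix (Fin 3) (Fin 3) k,
        P * Y * P⁻¹ * (P * Z * P⁻¹) = P * (Y * Z) * P⁻¹ := by
      intro Y Z
      simp only [Matrix.mul_assoc]
      rw [← Matrix.mul_assoc P⁻¹ P, h2, Matrix.one_mul]
    intro Y Z
    rw [coe_mul, e, e, Matrix.mul_smul, Matrix.smul_mul, Matrix.mul_add, Matrix.add_mul]
  let f : H3k γ →ₙₐ[k] H3k γ' :=
    { toFun := fun Y => ⟨P * Y.1 * P⁻¹, (hmem Y.1).mp Y.2⟩
      map_smul' := fun t Y => Subtype.ext (by simp)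
      map_zero' := Subtype.ext (by simp)
      map_add' := fun Y Z => Subtype.ext (by simp [Matrix.mul_add, Matrix.add_mul])
      map_mul' := fun Y Z => Subtype.ext (hmul Y Z) }
  have hf : ∀ Y, (f Y).1 = P * Y.1 * P⁻¹ := fun _ => rfl
  refine ⟨f, ?_, ?_⟩
  · have e : ∀ Y : Matrix (Fin 3) (Fin 3) k, P⁻¹ * (P * Y * P⁻¹) * P = Y := by
      intro Y
      rw [Matrix.mul_assoc P Y, ← Matrix.mul_assoc P⁻¹ P, h2, Matrix.one_mul, Matrix.mul_assoc, h2,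
        Matrix.mul_one]
    intro Y Z hYZ
    apply Subtype.ext
    rw [← e Y.1, ← e Z.1, ← hf, ← hf, hYZ]
  · intro Z
    have e : P * (P⁻¹ * Z.1 * P) * P⁻¹ = Z.1 := by
      rw [Matrix.mul_assoc P⁻¹, ← Matrix.mul_assoc P P⁻¹, h1, Matrix.one_mul, Matrix.mul_assoc, h1,
        Matrix.mul_one]
    refine ⟨⟨P⁻¹ * Z.1 * P, (hmem _).mpr ?_⟩, Subtype.ext ((hf _).trans e)⟩
    rw [e]; exact Z.2

/-- The ternary part is det(Γ)Γ up to squares, for example γ₁/γ₂ · (γ₀γ₂)² = γ₀γ₁γ₂ · γ₀. After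
cancelling ⟨1⟩, an isometry therefore makes Γ and Γ' similar. -/
theorem algIso_H3k_iff (γ γ' : Fin 3 → kˣ) : AlgIso k (H3k γ) (H3k γ') ↔
    QuadraticMap.Equivalent (diagForm 1 (γ 1 / γ 2 : k) (γ 2 / γ 0) (γ 0 / γ 1))
      (diagForm 1 (γ' 1 / γ' 2 : k) (γ' 2 / γ' 0) (γ' 0 / γ' 1)) := by
  refine ⟨fun h => equivalent_vecCons 1 (equivalent_of_algIso_H3k h), fun h => ?_⟩
  have h3 := equivalent_of_vecCons one_ne_zero h
  have hd : ∀ δ : Fin 3 → kˣ, QuadraticMap.Equivalent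
      (QuadraticMap.weightedSumSquares k fun i => (δ 0 * δ 1 * δ 2 : k) * δ i)
      (QuadraticMap.weightedSumSquares k ![(δ 1 / δ 2 : k), δ 2 / δ 0, δ 0 / δ 1]) := by
    intro δ
    refine equivalent_weightedSumSquares_of_sq ![(δ 0 * δ 2 : k), δ 0 * δ 1, δ 1 * δ 2] ?_ ?_
    · intro i; fin_cases i <;> simp
    · intro i; fin_cases i <;> simp <;> field_simp
  obtain ⟨P, hP, hPw⟩ := exists_congr_of_equivalent_weightedSumSquares
    (((hd γ).trans h3).trans (hd γ').symm)
  exact algIso_H3k_of_congr (by simp) (by simp) hP hPw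

/-- The classification of the algebras `H₃(k, Γ)` by quaternion algebras. -/
theorem exists_equiv_H3Classes :
    ∃ Φ : H3Classes k ≃ QuatClasses k, ∀ (γ : Fin 3 → kˣ) (Q : QuatAlg k),
      Φ (Quotient.mk (h3Setoid k) γ) = Quotient.mk (quatSetoid k) Q ↔
        QuadraticMap.Equivalent Q.norm
          (diagForm 1 ((γ 1 : k) / γ 2) ((γ 2 : k) / γ 0) ((γ 0 : k) / γ 1)) := by
  -- If abc = 1, then ab and c differ by the square (ab)².
  have hsq : ∀ a b c : k, a ≠ 0 → b ≠ 0 → a * b * c = 1 → QuadraticMap.Equivalent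
      (diagForm 1 a b (a * b)) (diagForm 1 a b c) := by
    intro a b c ha hb habc
    refine equivalent_weightedSumSquares_of_sq ![1, 1, 1, a * b] ?_ ?_
    · intro i; fin_cases i <;> simp [ha, hb]
    · intro i; fin_cases i <;> simp
      linear_combination (-a * b) * habc
  refine exists_equiv_quatClasses (h3Setoid k)
    (fun γ => diagForm 1 ((γ 1 : k) / γ 2) ((γ 2 : k) / γ 0) ((γ 0 : k) / γ 1))
    algIso_H3k_iff ?_ ?_
  · intro γ
    obtain ⟨Q, hQ⟩ := exists_quatAlg_norm_equivalent (a := (γ 1 / γ 2 : k)) (b := γ 2 / γ 0)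
      (by simp) (by simp)
    exact ⟨Q, hQ.trans (hsq _ _ _ (by simp) (by simp) (by field_simp))⟩
  · intro Q
    obtain ⟨a, b, ha, hb, hQ⟩ := exists_norm_equivalent_diagForm Q
    -- For Γ = diag(1, ab, b) the three ratios are a, b and 1/(ab).
    refine ⟨![1, Units.mk0 (a * b) (mul_ne_zero ha hb), Units.mk0 b hb], hQ.trans ?_⟩
    have := hsq a b (1 / (a * b)) ha hb (by field_simp)
    convert this using 2 <;> simp
    field_simp

end H3Algebra

/-! ### Coordinates of trivectors -/

section Trivectors

open Matrix

variable {F : Type*} [Field F]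

theorem trivec_hom_ext {M : Type*} [AddCommGroup M] [Module F M]
    {f g : Trivec F →ₗ[F] M} (h : ∀ u v w, f (wedge u v w) = g (wedge u v w)) : f = g := by
  refine exteriorPower.linearMap_ext (AlternatingMap.ext fun m => ?_)
  have hm : m = ![m 0, m 1, m 2] := by
    funext i; fin_cases i <;> rfl
  rw [hm]
  exact h _ _ _

theorem spAct_wedge (g : symplecticGroup (Fin 3) F) (u v w : Fin 3 ⊕ Fin 3 → F) :
    spAct g (wedge u v w) = wedge (g.1 *ᵥ u) (g.1 *ᵥ v) (g.1 *ᵥ w) := by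
  rw [spAct, wedge, exteriorPower.map_apply_ιMulti, wedge]
  congr 1
  funext i
  fin_cases i <;> rfl

/-- The coordinate of a trivector at `e_i ∧ e_j ∧ e_l`. -/
noncomputable def coord (i j l : Fin 3 ⊕ Fin 3) : Trivec F →ₗ[F] F :=
  exteriorPower.alternatingMapLinearEquiv
    (detRowAlternating.compLinearMap (LinearMap.funLeft F F ![i, j, l]))

theorem coord_wedge (i j l : Fin 3 ⊕ Fin 3) (u v w : Fin 3 ⊕ Fin 3 → F) :
    coord i j l (wedge u v w) = u i * v j * w l - u i * v l * w j - u j * v i * w l +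
      u j * v l * w i + u l * v i * w j - u l * v j * w i := by
  rw [coord, wedge, exteriorPower.alternatingMapLinearEquiv_apply_ιMulti]
  refine (det_fin_three (Matrix.of fun a b => ![u, v, w] a (![i, j, l] b))).trans ?_
  simp

theorem coord_swap_left (i j l : Fin 3 ⊕ Fin 3) (x : Trivec F) :
    coord i j l x = -coord j i l x := by
  have : coord i j l = -coord (F := F) j i l := trivec_hom_ext fun u v w => by
    rw [LinearMap.neg_apply, coord_wedge, coord_wedge]; ring
  rw [this, LinearMap.neg_apply]

theorem coord_swap_right (i j l : Fin 3 ⊕ Fin 3) (x : Trivec F) :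
    coord i j l x = -coord i l j x := by
  have : coord i j l = -coord (F := F) i l j := trivec_hom_ext fun u v w => by
    rw [LinearMap.neg_apply, coord_wedge, coord_wedge]; ring
  rw [this, LinearMap.neg_apply]

theorem coord_self_left (i l : Fin 3 ⊕ Fin 3) (x : Trivec F) : coord i i l x = 0 := by
  have : coord i i l = (0 : Trivec F →ₗ[F] F) := trivec_hom_ext fun u v w => by
    rw [LinearMap.zero_apply, coord_wedge]; ring
  rw [this, LinearMap.zero_apply]

theorem coord_self_right (i l : Fin 3 ⊕ Fin 3) (x : Trivec F) : coord i l l x = 0 := by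
  have : coord i l l = (0 : Trivec F →ₗ[F] F) := trivec_hom_ext fun u v w => by
    rw [LinearMap.zero_apply, coord_wedge]; ring
  rw [this, LinearMap.zero_apply]

theorem wedge_swap_left (u v w : Fin 3 ⊕ Fin 3 → F) : wedge u v w = -wedge v u w := by
  have h := (exteriorPower.ιMulti F 3).map_swap ![v, u, w] (show (0 : Fin 3) ≠ 1 by decide)
  rw [wedge, wedge, ← h]
  congr 1
  funext i
  fin_cases i <;> rfl

theorem wedge_swap_right (u v w : Fin 3 ⊕ Fin 3 → F) : wedge u v w = -wedge u w v := by
  have h := (exteriorPower.ιMulti F 3).map_swap ![u, w, v] (show (1 : Fin 3) ≠ 2 by decide)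
  rw [wedge, wedge, ← h]
  congr 1
  funext i
  fin_cases i <;> rfl

/-- The trivector `u ∧ v ∧ w` as a linear function of `u`. -/
noncomputable def wedgeHom (v w : Fin 3 ⊕ Fin 3 → F) : (Fin 3 ⊕ Fin 3 → F) →ₗ[F] Trivec F :=
  (exteriorPower.ιMulti F 3).toMultilinearMap.toLinearMap ![0, v, w] 0

theorem wedgeHom_apply (u v w : Fin 3 ⊕ Fin 3 → F) : wedgeHom v w u = wedge u v w := by
  change exteriorPower.ιMulti F 3 (Function.update ![0, v, w] 0 u) = _
  rw [wedge]
  congr 1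
  funext i
  fin_cases i <;> rfl

theorem sum_smul_wedge_left (u v w : Fin 3 ⊕ Fin 3 → F) :
    ∑ i, u i • wedge (Pi.single i (1 : F)) v w = wedge u v w := by
  simp only [← wedgeHom_apply, ← map_smul, ← map_sum]
  congr 1
  exact (pi_eq_sum_univ' u).symm

theorem sum_smul_wedge_middle (u v w : Fin 3 ⊕ Fin 3 → F) :
    ∑ i, v i • wedge u (Pi.single i (1 : F)) w = wedge u v w := by
  rw [wedge_swap_left u v w, ← sum_smul_wedge_left v u w, ← Finset.sum_neg_distrib]
  exact Finset.sum_congr rfl fun i _ => by rw [wedge_swap_left, smul_neg]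

theorem sum_smul_wedge_right (u v w : Fin 3 ⊕ Fin 3 → F) :
    ∑ i, w i • wedge u v (Pi.single i (1 : F)) = wedge u v w := by
  rw [wedge_swap_right u v w, ← sum_smul_wedge_middle u w v, ← Finset.sum_neg_distrib]
  exact Finset.sum_congr rfl fun i _ => by rw [wedge_swap_right, smul_neg]

theorem sum_smul_wedge (u v w : Fin 3 ⊕ Fin 3 → F) :
    ∑ i, ∑ j, ∑ l, (u i * v j * w l) •
      wedge (Pi.single i (1 : F)) (Pi.single j 1) (Pi.single l 1) = wedge u v w := by
  simp only [mul_smul, ← Finset.smul_sum, sum_smul_wedge_right, sum_smul_wedge_middle,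
    sum_smul_wedge_left]

/-- Summing over ordered triples counts every basis trivector 3! times with matching signs. Division
by this 6 is what makes the coordinates separate trivectors in `eq_of_coord_eq`. -/
theorem sum_coord_smul_wedge (x : Trivec F) :
    ∑ i, ∑ j, ∑ l, coord i j l x •
      wedge (Pi.single i (1 : F)) (Pi.single j 1) (Pi.single l 1) = (6 : F) • x := by
  have h : ∑ i, ∑ j, ∑ l, (coord i j l).smulRight
      (wedge (Pi.single i (1 : F)) (Pi.single j 1) (Pi.single l 1)) =
      (6 : F) • (LinearMap.id : Trivec F →ₗ[F] Trivec F) := by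
    refine trivec_hom_ext fun u v w => ?_
    have h1 := sum_smul_wedge u v w
    have h2 := sum_smul_wedge u w v
    have h3 := sum_smul_wedge v u w
    have h4 := sum_smul_wedge w u v
    have h5 := sum_smul_wedge v w u
    have h6 := sum_smul_wedge w v u
    rw [wedge_swap_right u w v] at h2
    rw [wedge_swap_left v u w] at h3
    rw [wedge_swap_left w u v, wedge_swap_right u w v, neg_neg] at h4
    rw [wedge_swap_right v w u, wedge_swap_left v u w, neg_neg] at h5
    rw [wedge_swap_left w v u, wedge_swap_right v w u, wedge_swap_left v u w, neg_neg] at h6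
    simp only [LinearMap.sum_apply, LinearMap.smulRight_apply, coord_wedge, LinearMap.smul_apply,
      LinearMap.id_apply]
    have e : ∀ i j l, (u i * v j * w l - u i * v l * w j - u j * v i * w l +
        u j * v l * w i + u l * v i * w j - u l * v j * w i) = u i * v j * w l - u i * w j * v l -
        v i * u j * w l + w i * u j * v l + v i * w j * u l - w i * v j * u l := by
      intro i j l; ring
    simp only [e, add_smul, sub_smul, Finset.sum_add_distrib, Finset.sum_sub_distrib, h1, h2, h3,
      h4, h5, h6]
    module
  have := LinearMap.congr_fun h x
  simpa only [LinearMap.sum_apply, LinearMap.smulRight_apply, LinearMap.smul_apply,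
    LinearMap.id_apply] using this

theorem eq_of_coord_eq [NeZero (2 : F)] [NeZero (3 : F)] {x y : Trivec F}
    (h : ∀ i j l, coord i j l x = coord i j l y) : x = y := by
  have h6 : (6 : F) ≠ 0 := by
    have : (6 : F) = 2 * 3 := by norm_num
    rw [this]
    exact mul_ne_zero (NeZero.ne _) (NeZero.ne _)
  refine smul_right_injective _ h6 ?_
  simp only [← sum_coord_smul_wedge, h]

/-- The contraction of a trivector with a vector of the dual basis, as a skew matrix. -/
noncomputable def slice (x : Trivec F) (a : Fin 3 ⊕ Fin 3) :
    Matrix (Fin 3 ⊕ Fin 3) (Fin 3 ⊕ Fin 3) F :=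
  Matrix.of fun i j => coord a i j x

theorem slice_apply (x : Trivec F) (a i j : Fin 3 ⊕ Fin 3) : slice x a i j = coord a i j x := rfl

theorem slice_wedge (u v w : Fin 3 ⊕ Fin 3 → F) (a : Fin 3 ⊕ Fin 3) :
    slice (wedge u v w) a = u a • (vecMulVec v w - vecMulVec w v) -
      v a • (vecMulVec u w - vecMulVec w u) + w a • (vecMulVec u v - vecMulVec v u) := by
  ext i j
  simp only [slice_apply, coord_wedge, Matrix.add_apply, Matrix.sub_apply, Matrix.smul_apply,
    vecMulVec_apply, smul_eq_mul]
  ring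

/-- `slice` as a linear map. -/
noncomputable def sliceHom (a : Fin 3 ⊕ Fin 3) :
    Trivec F →ₗ[F] Matrix (Fin 3 ⊕ Fin 3) (Fin 3 ⊕ Fin 3) F where
  toFun x := slice x a
  map_add' x y := by ext i j; simp [slice_apply]
  map_smul' c x := by ext i j; simp [slice_apply]

theorem slice_spAct (g : symplecticGroup (Fin 3) F) (x : Trivec F) (a : Fin 3 ⊕ Fin 3) :
    slice (spAct g x) a = ∑ b, g.1 a b • (g.1 * slice x b * g.1ᵀ) := by
  have h : (sliceHom a).comp (spAct g) =
      ∑ b, g.1 a b • (LinearMap.mulLeftRight F (g.1, g.1ᵀ)).comp (sliceHom b) := by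
    refine trivec_hom_ext fun u v w => ?_
    have e : ∀ v w : Fin 3 ⊕ Fin 3 → F, g.1 * vecMulVec v w * g.1ᵀ =
        vecMulVec (g.1 *ᵥ v) (g.1 *ᵥ w) := by
      intro v w
      rw [mul_vecMulVec, vecMulVec_mul, vecMul_transpose]
    simp only [LinearMap.comp_apply, LinearMap.sum_apply, LinearMap.smul_apply, spAct_wedge]
    change slice (wedge (g.1 *ᵥ u) (g.1 *ᵥ v) (g.1 *ᵥ w)) a =
      ∑ b, g.1 a b • (g.1 * slice (wedge u v w) b * g.1ᵀ)
    simp only [slice_wedge, Matrix.mul_add, Matrix.mul_sub, Matrix.add_mul, Matrix.sub_mul,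
      Matrix.mul_smul, Matrix.smul_mul, e, smul_sub, smul_add, smul_smul, Finset.sum_add_distrib,
      Finset.sum_sub_distrib, ← Finset.sum_smul]
    rfl
  have := LinearMap.congr_fun h x
  simp only [LinearMap.comp_apply, LinearMap.sum_apply, LinearMap.smul_apply] at this
  exact this

/-- The quadratic covariant of a trivector with values in symmetric matrices. -/
noncomputable def covariant (x : Trivec F) : Matrix (Fin 3 ⊕ Fin 3) (Fin 3 ⊕ Fin 3) F :=
  Matrix.of fun a b => trace (slice x a * J (Fin 3) F * (slice x b * J (Fin 3) F))

theorem covariant_apply (x : Trivec F) (a b : Fin 3 ⊕ Fin 3) :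
    covariant x a b = trace (slice x a * J (Fin 3) F * (slice x b * J (Fin 3) F)) := rfl

theorem covariant_transpose (x : Trivec F) : (covariant x)ᵀ = covariant x := by
  ext a b
  rw [transpose_apply, covariant_apply, covariant_apply, trace_mul_comm]

theorem transpose_mul_J_mul (g : symplecticGroup (Fin 3) F) : 
    g.1ᵀ * J (Fin 3) F * g.1 = J (Fin 3) F :=
  SymplecticGroup.mem_iff'.mp g.2

theorem trace_conj_mul_J (g : symplecticGroup (Fin 3) F)
    (M M' : Matrix (Fin 3 ⊕ Fin 3) (Fin 3 ⊕ Fin 3) F) :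
    trace (g.1 * M * g.1ᵀ * J (Fin 3) F * (g.1 * M' * g.1ᵀ * J (Fin 3) F)) =
      trace (M * J (Fin 3) F * (M' * J (Fin 3) F)) := by
  have h := transpose_mul_J_mul g
  have e : g.1 * M * g.1ᵀ * J (Fin 3) F * (g.1 * M' * g.1ᵀ * J (Fin 3) F) =
      g.1 * (M * (g.1ᵀ * J (Fin 3) F * g.1) * (M' * (g.1ᵀ * J (Fin 3) F))) := by
    simp only [Matrix.mul_assoc]
  rw [e, h, trace_mul_comm, Matrix.mul_assoc (M * J (Fin 3) F), Matrix.mul_assoc M', h]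

/-- The slices transform by conjugation with g and by g on the contracted index. Under the trace the
conjugation disappears, because gᵀJg = J, and only the two contracted indices remain. -/
theorem covariant_spAct (g : symplecticGroup (Fin 3) F) (x : Trivec F) :
    covariant (spAct g x) = g.1 * covariant x * g.1ᵀ := by
  ext a b
  rw [covariant_apply, slice_spAct, slice_spAct]
  simp only [Matrix.sum_mul, Matrix.mul_sum, Matrix.smul_mul, Matrix.mul_smul, trace_sum,
    trace_smul, trace_conj_mul_J, smul_eq_mul]
  simp only [Matrix.mul_apply (M := g.1 * covariant x), Matrix.mul_apply (M := g.1),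
    transpose_apply, covariant_apply, Finset.sum_mul]
  refine Finset.sum_congr rfl fun i _ => ?_
  rw [Finset.mul_sum]
  exact Finset.sum_congr rfl fun j _ => by ring

theorem trace_slice_mul_J_spAct (g : symplecticGroup (Fin 3) F) {x : Trivec F}
    (h : ∀ a, trace (slice x a * J (Fin 3) F) = 0) (a : Fin 3 ⊕ Fin 3) :
    trace (slice (spAct g x) a * J (Fin 3) F) = 0 := by
  rw [slice_spAct, Matrix.sum_mul, trace_sum]
  refine Finset.sum_eq_zero fun b _ => ?_
  rw [Matrix.smul_mul, trace_smul, Matrix.mul_assoc, Matrix.mul_assoc, trace_mul_comm,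
    Matrix.mul_assoc, transpose_mul_J_mul, h, smul_zero]

/-- This vanishing is a condition on orbits, so it may be tested at a base point. When the column
space of the covariant is L, it says exactly that the trivector lies in L ∧ L ∧ V. -/
theorem covariant_mul_slice_mul_covariant_spAct (g : symplecticGroup (Fin 3) F) {x : Trivec F}
    (h : ∀ a, covariant x * J (Fin 3) F * slice x a * J (Fin 3) F * covariant x = 0)
    (a : Fin 3 ⊕ Fin 3) :
    covariant (spAct g x) * J (Fin 3) F * slice (spAct g x) a * J (Fin 3) F *
      covariant (spAct g x) = 0 := by
  rw [slice_spAct, covariant_spAct]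
  simp only [Matrix.sum_mul, Matrix.mul_sum, Matrix.smul_mul, Matrix.mul_smul]
  refine Finset.sum_eq_zero fun b _ => ?_
  have e : g.1 * covariant x * g.1ᵀ * J (Fin 3) F * (g.1 * slice x b * g.1ᵀ) * J (Fin 3) F *
      (g.1 * covariant x * g.1ᵀ) = g.1 * (covariant x * (g.1ᵀ * J (Fin 3) F * g.1) * slice x b *
        (g.1ᵀ * J (Fin 3) F * g.1) * covariant x) * g.1ᵀ := by
    simp only [Matrix.mul_assoc]
  rw [e, transpose_mul_J_mul, h, Matrix.mul_zero, Matrix.zero_mul, smul_zero]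

/-- The condition says that the column space of the covariant is isotropic. -/
theorem covariant_mul_J_mul_covariant_spAct (g : symplecticGroup (Fin 3) F) {x : Trivec F}
    (h : covariant x * J (Fin 3) F * covariant x = 0) :
    covariant (spAct g x) * J (Fin 3) F * covariant (spAct g x) = 0 := by
  rw [covariant_spAct]
  have e : g.1 * covariant x * g.1ᵀ * J (Fin 3) F *
      (g.1 * covariant x * g.1ᵀ) = g.1 * (covariant x * (g.1ᵀ * J (Fin 3) F * g.1) *
        covariant x) * g.1ᵀ := by
    simp only [Matrix.mul_assoc]
  rw [e, transpose_mul_J_mul, h, Matrix.mul_zero, Matrix.zero_mul]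

/-- Trivectors in `X` have vanishing contraction with the symplectic form. -/
theorem trace_slice_mul_J_of_mem_X {x : Trivec F} (hx : x ∈ X F) (a : Fin 3 ⊕ Fin 3) :
    trace (slice x a * J (Fin 3) F) = 0 := by
  have h0 : ∀ a, trace (slice (wedge (eL F 0) (eL F 1) (eL F 2)) a * J (Fin 3) F) = 0 := by
    intro a
    have : slice (wedge (eL F 0) (eL F 1) (eL F 2)) a =
      fromBlocks (toBlocks₁₁ (slice (wedge (eL F 0) (eL F 1) (eL F 2)) a)) 0 0 0 := by
      ext i j
      rcases i with i | i <;> rcases j with j | j <;>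
        simp [slice_apply, coord_wedge, eL, toBlocks₁₁]
    rw [this, J, fromBlocks_multiply]
    simp [trace, Fintype.sum_sum_type]
  let T : Trivec F →ₗ[F] F := (traceLinearMap _ F F).comp
    ((LinearMap.mulRight F (J (Fin 3) F)).comp (sliceHom a))
  have hT : X F ≤ LinearMap.ker T := by
    rw [X, Submodule.span_le]
    rintro _ ⟨g, rfl⟩
    exact trace_slice_mul_J_spAct g h0 a
  exact hT hx

theorem coord_extend {k K : Type*} [Field k] [Field K] [Algebra k K] (x : Trivec k)
    (i j l : Fin 3 ⊕ Fin 3) : coord i j l (extend k K x) = algebraMap k K (coord i j l x) := by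
  have h : ((coord i j l : Trivec K →ₗ[K] K).restrictScalars k).comp (extend k K) =
      (Algebra.linearMap k K).comp (coord i j l) := by
    refine trivec_hom_ext fun u v w => ?_
    simp only [LinearMap.comp_apply, extend_wedge, LinearMap.restrictScalars_apply, coord_wedge,
      Algebra.linearMap_apply, map_sub, map_add, map_mul, Function.comp_apply]
  exact LinearMap.congr_fun h x

theorem slice_extend {k K : Type*} [Field k] [Field K] [Algebra k K] (x : Trivec k)
    (a : Fin 3 ⊕ Fin 3) : slice (extend k K x) a = (slice x a).map (algebraMap k K) := by
  ext i j
  simp only [slice_apply, coord_extend, map_apply]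

theorem covariant_extend {k K : Type*} [Field k] [Field K] [Algebra k K] (x : Trivec k) :
    covariant (extend k K x) = (covariant x).map (algebraMap k K) := by
  ext a b
  rw [map_apply, covariant_apply, covariant_apply, slice_extend, slice_extend,
    ← map_J (l := Fin 3) (algebraMap k K), ← Matrix.map_mul, ← Matrix.map_mul, ← Matrix.map_mul]
  exact (AddMonoidHom.map_trace (algebraMap k K) _).symm

end Trivectors

/-! ### The orbits of `Sp₆` in `X₂` -/

section SymplecticOrbits

open Matrix

variable {F : Type*} [Field F]

/-- The component of a trivector in `L' ⊗ Λ² L`, where `L` and `L'` are the spans of `e₁, e₂, e₃`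
and `e₄, e₅, e₆`, as a matrix. -/
noncomputable def symPart (x : Trivec F) : Matrix (Fin 3) (Fin 3) F :=
  Matrix.of fun i l => coord (Sum.inl (i + 1)) (Sum.inl (i + 2)) (Sum.inr l) x

/-- Trivectors in `L ∧ L ∧ V`. -/
def IsTangent (x : Trivec F) : Prop := ∀ a i j, coord a (Sum.inr i) (Sum.inr j) x = 0

theorem symPart_apply (x : Trivec F) (i l : Fin 3) :
    symPart x i l = coord (Sum.inl (i + 1)) (Sum.inl (i + 2)) (Sum.inr l) x := rfl

theorem coord_inl_inl_inr (x : Trivec F) (l : Fin 3) (i j : Fin 3) :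
    coord (Sum.inl i) (Sum.inl j) (Sum.inr l) x =
      !![0, symPart x 2 l, -symPart x 1 l; -symPart x 2 l, 0, symPart x 0 l;
        symPart x 1 l, -symPart x 0 l, 0] i j := by
  fin_cases i <;> fin_cases j <;> simp [symPart_apply, coord_self_left]
  all_goals exact coord_swap_left _ _ _ x

/-- No coordinate with two indices in the second half survives, so by alternation only the entries
of `symPart` and the single coordinate at e₁ ∧ e₂ ∧ e₃ are left. -/
theorem eq_of_isTangent [NeZero (2 : F)] [NeZero (3 : F)] {x y : Trivec F} (hx : IsTangent x)
    (hy : IsTangent y) (h : symPart x = symPart y)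
    (h0 : coord (Sum.inl 0) (Sum.inl 1) (Sum.inl 2) x =
      coord (Sum.inl 0) (Sum.inl 1) (Sum.inl 2) y) : x = y := by
  refine eq_of_coord_eq fun i j l => ?_
  have h2 : ∀ i j l, coord (Sum.inl i) (Sum.inl j) (Sum.inr l) x =
      coord (Sum.inl i) (Sum.inl j) (Sum.inr l) y := by
    intro i j l
    rw [coord_inl_inl_inr, coord_inl_inl_inr, h]
  rcases l with l | l
  · rcases j with j | j
    · rcases i with i | i
      -- The determinant is the sign of the arrangement (i, j, l), or 0 if an index repeats.
      · have key : ∀ z : Trivec F, coord (Sum.inl i) (Sum.inl j) (Sum.inl l) z =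
            det (Matrix.of fun a b : Fin 3 => (Pi.single (![i, j, l] a) 1 : Fin 3 → F) b) *
              coord (Sum.inl 0) (Sum.inl 1) (Sum.inl 2) z := by
          intro z
          have h1 := coord_swap_left (Sum.inl 0) (Sum.inl 1) (Sum.inl 2) z
          have h2 := coord_swap_right (Sum.inl 0) (Sum.inl 1) (Sum.inl 2) z
          have h3 := coord_swap_right (Sum.inl 1) (Sum.inl 0) (Sum.inl 2) z
          have h4 := coord_swap_left (Sum.inl 0) (Sum.inl 2) (Sum.inl 1) z
          have h5 := coord_swap_right (Sum.inl 2) (Sum.inl 0) (Sum.inl 1) z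
          have h6 : ∀ i j, coord (Sum.inl i) (Sum.inl j) (Sum.inl i) z = 0 := fun i j => by
            rw [coord_swap_right, coord_self_left, neg_zero]
          fin_cases i <;> fin_cases j <;> fin_cases l <;>
            simp [det_fin_three, coord_self_left, coord_self_right, h6]
          · linear_combination h2
          · linear_combination h1
          · linear_combination h3 - h1
          · linear_combination h4 - h2
          · linear_combination h2 - h4 + h5
        rw [key x, key y, h0]
      · have key : ∀ z : Trivec F, coord (Sum.inr i) (Sum.inl j) (Sum.inl l) z =
            coord (Sum.inl j) (Sum.inl l) (Sum.inr i) z := fun z => by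
          rw [coord_swap_left, coord_swap_right (Sum.inl j) (Sum.inr i), neg_neg]
        rw [key, key, h2]
    · rcases i with i | i
      · rw [coord_swap_right, h2, ← coord_swap_right]
      · rw [coord_swap_right, coord_swap_left, hx, coord_swap_right, coord_swap_left, hy]
  · rcases j with j | j
    · rcases i with i | i
      · exact h2 i j l
      · rw [coord_swap_left, hx, coord_swap_left, hy]
    · rw [hx, hy]

theorem slice_inl_of_isTangent {x : Trivec F} (hx : IsTangent x) (a : Fin 3) :
    slice x (Sum.inl a) = fromBlocks (toBlocks₁₁ (slice x (Sum.inl a)))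
      (toBlocks₁₂ (slice x (Sum.inl a))) (-(toBlocks₁₂ (slice x (Sum.inl a)))ᵀ) 0 := by
  ext i j
  rcases i with i | i <;> rcases j with j | j
  · rfl
  · rfl
  · exact coord_swap_right _ _ _ x
  · exact hx _ i j

theorem slice_inr_of_isTangent {x : Trivec F} (hx : IsTangent x) (a : Fin 3) :
    slice x (Sum.inr a) = fromBlocks (toBlocks₁₁ (slice x (Sum.inr a))) 0 0 0 := by
  ext i j
  rcases i with i | i <;> rcases j with j | j
  · rfl
  · change coord (Sum.inr a) (Sum.inl i) (Sum.inr j) x = 0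
    rw [coord_swap_left, hx, neg_zero]
  · change coord (Sum.inr a) (Sum.inr i) (Sum.inl j) x = 0
    rw [coord_swap_right, coord_swap_left, hx, neg_zero, neg_zero]
  · exact hx _ i j

/-- Slices at e₄, e₅, e₆ live in the L × L block and contribute nothing; slices at e₁, e₂, e₃
contribute through their off-diagonal block and its negative transpose, whence the factor 2. -/
theorem covariant_of_isTangent {x : Trivec F} (hx : IsTangent x) :
    covariant x = fromBlocks (Matrix.of fun a b => 2 * trace
      (toBlocks₁₂ (slice x (Sum.inl a)) * toBlocks₁₂ (slice x (Sum.inl b)))) 0 0 0 := by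
  have htr : ∀ A B C D : Matrix (Fin 3) (Fin 3) F, trace (fromBlocks A B C D) =
      trace A + trace D := by
    intro A B C D
    simp [trace, Fintype.sum_sum_type]
  have hLL : ∀ A B A' B' : Matrix (Fin 3) (Fin 3) F,
      trace (fromBlocks A B (-Bᵀ) 0 * J (Fin 3) F * (fromBlocks A' B' (-B'ᵀ) 0 * J (Fin 3) F)) =
        2 * trace (B * B') := by
    intro A B A' B'
    simp only [J, fromBlocks_multiply, htr, Matrix.mul_zero, Matrix.mul_one, Matrix.zero_mul,
      add_zero, zero_add, Matrix.mul_neg, neg_neg, neg_zero, ← transpose_mul, trace_transpose]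
    rw [trace_mul_comm B' B, two_mul]
  have hLR : ∀ A B A' : Matrix (Fin 3) (Fin 3) F,
      trace (fromBlocks A B (-Bᵀ) 0 * J (Fin 3) F * (fromBlocks A' 0 0 0 * J (Fin 3) F)) = 0 := by
    intro A B A'
    simp [J, fromBlocks_multiply, htr]
  have hRR : ∀ A A' : Matrix (Fin 3) (Fin 3) F,
      trace (fromBlocks A 0 0 0 * J (Fin 3) F * (fromBlocks A' 0 0 0 * J (Fin 3) F)) = 0 := by
    intro A A'
    simp [J, fromBlocks_multiply]
  have hL := slice_inl_of_isTangent hx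
  have hR := slice_inr_of_isTangent hx
  let f (M M' : Matrix (Fin 3 ⊕ Fin 3) (Fin 3 ⊕ Fin 3) F) : F :=
    trace (M * J (Fin 3) F * (M' * J (Fin 3) F))
  ext a b
  rcases a with a | a <;> rcases b with b | b
  · exact (congrArg₂ f (hL a) (hL b)).trans (hLL _ _ _ _)
  · exact (congrArg₂ f (hL a) (hR b)).trans (hLR _ _ _)
  · exact (trace_mul_comm _ _).trans ((congrArg₂ f (hL b) (hR a)).trans (hLR _ _ _))
  · exact (congrArg₂ f (hR a) (hR b)).trans (hRR _ _)

/-- The contraction of a tangent trivector with the symplectic form has as coefficients, up to the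
factor 2 and signs, the differences S i j − S j i for S = `symPart x`. -/
theorem symPart_transpose_of_contraction [NeZero (2 : F)] {x : Trivec F} (hx : IsTangent x)
    (h : ∀ a, trace (slice x a * J (Fin 3) F) = 0) : (symPart x)ᵀ = symPart x := by
  have h2 := NeZero.ne (2 : F)
  have key : ∀ a, trace (toBlocks₁₂ (slice x (Sum.inl a))) = 0 := by
    intro a
    have := h (Sum.inl a)
    rw [slice_inl_of_isTangent hx, J, fromBlocks_multiply] at this
    simp only [Matrix.mul_zero, Matrix.mul_one, add_zero, zero_add, Matrix.mul_neg,
      neg_neg] at this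
    have h' : 2 * trace (toBlocks₁₂ (slice x (Sum.inl a))) = 0 := by
      rw [← this]
      conv_rhs => rw [trace]
      rw [Fintype.sum_sum_type]
      simp only [diag_apply, fromBlocks_apply₁₁, fromBlocks_apply₂₂, transpose_apply, ← two_mul]
      rfl
    exact (mul_eq_zero.mp h').resolve_left h2
  have e : ∀ a, coord (Sum.inl a) (Sum.inl 0) (Sum.inr 0) x +
      coord (Sum.inl a) (Sum.inl 1) (Sum.inr 1) x + coord (Sum.inl a) (Sum.inl 2) (Sum.inr 2) x =
      0 := fun a => by
    have := key a
    rwa [trace_fin_three] at this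
  have e0 := e 0
  have e1 := e 1
  have e2 := e 2
  simp only [coord_inl_inl_inr] at e0 e1 e2
  simp at e0 e1 e2
  ext i j
  rw [transpose_apply]
  fin_cases i <;> fin_cases j <;> simp
  · linear_combination e2
  · linear_combination -e1
  · linear_combination -e2
  · linear_combination e0
  · linear_combination e1
  · linear_combination -e0

/-- The off-diagonal block of the slice at eₐ is an alternating matrix times S = `symPart x`. For
symmetric S the trace of the product of two such blocks is −2 times a cofactor of S. -/
theorem covariant_of_isTangent_of_symm {x : Trivec F} (hx : IsTangent x)
    (h : (symPart x)ᵀ = symPart x) :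
    covariant x = fromBlocks ((-4 : F) • (symPart x).adjugate) 0 0 0 := by
  rw [covariant_of_isTangent hx]
  congr 1
  have h01 : symPart x 1 0 = symPart x 0 1 := congrFun (congrFun h 0) 1
  have h02 : symPart x 2 0 = symPart x 0 2 := congrFun (congrFun h 0) 2
  have h12 : symPart x 2 1 = symPart x 1 2 := congrFun (congrFun h 1) 2
  have hB : ∀ a i l, toBlocks₁₂ (slice x (Sum.inl a)) i l =
      coord (Sum.inl a) (Sum.inl i) (Sum.inr l) x := fun _ _ _ => rfl
  ext a b
  rw [of_apply, trace_fin_three, adjugate_fin_three]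
  simp only [Matrix.mul_apply, Fin.sum_univ_three, hB, coord_inl_inl_inr, h01, h02, h12]
  fin_cases a <;> fin_cases b <;> simp <;> ring

theorem coord_diagElt (a b c : F) (i j l : Fin 3 ⊕ Fin 3) :
    coord i j l (diagElt a b c) = a * coord i j l (wedge (eR F 0) (eL F 1) (eL F 2)) +
      b * coord i j l (wedge (eL F 0) (eR F 1) (eL F 2)) +
      c * coord i j l (wedge (eL F 0) (eL F 1) (eR F 2)) := by
  simp [diagElt]

theorem isTangent_diagElt (a b c : F) : IsTangent (diagElt a b c) := by
  intro s i j
  rw [coord_diagElt]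
  simp [coord_wedge, eL]

theorem symPart_diagElt (a b c : F) : symPart (diagElt a b c) = diagonal ![a, b, c] := by
  ext i j
  rw [symPart_apply, coord_diagElt]
  fin_cases i <;> fin_cases j <;> simp [coord_wedge, eL, eR]

theorem coord_inl_diagElt (a b c : F) (i j l : Fin 3) :
    coord (Sum.inl i) (Sum.inl j) (Sum.inl l) (diagElt a b c) = 0 := by
  rw [coord_diagElt]
  simp [coord_wedge, eR]

theorem covariant_diagElt (a b c : F) : covariant (diagElt a b c) =
    fromBlocks (diagonal fun i => -4 * ![b * c, c * a, a * b] i) 0 0 0 := by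
  rw [covariant_of_isTangent_of_symm (isTangent_diagElt a b c) (by
    rw [symPart_diagElt, diagonal_transpose]), symPart_diagElt]
  congr 1
  rw [adjugate_fin_three]
  ext i j
  fin_cases i <;> fin_cases j <;> simp [mul_comm]

/-- The element of `Sp₆` acting by `P` on `e₁, e₂, e₃` and contragrediently on `e₄, e₅, e₆`. -/
def spBlockDiag (P Z : Matrix (Fin 3) (Fin 3) F) (h : Pᵀ * Z = 1) :
    symplecticGroup (Fin 3) F :=
  ⟨fromBlocks P 0 0 Z, by
    have h1 : Zᵀ * P = 1 := by
      rw [← transpose_transpose P, ← transpose_mul, h, transpose_one]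
    have h2 : P * Zᵀ = 1 := _root_.mul_eq_one_comm.mp h1
    have h3 : Z * Pᵀ = 1 := _root_.mul_eq_one_comm.mp h
    rw [SymplecticGroup.mem_iff, J, fromBlocks_transpose, fromBlocks_multiply, fromBlocks_multiply]
    simp [h2, h3]⟩

theorem spBlockDiag_mulVec_eL (P Z : Matrix (Fin 3) (Fin 3) F) (h : Pᵀ * Z = 1) (i : Fin 3) :
    (spBlockDiag P Z h).1 *ᵥ eL F i = Sum.elim (fun j => P j i) 0 := by
  rw [eL, mulVec_single_one]
  funext j
  rcases j with j | j <;> rfl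

theorem spBlockDiag_mulVec_eR (P Z : Matrix (Fin 3) (Fin 3) F) (h : Pᵀ * Z = 1) (i : Fin 3) :
    (spBlockDiag P Z h).1 *ᵥ eR F i = Sum.elim (0 : Fin 3 → F) (fun j => Z j i) := by
  rw [eR, mulVec_single_one]
  funext j
  rcases j with j | j <;> rfl

theorem coord_spBlockDiag_diagElt (P Z : Matrix (Fin 3) (Fin 3) F) (h : Pᵀ * Z = 1) (a b c : F)
    (i j l : Fin 3 ⊕ Fin 3) :
    coord i j l (spAct (spBlockDiag P Z h) (diagElt a b c)) =
      a * coord i j l (wedge (Sum.elim (0 : Fin 3 → F) fun j => Z j 0) (Sum.elim (fun j => P j 1) 0)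
        (Sum.elim (fun j => P j 2) 0)) +
      b * coord i j l (wedge (Sum.elim (fun j => P j 0) 0) (Sum.elim (0 : Fin 3 → F) fun j => Z j 1)
        (Sum.elim (fun j => P j 2) 0)) +
      c * coord i j l (wedge (Sum.elim (fun j => P j 0) 0) (Sum.elim (fun j => P j 1) 0)
        (Sum.elim (0 : Fin 3 → F) fun j => Z j 2)) := by
  simp only [diagElt, map_add, map_smul, spAct_wedge, spBlockDiag_mulVec_eL, spBlockDiag_mulVec_eR,
    smul_eq_mul]

theorem isTangent_spBlockDiag_diagElt (P Z : Matrix (Fin 3) (Fin 3) F) (h : Pᵀ * Z = 1)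
    (a b c : F) : IsTangent (spAct (spBlockDiag P Z h) (diagElt a b c)) := by
  intro s i j
  rw [coord_spBlockDiag_diagElt]
  simp [coord_wedge]

theorem coord_inl_spBlockDiag_diagElt (P Z : Matrix (Fin 3) (Fin 3) F) (h : Pᵀ * Z = 1)
    (a b c : F) (i j l : Fin 3) :
    coord (Sum.inl i) (Sum.inl j) (Sum.inl l) (spAct (spBlockDiag P Z h) (diagElt a b c)) = 0 := by
  rw [coord_spBlockDiag_diagElt]
  simp [coord_wedge]

/-- The element acts on L' by Z and on Λ²L by the cofactor matrix of P, which is det(P) Z. -/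
theorem symPart_spBlockDiag_diagElt (P Z : Matrix (Fin 3) (Fin 3) F) (h : Pᵀ * Z = 1)
    (a b c : F) : symPart (spAct (spBlockDiag P Z h) (diagElt a b c)) =
      P.det • (Z * diagonal ![a, b, c] * Zᵀ) := by
  have hadj : P.adjugate = P.det • Zᵀ := by
    have h1 : Zᵀ * P = 1 := by
      rw [← transpose_transpose P, ← transpose_mul, h, transpose_one]
    have h2 : P * Zᵀ = 1 := _root_.mul_eq_one_comm.mp h1
    rw [← Matrix.mul_one P.adjugate, ← h2, ← Matrix.mul_assoc, adjugate_mul, Matrix.smul_mul,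
      Matrix.one_mul]
  have e : ∀ i j, P.adjugate i j = P.det * Z j i := fun i j => by rw [hadj]; simp
  rw [adjugate_fin_three] at e
  have e00 := e 0 0
  have e01 := e 0 1
  have e02 := e 0 2
  have e10 := e 1 0
  have e11 := e 1 1
  have e12 := e 1 2
  have e20 := e 2 0
  have e21 := e 2 1
  have e22 := e 2 2
  simp at e00 e01 e02 e10 e11 e12 e20 e21 e22
  ext i l
  rw [symPart_apply, coord_spBlockDiag_diagElt, Matrix.smul_apply, Matrix.mul_apply]
  simp only [Fin.sum_univ_three, mul_diagonal, transpose_apply, coord_wedge, Sum.elim_inl,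
    Sum.elim_inr, Pi.zero_apply, cons_val_zero, cons_val_one, cons_val_two, smul_eq_mul]
  fin_cases i <;> simp
  · linear_combination a * Z l 0 * e00 + b * Z l 1 * e10 + c * Z l 2 * e20
  · linear_combination a * Z l 0 * e01 + b * Z l 1 * e11 + c * Z l 2 * e21
  · linear_combination a * Z l 0 * e02 + b * Z l 1 * e12 + c * Z l 2 * e22

end SymplecticOrbits

/-! ### Symplectic normal form of symmetric matrices with Lagrangian column space. -/

section SymplecticNormalForm

open Matrix

variable {F : Type*} [Field F]

/-- A symmetric matrix whose columns span a Lagrangian subspace is the image under `Sp₆` of a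
diagonal matrix supported on `L`. -/
theorem exists_symplectic_eq_mul_fromBlocks_mul [NeZero (2 : F)]
    {K : Matrix (Fin 3 ⊕ Fin 3) (Fin 3 ⊕ Fin 3) F} (hK : Kᵀ = K) (hrank : K.rank = 3)
    (hKJK : K * J (Fin 3) F * K = 0) :
    ∃ (g : symplecticGroup (Fin 3) F) (d : Fin 3 → F), (∀ i, d i ≠ 0) ∧
      K = g.1 * fromBlocks (diagonal d) 0 0 0 * g.1ᵀ := by
  classical
  obtain ⟨P, w, hP, hPK⟩ := exists_eq_mul_diagonal_mul_transpose K hK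
  have hcard : Fintype.card {i // w i ≠ 0} = 3 := by
    have hr : K.rank = (diagonal w).rank := by
      rw [hPK, rank_mul_eq_left_of_isUnit_det _ _ (by rwa [det_transpose]),
        rank_mul_eq_right_of_isUnit_det _ _ hP]
    rw [← rank_diagonal, ← hr, hrank]
  -- Keeping only the three columns of P with nonzero weight gives K = L diag(d) Lᵀ; the
  -- corresponding rows of P⁻¹ form a left inverse Λ of L.
  let e : Fin 3 ≃ {i // w i ≠ 0} := (Fintype.equivFinOfCardEq hcard).symm
  let f : Fin 3 → Fin 3 ⊕ Fin 3 := fun i => (e i).1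
  let L : Matrix (Fin 3 ⊕ Fin 3) (Fin 3) F := P.submatrix id f
  let Λ : Matrix (Fin 3) (Fin 3 ⊕ Fin 3) F := P⁻¹.submatrix f id
  let d : Fin 3 → F := fun i => w (f i)
  have hd : ∀ i, d i ≠ 0 := fun i => (e i).2
  have hΛL : Λ * L = 1 := by
    change P⁻¹.submatrix f id * P.submatrix id f = 1
    refine (submatrix_mul_equiv P⁻¹ P f (Equiv.refl _) f).trans ?_
    rw [nonsing_inv_mul _ hP]
    exact submatrix_one f (Subtype.val_injective.comp e.injective)
  have hKL : K = L * diagonal d * Lᵀ := by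
    ext a b
    have h1 : K a b = ∑ i, P a i * w i * P b i := by
      rw [hPK, Matrix.mul_apply]
      simp only [mul_diagonal, transpose_apply]
    have h2 : (L * diagonal d * Lᵀ) a b = ∑ j, P a (f j) * w (f j) * P b (f j) := by
      rw [Matrix.mul_apply]
      simp only [mul_diagonal, transpose_apply, L, d, submatrix_apply, id]
    rw [h1, h2, Equiv.sum_comp e (fun i => P a i.1 * w i.1 * P b i.1),
      ← Finset.sum_filter_of_ne (p := fun i => w i ≠ 0) fun i _ h hw => h (by rw [hw]; ring)]
    exact Finset.sum_subtype _ (by simp) _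
  have hdd : diagonal d * diagonal (fun i => (d i)⁻¹) = 1 := by
    rw [diagonal_mul_diagonal, ← diagonal_one]
    congr 1; funext i; exact mul_inv_cancel₀ (hd i)
  have hdd' : diagonal (fun i => (d i)⁻¹) * diagonal d = 1 := by
    rw [diagonal_mul_diagonal, ← diagonal_one]
    congr 1; funext i; exact inv_mul_cancel₀ (hd i)
  have hLΛ : Lᵀ * Λᵀ = 1 := by rw [← transpose_mul, hΛL, transpose_one]
  -- Multiplying KJK = 0 by Λ and Λᵀ and cancelling diag(d) on both sides shows that the columns of
  -- L span an isotropic space.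
  have hLJL : Lᵀ * J (Fin 3) F * L = 0 := by
    have h1 : diagonal (fun i => (d i)⁻¹) * (Λ * (K * J (Fin 3) F * K) * Λᵀ) *
        diagonal (fun i => (d i)⁻¹) = 0 := by
      rw [hKJK]; simp
    have h2 : Λ * (K * J (Fin 3) F * K) * Λᵀ =
        (Λ * L) * diagonal d * (Lᵀ * J (Fin 3) F * L) * diagonal d * (Lᵀ * Λᵀ) := by
      rw [hKL]; simp only [Matrix.mul_assoc]
    rw [h2, hΛL, hLΛ, Matrix.one_mul, Matrix.mul_one] at h1
    have h3 : diagonal (fun i => (d i)⁻¹) * (diagonal d * (Lᵀ * J (Fin 3) F * L) * diagonal d) *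
        diagonal (fun i => (d i)⁻¹) = (diagonal (fun i => (d i)⁻¹) * diagonal d) *
        (Lᵀ * J (Fin 3) F * L) * (diagonal d * diagonal (fun i => (d i)⁻¹)) := by
      simp only [Matrix.mul_assoc]
    rw [h3, hdd, hdd', Matrix.one_mul, Matrix.mul_one] at h1
    exact h1
  have hJJ := J_squared (Fin 3) F
  have hJt := J_transpose (Fin 3) F
  -- The columns of JΛᵀ pair with those of L as required, but their own Gram matrix is the skew
  -- matrix N. Adding L(−N/2) removes it without affecting the pairing with L, and completes L to a
  -- symplectic basis.
  let N := Λ * J (Fin 3) F * Λᵀ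
  have hN : Nᵀ = -N := by
    simp only [N, transpose_mul, transpose_transpose, hJt, Matrix.mul_neg, Matrix.neg_mul,
      Matrix.mul_assoc]
  let C : Matrix (Fin 3) (Fin 3) F := -((2⁻¹ : F) • N)
  let R : Matrix (Fin 3 ⊕ Fin 3) (Fin 3) F := J (Fin 3) F * Λᵀ + L * C
  have hLR : Lᵀ * J (Fin 3) F * R = -1 := by
    simp only [R, Matrix.mul_add]
    rw [← Matrix.mul_assoc _ L, hLJL, Matrix.zero_mul, add_zero, ← Matrix.mul_assoc,
      Matrix.mul_assoc Lᵀ (J (Fin 3) F), hJJ, Matrix.mul_neg, Matrix.mul_one, Matrix.neg_mul, hLΛ]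
  have hRL : Rᵀ * J (Fin 3) F * L = 1 := by
    have h := congrArg transpose hLR
    simp only [transpose_mul, transpose_transpose, hJt, transpose_neg, transpose_one, Matrix.neg_mul,
      Matrix.mul_neg, ← Matrix.mul_assoc] at h
    exact neg_injective h
  have hRR : Rᵀ * J (Fin 3) F * R = 0 := by
    have h1 : Rᵀ * J (Fin 3) F * (J (Fin 3) F * Λᵀ) = N + Cᵀ * (-1) := by
      rw [← Matrix.mul_assoc, Matrix.mul_assoc Rᵀ, hJJ, Matrix.mul_neg, Matrix.mul_one]
      simp only [R, N, transpose_add, transpose_mul, transpose_transpose, hJt, Matrix.add_mul,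
        Matrix.mul_neg, Matrix.mul_one, Matrix.neg_mul, Matrix.mul_assoc, hLΛ, neg_add, neg_neg]
    have h2 : Rᵀ * J (Fin 3) F * (L * C) = C := by
      rw [← Matrix.mul_assoc, hRL, Matrix.one_mul]
    have h3 : (2⁻¹ : F) + 2⁻¹ = 1 := by
      rw [← two_mul, mul_inv_cancel₀ (NeZero.ne _)]
    change Rᵀ * J (Fin 3) F * (J (Fin 3) F * Λᵀ + L * C) = 0
    rw [Matrix.mul_add, h1, h2]
    simp only [C, transpose_neg, transpose_smul, hN, smul_neg, neg_neg, Matrix.mul_neg,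
      Matrix.mul_one]
    have h4 : N = (2⁻¹ : F) • N + (2⁻¹ : F) • N := by rw [← add_smul, h3, one_smul]
    nth_rewrite 1 [h4]
    abel
  refine ⟨⟨fromCols L R, ?_⟩, d, hd, ?_⟩
  · rw [SymplecticGroup.mem_iff', transpose_fromCols, fromRows_mul, fromRows_mul_fromCols,
      hLJL, hLR, hRL, hRR, J]
  · change K = fromCols L R * fromBlocks (diagonal d) 0 0 0 * (fromCols L R)ᵀ
    rw [fromCols_mul_fromBlocks, transpose_fromCols, fromCols_mul_fromRows, hKL]
    simp

end SymplecticNormalForm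

/-! ### Unipotent elements and diagonal representatives. -/

section X2Orbits

open Matrix

variable {F : Type*} [Field F]

/-- After diagonalization over the small field, both ranks count the same nonzero diagonal entries.
-/
theorem rank_map_of_transpose_eq {K : Type*} [Field K] [Algebra F K] [NeZero (2 : F)] {n : Type*}
    [Fintype n] [DecidableEq n] {S : Matrix n n F} (hS : Sᵀ = S) :
    (S.map (algebraMap F K)).rank = S.rank := by
  classical
  obtain ⟨P, w, hP, h⟩ := exists_eq_mul_diagonal_mul_transpose S hS
  have hP' : IsUnit (P.map (algebraMap F K)).det := by
    have := hP.map (algebraMap F K)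
    rwa [RingHom.map_det] at this
  have hmap : S.map (algebraMap F K) = P.map (algebraMap F K) *
      diagonal (fun i => algebraMap F K (w i)) * (P.map (algebraMap F K))ᵀ := by
    rw [h, Matrix.map_mul, Matrix.map_mul, diagonal_map (map_zero _), transpose_map]
  rw [hmap, rank_mul_eq_left_of_isUnit_det _ _ (by rwa [det_transpose]),
    rank_mul_eq_right_of_isUnit_det _ _ hP', h,
    rank_mul_eq_left_of_isUnit_det _ _ (by rwa [det_transpose]),
    rank_mul_eq_right_of_isUnit_det _ _ hP, rank_diagonal, rank_diagonal]
  simp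

theorem rank_fromBlocks_diagonal {d : Fin 3 → F} (hd : ∀ i, d i ≠ 0) :
    (fromBlocks (diagonal d) 0 0 0 : Matrix (Fin 3 ⊕ Fin 3) (Fin 3 ⊕ Fin 3) F).rank = 3 := by
  classical
  have h : (fromBlocks (diagonal d) 0 0 0 : Matrix (Fin 3 ⊕ Fin 3) (Fin 3 ⊕ Fin 3) F) =
      diagonal (Sum.elim d fun _ => 0) := by
    rw [← fromBlocks_diagonal, diagonal_zero]
  rw [h, rank_diagonal]
  refine (Fintype.card_congr (Equiv.ofBijective
    (fun i : Fin 3 => (⟨Sum.inl i, hd i⟩ : {i // Sum.elim d (fun _ => (0 : F)) i ≠ 0}))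
    ⟨fun i j h => Sum.inl_injective (congrArg Subtype.val h), ?_⟩)).symm.trans (Fintype.card_fin 3)
  rintro ⟨i | i, hi⟩
  · exact ⟨i, rfl⟩
  · exact absurd rfl hi

theorem neZero_ofNat_map (K : Type*) [Field K] [Algebra F K] (n : ℕ) [n.AtLeastTwo]
    [NeZero (OfNat.ofNat n : F)] : NeZero (OfNat.ofNat n : K) :=
  ⟨by
    rw [← map_ofNat (algebraMap F K) n]
    exact (map_ne_zero _).mpr (NeZero.ne _)⟩

theorem wedge_add_left (u u' v w : Fin 3 ⊕ Fin 3 → F) :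
    wedge (u + u') v w = wedge u v w + wedge u' v w := by
  simp only [← wedgeHom_apply, map_add]

theorem wedge_add_middle (u v v' w : Fin 3 ⊕ Fin 3 → F) :
    wedge u (v + v') w = wedge u v w + wedge u v' w := by
  rw [wedge_swap_left u, wedge_add_left, wedge_swap_left u v, wedge_swap_left u v', neg_add]

theorem wedge_add_right (u v w w' : Fin 3 ⊕ Fin 3 → F) :
    wedge u v (w + w') = wedge u v w + wedge u v w' := by
  rw [wedge_swap_right u, wedge_add_middle, wedge_swap_right u v w, wedge_swap_right u v w', neg_add]

theorem wedge_smul_left (c : F) (u v w : Fin 3 ⊕ Fin 3 → F) :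
    wedge (c • u) v w = c • wedge u v w := by
  simp only [← wedgeHom_apply, map_smul]

/-- The element `e_i ↦ e_i`, `e_{i+3} ↦ e_{i+3} + s_i e_i` of `Sp₆`. -/
def spUpper (s : Fin 3 → F) : symplecticGroup (Fin 3) F :=
  ⟨fromBlocks 1 (diagonal s) 0 1, by
    rw [SymplecticGroup.mem_iff, J, fromBlocks_transpose, fromBlocks_multiply, fromBlocks_multiply]
    simp⟩

/-- The element `e_i ↦ e_i + s_i e_{i+3}`, `e_{i+3} ↦ e_{i+3}` of `Sp₆`. -/
def spLower (s : Fin 3 → F) : symplecticGroup (Fin 3) F :=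
  ⟨fromBlocks 1 0 (diagonal s) 1, by
    rw [SymplecticGroup.mem_iff, J, fromBlocks_transpose, fromBlocks_multiply, fromBlocks_multiply]
    simp⟩

theorem spUpper_mulVec_eL (s : Fin 3 → F) (i : Fin 3) : (spUpper s).1 *ᵥ eL F i = eL F i := by
  rw [eL, mulVec_single_one]
  funext j
  rcases j with j | j <;> simp [spUpper, Matrix.one_apply, Pi.single_apply]

theorem spUpper_mulVec_eR (s : Fin 3 → F) (i : Fin 3) :
    (spUpper s).1 *ᵥ eR F i = eR F i + s i • eL F i := by
  rw [eL, eR, mulVec_single_one]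
  funext j
  rcases j with j | j <;> simp [spUpper, Matrix.one_apply, Pi.single_apply, diagonal_apply]
  · split_ifs with h
    · rw [h]
    · rfl

theorem spLower_mulVec_eL (s : Fin 3 → F) (i : Fin 3) :
    (spLower s).1 *ᵥ eL F i = eL F i + s i • eR F i := by
  rw [eL, eR, mulVec_single_one]
  funext j
  rcases j with j | j <;> simp [spLower, Matrix.one_apply, Pi.single_apply, diagonal_apply]
  · split_ifs with h
    · rw [h]
    · rfl

theorem spAct_spUpper_diagElt (s a b c : F) :
    spAct (spUpper ![s, 0, 0]) (diagElt a b c) =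
      diagElt a b c + (a * s) • wedge (eL F 0) (eL F 1) (eL F 2) := by
  simp only [diagElt, map_add, map_smul, spAct_wedge, spUpper_mulVec_eL, spUpper_mulVec_eR,
    cons_val_zero, cons_val_one, cons_val_two, zero_smul, add_zero, wedge_add_left, wedge_smul_left]
  simp
  module

theorem symPart_add_smul_wedge (x : Trivec F) (t : F) :
    symPart (x + t • wedge (eL F 0) (eL F 1) (eL F 2)) = symPart x := by
  ext i j
  rw [symPart_apply, symPart_apply, map_add]
  simp [coord_wedge, eL]

/-- The unipotent element sends e₄ to e₄ − (t/a)e₁, so the term a e₄ ∧ e₂ ∧ e₃ produces exactly the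
multiple that cancels t e₁ ∧ e₂ ∧ e₃. -/
theorem spAct_spUpper_diagElt_add {a : F} (ha : a ≠ 0) (b c t : F) :
    spAct (spUpper ![-(t / a), 0, 0]) (diagElt a b c + t • wedge (eL F 0) (eL F 1) (eL F 2)) =
      diagElt a b c := by
  rw [map_add, spAct_spUpper_diagElt, map_smul, spAct_wedge, spUpper_mulVec_eL, spUpper_mulVec_eL,
    spUpper_mulVec_eL, add_assoc, ← add_smul]
  have h0 : a * -(t / a) + t = 0 := by
    field_simp
    ring
  rw [h0, zero_smul, add_zero]

/-- Moving e₁ ∧ e₂ ∧ e₃ by eᵢ ↦ eᵢ + eᵢ₊₃ changes it by one of the three terms of the diagonal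
element. -/
theorem diagElt_mem_X (a b c : F) : diagElt a b c ∈ X F := by
  have h0 : ∀ g, spAct g (wedge (eL F 0) (eL F 1) (eL F 2)) ∈ X F := fun g =>
    Submodule.subset_span ⟨g, rfl⟩
  have h1 : wedge (eL F 0) (eL F 1) (eL F 2) ∈ X F := by
    have := h0 1
    rwa [spAct_one] at this
  have h2 := h0 (spLower ![1, 0, 0])
  have h3 := h0 (spLower ![0, 1, 0])
  have h4 := h0 (spLower ![0, 0, 1])
  simp only [spAct_wedge, spLower_mulVec_eL] at h2 h3 h4
  simp [wedge_add_left, wedge_add_middle, wedge_add_right] at h2 h3 h4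
  rw [Submodule.add_mem_iff_right _ h1] at h2 h3 h4
  exact (X F).add_mem ((X F).add_mem ((X F).smul_mem _ h2) ((X F).smul_mem _ h3))
    ((X F).smul_mem _ h4)

variable [NeZero (2 : F)] [NeZero (3 : F)]

theorem spAct_spBlockDiag_diagElt {P Z : Matrix (Fin 3) (Fin 3) F} (h : Pᵀ * Z = 1)
    {a b c a' b' c' : F}
    (hS : P.det • (Z * diagonal ![a, b, c] * Zᵀ) = diagonal ![a', b', c']) :
    spAct (spBlockDiag P Z h) (diagElt a b c) = diagElt a' b' c' :=
  eq_of_isTangent (isTangent_spBlockDiag_diagElt P Z h a b c) (isTangent_diagElt a' b' c')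
    (by rw [symPart_spBlockDiag_diagElt, hS, symPart_diagElt])
    (by rw [coord_inl_spBlockDiag_diagElt, coord_inl_diagElt])

theorem exists_spAct_diagElt_eq_one [IsAlgClosed F] {a b c : F} (ha : a ≠ 0) (hb : b ≠ 0)
    (hc : c ≠ 0) : ∃ g, spAct g (diagElt a b c) = diagElt 1 1 1 := by
  obtain ⟨α, hα⟩ := IsAlgClosed.exists_pow_nat_eq a (n := 2) (by norm_num)
  obtain ⟨β, hβ⟩ := IsAlgClosed.exists_pow_nat_eq b (n := 2) (by norm_num)
  obtain ⟨δ, hδ⟩ := IsAlgClosed.exists_pow_nat_eq c (n := 2) (by norm_num)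
  have hα0 : α ≠ 0 := by rintro rfl; exact ha (by rw [← hα]; ring)
  have hβ0 : β ≠ 0 := by rintro rfl; exact hb (by rw [← hβ]; ring)
  have hδ0 : δ ≠ 0 := by rintro rfl; exact hc (by rw [← hδ]; ring)
  -- With a = α², b = β², c = δ² and Z = diag(βδ, αδ, αβ), each entry of Z diag(a, b, c) Zᵀ is
  -- (αβδ)², which is the inverse of det P.
  refine ⟨spBlockDiag (diagonal ![(β * δ)⁻¹, (α * δ)⁻¹, (α * β)⁻¹])
    (diagonal ![β * δ, α * δ, α * β]) ?_, spAct_spBlockDiag_diagElt _ ?_⟩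
  · rw [diagonal_transpose, diagonal_mul_diagonal, ← diagonal_one]
    congr 1
    funext i
    fin_cases i <;> simp <;> field_simp
  · rw [diagonal_transpose, diagonal_mul_diagonal, diagonal_mul_diagonal, det_diagonal,
      ← diagonal_smul, Fin.prod_univ_three, ← hα, ← hβ, ← hδ]
    congr 1
    funext i
    fin_cases i <;> simp <;> field_simp

/-- The base point of `X₂` is in the orbit of a diagonal element. -/
theorem exists_spAct_diagElt_eq_basePoint : ∃ g, spAct g (diagElt (-1) 1 (-2⁻¹) : Trivec F) =
    wedge (eL _ 0) (eR _ 0) (eL _ 2) + wedge (eR _ 1) (eL _ 1) (eL _ 2) +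
        wedge (eL _ 0) (eL _ 1) (eR _ 2) := by
  have h2 := NeZero.ne (2 : F)
  -- The `symPart` of the base point is a hyperbolic plane plus ⟨1⟩. This P diagonalizes the plane,
  -- and its determinant −2 accounts for the entry −1/2.
  have hPZ : (!![1, 1, 0; 1, -1, 0; 0, 0, 1] : Matrix (Fin 3) (Fin 3) F)ᵀ *
      !![2⁻¹, 2⁻¹, 0; 2⁻¹, -2⁻¹, 0; 0, 0, 1] = 1 := by
    ext i j
    fin_cases i <;> fin_cases j <;> simp [Matrix.mul_apply, Fin.sum_univ_three] <;>
      field_simp <;> norm_num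
  refine ⟨spBlockDiag _ _ hPZ, eq_of_isTangent (isTangent_spBlockDiag_diagElt _ _ _ _ _ _) ?_ ?_ ?_⟩
  · intro s i j
    simp [coord_wedge, eL]
  · rw [symPart_spBlockDiag_diagElt]
    ext i j
    rw [symPart_apply, Matrix.smul_apply, Matrix.mul_apply]
    simp only [mul_diagonal, Fin.sum_univ_three, transpose_apply]
    fin_cases i <;> fin_cases j <;> simp [det_fin_three, coord_wedge, eL, eR] <;>
      field_simp <;> norm_num
  · rw [coord_inl_spBlockDiag_diagElt]
    simp [coord_wedge, eR]

theorem extend_diagElt {k K : Type*} [Field k] [Field K] [Algebra k K] (a b c : k) :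
    extend k K (diagElt a b c) =
      diagElt (algebraMap k K a) (algebraMap k K b) (algebraMap k K c) := by
  have hL : ∀ i, algebraMap k K ∘ eL k i = eL K i := by
    intro i
    funext j
    simp [eL, Pi.single_apply]
  have hR : ∀ i, algebraMap k K ∘ eR k i = eR K i := by
    intro i
    funext j
    simp [eR, Pi.single_apply]
  simp only [diagElt, map_add, map_smul, extend_wedge, hL, hR, algebraMap_smul]

end X2Orbits

/-! ### Rational orbits in X₂. -/

section X2Classification

open Matrix

variable {k : Type u} [Field k] [NeZero (2 : k)] [NeZero (3 : k)]

theorem mem_X2_iff (x : Trivec k) : x ∈ X2 k ↔ x ∈ X k ∧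
    ∃ g : symplecticGroup (Fin 3) (AlgebraicClosure k),
      extend k (AlgebraicClosure k) x = spAct g (diagElt 1 1 1) := by
  have := neZero_ofNat_map (F := k) (AlgebraicClosure k) 2
  have := neZero_ofNat_map (F := k) (AlgebraicClosure k) 3
  obtain ⟨g₁, h₁⟩ := exists_spAct_diagElt_eq_basePoint (F := AlgebraicClosure k)
  obtain ⟨g₂, h₂⟩ := exists_spAct_diagElt_eq_one (F := AlgebraicClosure k) (a := -1) (b := 1)
    (c := -2⁻¹) (by simp) one_ne_zero (by simp [NeZero.ne])
  refine and_congr_right fun _ => ⟨?_, ?_⟩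
  · rintro ⟨g, hg⟩
    refine ⟨g * g₁ * g₂⁻¹, ?_⟩
    rw [hg, ← h₁, ← h₂, ← spAct_mul, ← spAct_mul, inv_mul_cancel_right]
  · rintro ⟨g, hg⟩
    refine ⟨g * g₂ * g₁⁻¹, ?_⟩
    rw [hg, ← h₁, ← h₂, ← spAct_mul, ← spAct_mul, inv_mul_cancel_right]

theorem diagElt_mem_X2 (a b c : kˣ) : diagElt (a : k) (b : k) (c : k) ∈ X2 k := by
  have := neZero_ofNat_map (F := k) (AlgebraicClosure k) 2
  have := neZero_ofNat_map (F := k) (AlgebraicClosure k) 3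
  rw [mem_X2_iff]
  refine ⟨diagElt_mem_X _ _ _, ?_⟩
  obtain ⟨g, hg⟩ := exists_spAct_diagElt_eq_one (F := AlgebraicClosure k)
    (a := algebraMap k _ a) (b := algebraMap k _ b) (c := algebraMap k _ c) (by simp) (by simp)
    (by simp)
  exact ⟨g⁻¹, by rw [extend_diagElt, ← hg, ← spAct_mul, inv_mul_cancel, spAct_one]⟩

/-- Every orbit in `X₂` contains a diagonal element. -/
theorem exists_spAct_eq_diagElt {x : Trivec k} (hx : x ∈ X2 k) :
    ∃ (g : symplecticGroup (Fin 3) k) (a b c : kˣ), spAct g x = diagElt (a : k) b c := by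
  have h2 := NeZero.ne (2 : k)
  have := neZero_ofNat_map (F := k) (AlgebraicClosure k) 2
  have := neZero_ofNat_map (F := k) (AlgebraicClosure k) 3
  obtain ⟨hX, g₀, hg₀⟩ := (mem_X2_iff x).mp hx
  have hinj : Function.Injective fun M : Matrix (Fin 3 ⊕ Fin 3) (Fin 3 ⊕ Fin 3) k =>
      M.map (algebraMap k (AlgebraicClosure k)) :=
    Matrix.map_injective (algebraMap k (AlgebraicClosure k)).injective
  have hJ := map_J (l := Fin 3) (algebraMap k (AlgebraicClosure k))
  -- The next three facts are compatible with scalar extension and with the group action, so they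
  -- are checked at `diagElt 1 1 1` over the algebraic closure.
  have hrank : (covariant x).rank = 3 := by
    rw [← rank_map_of_transpose_eq (K := AlgebraicClosure k) (covariant_transpose x),
      ← covariant_extend, hg₀, covariant_spAct]
    have hdet := SymplecticGroup.symplectic_det g₀.2
    rw [rank_mul_eq_left_of_isUnit_det _ _ (by rwa [det_transpose]),
        rank_mul_eq_right_of_isUnit_det _ _ hdet, covariant_diagElt]
    refine rank_fromBlocks_diagonal fun i => ?_
    have h4 : (-4 : AlgebraicClosure k) ≠ 0 := by
      have h : (-4 : AlgebraicClosure k) = -(2 * 2) := by norm_num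
      rw [h]
      exact neg_ne_zero.mpr (mul_ne_zero (NeZero.ne _) (NeZero.ne _))
    fin_cases i <;> simpa using h4
  have hKJK : covariant x * J (Fin 3) k * covariant x = 0 := by
    refine hinj ?_
    simp only [Matrix.map_mul, ← covariant_extend, hJ, Matrix.map_zero _ (map_zero _)]
    rw [hg₀]
    refine covariant_mul_J_mul_covariant_spAct _ ?_
    rw [covariant_diagElt, J, fromBlocks_multiply, fromBlocks_multiply]
    simp
  have hKMK : ∀ a, covariant x * J (Fin 3) k * slice x a * J (Fin 3) k * covariant x = 0 := by
    intro a
    refine hinj ?_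
    simp only [Matrix.map_mul, ← covariant_extend, ← slice_extend, hJ,
      Matrix.map_zero _ (map_zero _)]
    rw [hg₀]
    refine covariant_mul_slice_mul_covariant_spAct _ (fun a => ?_) a
    have hsl : toBlocks₂₂ (slice (diagElt (1 : AlgebraicClosure k) 1 1) a) = 0 := by
      ext i j
      exact isTangent_diagElt _ _ _ a i j
    rw [← fromBlocks_toBlocks (slice (diagElt (1 : AlgebraicClosure k) 1 1) a), hsl,
      covariant_diagElt, J]
    simp [fromBlocks_multiply]
  obtain ⟨g, d, hd, hg⟩ := exists_symplectic_eq_mul_fromBlocks_mul (covariant_transpose x) hrank hKJK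
  set y := spAct g⁻¹ x with hy
  have hcy : covariant y = fromBlocks (diagonal d) 0 0 0 := by
    have h1 : (g⁻¹).1 * g.1 = 1 := congrArg Subtype.val (inv_mul_cancel g)
    rw [hy, covariant_spAct, hg]
    have : (g⁻¹).1 * (g.1 * fromBlocks (diagonal d) 0 0 0 * g.1ᵀ) * (g⁻¹).1ᵀ =
      ((g⁻¹).1 * g.1) * fromBlocks (diagonal d) 0 0 0 * ((g⁻¹).1 * g.1)ᵀ := by
      simp only [Matrix.mul_assoc, transpose_mul]
    rw [this, h1, transpose_one, Matrix.one_mul, Matrix.mul_one]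
  -- With the covariant equal to diag(d) on L, the upper left block of the vanishing product has
  -- entries dᵢ · (coordinate of y at a, eᵢ₊₃, eⱼ₊₃) · dⱼ up to sign.
  have hty : IsTangent y := by
    intro a i j
    have h := covariant_mul_slice_mul_covariant_spAct g⁻¹ hKMK a
    rw [← hy, hcy, ← fromBlocks_toBlocks (slice y a), J] at h
    simp only [fromBlocks_multiply] at h
    have h' := congrFun (congrFun (congrArg toBlocks₁₁ h) i) j
    simp [Matrix.mul_assoc, toBlocks₁₁] at h'
    exact (h'.resolve_left (hd i)).resolve_right (hd j)
  have hsy : (symPart y)ᵀ = symPart y := symPart_transpose_of_contraction hty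
    (trace_slice_mul_J_spAct g⁻¹ (trace_slice_mul_J_of_mem_X hX))
  have hadj : (-4 : k) • (symPart y).adjugate = diagonal d := by
    have := covariant_of_isTangent_of_symm hty hsy
    rw [hcy] at this
    exact (congrArg toBlocks₁₁ this).symm
  -- From S adj(S) = det(S) it follows that S diag(d) is scalar, so S is diagonal.
  have hmul : ∀ i j, symPart y i j * d j = -4 * (symPart y).det * (1 : Matrix _ _ k) i j := by
    intro i j
    rw [← mul_diagonal, ← hadj, Matrix.mul_smul, mul_adjugate, Matrix.smul_apply, Matrix.smul_apply]
    simp [mul_assoc]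
  have hoff : ∀ i j, i ≠ j → symPart y i j = 0 := by
    intro i j hij
    have := hmul i j
    rw [Matrix.one_apply_ne hij, mul_zero] at this
    exact (mul_eq_zero.mp this).resolve_right (hd j)
  have hdiag : symPart y = diagonal ![symPart y 0 0, symPart y 1 1, symPart y 2 2] := by
    ext i j
    by_cases hij : i = j
    · subst hij
      fin_cases i <;> simp
    · rw [hoff i j hij, diagonal_apply_ne _ hij]
  -- Two diagonal cofactors, being nonzero, already involve all three diagonal entries.
  have hne : symPart y 0 0 ≠ 0 ∧ symPart y 1 1 ≠ 0 ∧ symPart y 2 2 ≠ 0 := by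
    have e0 := congrFun (congrFun hadj 0) 0
    have e1 := congrFun (congrFun hadj 1) 1
    rw [hdiag, adjugate_fin_three] at e0 e1
    simp at e0 e1
    have hd0 := hd 0
    have hd1 := hd 1
    rw [← e0] at hd0
    rw [← e1] at hd1
    refine ⟨?_, ?_, ?_⟩ <;> intro h <;> simp [h] at hd0 hd1
  set t := coord (Sum.inl 0) (Sum.inl 1) (Sum.inl 2) y
  have hyt : y = diagElt (symPart y 0 0) (symPart y 1 1) (symPart y 2 2) +
      t • wedge (eL k 0) (eL k 1) (eL k 2) := by
    refine eq_of_isTangent hty ?_ ?_ ?_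
    · intro s i j
      rw [map_add, isTangent_diagElt]
      simp [coord_wedge, eL]
    · rw [symPart_add_smul_wedge, symPart_diagElt]
      exact hdiag
    · rw [map_add, coord_inl_diagElt]
      simp [coord_wedge, eL, t]
  refine ⟨spUpper ![-(t / symPart y 0 0), 0, 0] * g⁻¹, Units.mk0 _ hne.1, Units.mk0 _ hne.2.1,
    Units.mk0 _ hne.2.2, ?_⟩
  rw [spAct_mul, ← hy]
  exact (congrArg _ hyt).trans (spAct_spUpper_diagElt_add hne.1 _ _ _)

/-- If g relates the two elements, their covariants are supported on L, so the upper left block of g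
alone gives a congruence between them. Conversely, S is recovered from its adjugate once det(S) is
under control, so an isometry of the adjugate forms lifts as soon as its determinant has the right
sign. -/
theorem exists_spAct_diagElt_iff (a b c a' b' c' : kˣ) :
    (∃ g, spAct g (diagElt (a : k) b c) = diagElt (a' : k) b' c') ↔
      QuadraticMap.Equivalent (diagForm 1 ((b : k) * c) (c * a) (a * b))
        (diagForm 1 ((b' : k) * c') (c' * a') (a' * b')) := by
  have h2 := NeZero.ne (2 : k)
  have h4 : (-4 : k) ≠ 0 := by
    have h : (-4 : k) = -(2 * 2) := by norm_num
    rw [h]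
    exact neg_ne_zero.mpr (mul_ne_zero h2 h2)
  constructor
  · rintro ⟨g, hg⟩
    have hK := covariant_spAct g (diagElt (a : k) b c)
    rw [hg, covariant_diagElt, covariant_diagElt, ← fromBlocks_toBlocks g.1, fromBlocks_transpose,
      fromBlocks_multiply, fromBlocks_multiply] at hK
    have hK' := congrArg toBlocks₁₁ hK
    simp only [toBlocks_fromBlocks₁₁, Matrix.mul_zero, add_zero, Matrix.zero_mul] at hK'
    set P := toBlocks₁₁ g.1
    have hsc : ∀ w : Fin 3 → k, (diagonal fun i => -4 * w i) = (-4 : k) • diagonal w := fun w => by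
      rw [← diagonal_smul]; rfl
    rw [hsc, hsc, Matrix.mul_smul, Matrix.smul_mul] at hK'
    have hP := smul_right_injective _ h4 hK'
    have hdet : IsUnit Pᵀ.det := by
      have := congrArg det hP
      rw [det_mul, det_mul, det_diagonal, Fin.prod_univ_three] at this
      rw [isUnit_iff_ne_zero]
      intro h0
      rw [h0, mul_zero] at this
      simp at this
    refine equivalent_vecCons 1 (QuadraticMap.Equivalent.symm
      (equivalent_weightedSumSquares_of_congr hdet ?_))
    rw [transpose_transpose]
    exact hP.symm
  · intro h
    obtain ⟨P, hP, hPw⟩ := exists_congr_of_equivalent_weightedSumSquares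
      (equivalent_of_vecCons one_ne_zero h).symm
    -- The forms have determinants (abc)² and (a'b'c')², so det P is determined up to sign; in
    -- dimension 3, replacing P by −P changes that sign.
    have hdet : (Pᵀ.det - (a' * b' * c' / (a * b * c) : k)) *
        (Pᵀ.det + (a' * b' * c' / (a * b * c) : k)) = 0 := by
      have := congrArg det hPw
      rw [det_mul, det_mul, det_diagonal, det_diagonal, Fin.prod_univ_three,
        Fin.prod_univ_three] at this
      simp only [cons_val_zero, cons_val_one, cons_val] at this
      have ha := a.ne_zero
      have hb := b.ne_zero
      have hc := c.ne_zero
      rw [det_transpose] at this ⊢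
      field_simp
      linear_combination this
    obtain ⟨R, hR, hRw⟩ : ∃ R : Matrix (Fin 3) (Fin 3) k,
        R.det = a' * b' * c' / (a * b * c) ∧ R * diagonal ![(b : k) * c, c * a, a * b] * Rᵀ =
          diagonal ![(b' : k) * c', c' * a', a' * b'] := by
      rcases mul_eq_zero.mp hdet with h | h
      · exact ⟨Pᵀ, sub_eq_zero.mp h, by rw [transpose_transpose]; exact hPw⟩
      · refine ⟨-Pᵀ, ?_, by rw [transpose_neg, transpose_transpose]; simpa using hPw⟩
        rw [det_neg, Fintype.card_fin]
        linear_combination -h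
    have hu : IsUnit Rᵀ.det := by
      rw [det_transpose, hR]
      simp
    refine ⟨spBlockDiag R (Rᵀ)⁻¹ (mul_nonsing_inv _ hu), spAct_spBlockDiag_diagElt _ ?_⟩
    -- The relation adj(S) S = det(S) for S = diag(a, b, c); the required identity is checked after
    -- multiplication by the adjugate of the target.
    have hw : ∀ a b c : k, diagonal ![b * c, c * a, a * b] * diagonal ![a, b, c] =
        (a * b * c) • (1 : Matrix (Fin 3) (Fin 3) k) := by
      intro a b c
      rw [diagonal_mul_diagonal, ← diagonal_one, ← diagonal_smul]
      congr 1
      funext i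
      fin_cases i <;> simp <;> ring
    have hw' : IsUnit (diagonal ![(b' : k) * c', c' * a', a' * b']) := by
      rw [Matrix.isUnit_iff_isUnit_det, det_diagonal, Fin.prod_univ_three]
      simp
    refine hw'.mul_left_cancel ?_
    rw [hw, ← hRw, Matrix.mul_smul, transpose_nonsing_inv, transpose_transpose]
    have e : R * diagonal ![(b : k) * c, c * a, a * b] * Rᵀ *
        ((Rᵀ)⁻¹ * diagonal ![(a : k), b, c] * R⁻¹) = R * (diagonal ![(b : k) * c, c * a, a * b] *
          (Rᵀ * (Rᵀ)⁻¹) * diagonal ![(a : k), b, c]) * R⁻¹ := by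
      simp only [Matrix.mul_assoc]
    rw [e, mul_nonsing_inv _ hu, Matrix.mul_one, hw, Matrix.mul_smul, Matrix.smul_mul,
      Matrix.mul_one, mul_nonsing_inv _ (by rwa [det_transpose] at hu), smul_smul, hR]
    congr 1
    have ha := a.ne_zero
    have hb := b.ne_zero
    have hc := c.ne_zero
    field_simp

/-- The classification of the orbits in `X₂` by quaternion algebras. -/
theorem exists_equiv_X2Orbits :
    ∃ Ψ : X2Orbits k ≃ QuatClasses k, ∀ a b c : kˣ,
      ∃ hx : diagElt (a : k) (b : k) (c : k) ∈ X2 k, ∀ Q : QuatAlg k,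
        Ψ (Quotient.mk (x2Setoid k) ⟨diagElt (a : k) (b : k) (c : k), hx⟩) =
            Quotient.mk (quatSetoid k) Q ↔
          QuadraticMap.Equivalent Q.norm (diagForm 1 ((b : k) * c) (c * a) (a * b)) := by
  choose g a b c hg using fun x : X2 k => exists_spAct_eq_diagElt x.2
  -- The chosen diagonal representative of an orbit matters only through its quaternary form.
  have hrel : ∀ (x : X2 k) (a' b' c' : kˣ),
      (∃ g, spAct g x.1 = diagElt (a' : k) b' c') ↔ QuadraticMap.Equivalent
        (diagForm 1 ((b x : k) * c x) (c x * a x) (a x * b x))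
        (diagForm 1 ((b' : k) * c') (c' * a') (a' * b')) := by
    intro x a' b' c'
    rw [← exists_spAct_diagElt_iff, ← hg]
    constructor
    · rintro ⟨h, hh⟩
      exact ⟨h * (g x)⁻¹, by rw [← spAct_mul, inv_mul_cancel_right, hh]⟩
    · rintro ⟨h, hh⟩
      exact ⟨h * g x, by rw [spAct_mul, hh]⟩
  have hmem := fun a b c : kˣ => diagElt_mem_X2 a b c
  let F (x : X2 k) : QuadraticForm k (Fin 4 → k) :=
    diagForm 1 ((b x : k) * c x) (c x * a x) (a x * b x)
  have hs : ∀ x y, (x2Setoid k).r x y ↔ QuadraticMap.Equivalent (F x) (F y) := by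
    intro x y
    rw [← hrel, ← hg]
    constructor
    · rintro ⟨h, hh⟩
      exact ⟨g y * h, by rw [spAct_mul, hh]⟩
    · rintro ⟨h, hh⟩
      exact ⟨(g y)⁻¹ * h, by rw [spAct_mul, hh, ← spAct_mul, inv_mul_cancel, spAct_one]⟩
  have hF : ∀ x, ∃ Q : QuatAlg k, QuadraticMap.Equivalent Q.norm (F x) := by
    intro x
    obtain ⟨Q, hQ⟩ := exists_quatAlg_norm_equivalent (a := (b x : k) * c x) (b := (c x : k) * a x)
      (by simp) (by simp)
    refine ⟨Q, hQ.trans (equivalent_weightedSumSquares_of_sq ![1, 1, 1, (c x : k)] ?_ ?_)⟩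
    · intro i
      fin_cases i <;> simp
    · intro i
      fin_cases i <;> simp
      ring
  have hQ : ∀ Q : QuatAlg k, ∃ x, QuadraticMap.Equivalent Q.norm (F x) := by
    intro Q
    obtain ⟨u, v, hu, hv, hQ⟩ := exists_norm_equivalent_diagForm Q
    -- For (a, b, c) = (v, u, 1) the form ⟨1, bc, ca, ab⟩ is ⟨1, u, v, vu⟩.
    refine ⟨⟨_, hmem (Units.mk0 v hv) (Units.mk0 u hu) 1⟩, hQ.trans ?_⟩
    have := (hrel ⟨_, hmem (Units.mk0 v hv) (Units.mk0 u hu) 1⟩ (Units.mk0 v hv) (Units.mk0 u hu)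
      1).mp ⟨1, spAct_one _⟩
    refine QuadraticMap.Equivalent.trans ?_ this.symm
    convert QuadraticMap.Equivalent.refl _ using 2
    all_goals simp [mul_comm]
  obtain ⟨Ψ, hΨ⟩ := exists_equiv_quatClasses (x2Setoid k) F hs hF hQ
  refine ⟨Ψ, fun a' b' c' => ⟨hmem a' b' c', fun Q => ?_⟩⟩
  rw [hΨ]
  have := (hrel ⟨_, hmem a' b' c'⟩ a' b' c').mp ⟨1, spAct_one _⟩
  exact ⟨fun h => h.trans this, fun h => h.trans this.symm⟩

end X2Classification

/-! ### Forms of the algebra of symmetric matrices of degree three -/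

section JordanForms

open Matrix

variable {k K : Type*} [Field k] [Field K] [Algebra k K]

/-- The matrix of `v ↦ s × v`. -/
def crossMatrix (s : Fin 3 → K) : Matrix (Fin 3) (Fin 3) K :=
  !![0, -s 2, s 1; s 2, 0, -s 0; -s 1, s 0, 0]

/-- The inverse of `crossMatrix` on alternating matrices. -/
def axialVector : Matrix (Fin 3) (Fin 3) K →ₗ[K] (Fin 3 → K) where
  toFun M := ![M 2 1, M 0 2, M 1 0]
  map_add' M N := by simp
  map_smul' c M := by simp

theorem axialVector_apply (M : Matrix (Fin 3) (Fin 3) K) :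
    axialVector M = ![M 2 1, M 0 2, M 1 0] := rfl

/-- The commutator of symmetric matrices is alternating, hence the cross product with a vector. -/
theorem crossMatrix_axialVector_commutator {x y : Matrix (Fin 3) (Fin 3) K} (hx : xᵀ = x)
    (hy : yᵀ = y) : crossMatrix (axialVector (x * y - y * x)) = x * y - y * x := by
  have hx' : ∀ i j, x i j = x j i := fun i j => congrFun (congrFun hx j) i
  have hy' : ∀ i j, y i j = y j i := fun i j => congrFun (congrFun hy j) i
  ext i j
  fin_cases i <;> fin_cases j <;>
    simp [crossMatrix, axialVector_apply, Matrix.mul_apply, Fin.sum_univ_three, hx' 1 0, hx' 2 0,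
      hx' 2 1, hy' 1 0, hy' 2 0, hy' 2 1] <;> ring

theorem crossMatrix_mul_self (s : Fin 3 → K) :
    crossMatrix s * crossMatrix s = vecMulVec s s - (s ⬝ᵥ s) • 1 := by
  ext i j
  fin_cases i <;> fin_cases j <;>
    simp [crossMatrix, Matrix.mul_apply, Fin.sum_univ_three, vecMulVec_apply, dotProduct] <;> ring

theorem trace_crossMatrix_mul (s t : Fin 3 → K) :
    trace (crossMatrix s * crossMatrix t) = -2 * (s ⬝ᵥ t) := by
  simp [crossMatrix, trace, Fin.sum_univ_three, dotProduct]
  ring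

/-- This yields stᵀ + tsᵀ when s · t = 0 and t · t ≠ 0, where the Jordan product of ssᵀ and ttᵀ
gives nothing. -/
theorem commutator_crossMatrix_vecMulVec (s t : Fin 3 → K) :
    crossMatrix t * (crossMatrix s * vecMulVec t t - vecMulVec t t * crossMatrix s) -
      (crossMatrix s * vecMulVec t t - vecMulVec t t * crossMatrix s) * crossMatrix t =
    (t ⬝ᵥ t) • (vecMulVec s t + vecMulVec t s) - (2 * (s ⬝ᵥ t)) • vecMulVec t t := by
  ext i j
  simp only [Matrix.mul_apply, Matrix.sub_apply, Matrix.add_apply, Matrix.smul_apply,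
    Fin.sum_univ_three, vecMulVec_apply, dotProduct, smul_eq_mul]
  fin_cases i <;> fin_cases j <;> simp [crossMatrix] <;> ring

theorem vecMulVec_mul_add_mul (s t : Fin 3 → K) :
    vecMulVec s s * vecMulVec t t + vecMulVec t t * vecMulVec s s =
      (s ⬝ᵥ t) • (vecMulVec s t + vecMulVec t s) := by
  rw [vecMulVec_mul_vecMulVec, vecMulVec_mul_vecMulVec, dotProduct_comm t s, smul_add,
    vecMulVec_smul, vecMulVec_smul]

section Submodule

variable [NeZero (2 : k)] {J : Submodule k (Matrix (Fin 3) (Fin 3) K)}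

theorem mem_of_two_smul_mem {M : Type*} [AddCommGroup M] [Module k M] {J : Submodule k M} {x : M}
    (h : (2 : k) • x ∈ J) : x ∈ J := by
  have := J.smul_mem (2⁻¹ : k) h
  rwa [smul_smul, inv_mul_cancel₀ (NeZero.ne _), one_smul] at this

theorem mul_self_mem (hJ : ∀ x ∈ J, ∀ y ∈ J, x * y + y * x ∈ J) {x : Matrix (Fin 3) (Fin 3) K}
    (hx : x ∈ J) : x * x ∈ J :=
  mem_of_two_smul_mem (by rw [two_smul]; exact hJ x hx x hx)

/-- With u∘v = uv + vu, one has 2xyx = x∘(x∘y) − x²∘y. -/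
theorem mul_mul_mem (hJ : ∀ x ∈ J, ∀ y ∈ J, x * y + y * x ∈ J) {x y : Matrix (Fin 3) (Fin 3) K}
    (hx : x ∈ J) (hy : y ∈ J) : x * y * x ∈ J := by
  refine mem_of_two_smul_mem ?_
  have h := J.sub_mem (hJ x hx _ (hJ x hx y hy)) (hJ _ (mul_self_mem hJ hx) y hy)
  convert h using 1
  rw [two_smul]
  noncomm_ring

/-- With u∘v = uv + vu, one has [x, y]² = x∘(yxy) − xy²x − yx²y. -/
theorem commutator_mul_self_mem (hJ : ∀ x ∈ J, ∀ y ∈ J, x * y + y * x ∈ J)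
    {x y : Matrix (Fin 3) (Fin 3) K} (hx : x ∈ J) (hy : y ∈ J) :
    (x * y - y * x) * (x * y - y * x) ∈ J := by
  have h := J.sub_mem (J.sub_mem (hJ x hx _ (mul_mul_mem hJ hy hx))
    (mul_mul_mem hJ hx (mul_self_mem hJ hy))) (mul_mul_mem hJ hy (mul_self_mem hJ hx))
  convert h using 1
  noncomm_ring

/-- With u∘v = uv + vu, one has [[x, y], z] = x∘(y∘z) − y∘(x∘z). -/
theorem commutator_commutator_mem (hJ : ∀ x ∈ J, ∀ y ∈ J, x * y + y * x ∈ J)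
    {x y z : Matrix (Fin 3) (Fin 3) K} (hx : x ∈ J) (hy : y ∈ J) (hz : z ∈ J) :
    (x * y - y * x) * z - z * (x * y - y * x) ∈ J := by
  have h := J.sub_mem (hJ x hx _ (hJ y hy z hz)) (hJ y hy _ (hJ x hx z hz))
  convert h using 1
  noncomm_ring

/-- Up to the factor −2 the dot product is tr([a, b][c, d]) = tr([[a, b], c] d). Since [[a, b], c]
lies in J, this is half the trace of an element of J. -/
theorem dotProduct_axialVector_mem [NeZero (2 : K)] (hJ : ∀ x ∈ J, ∀ y ∈ J, x * y + y * x ∈ J)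
    (hsym : ∀ x ∈ J, xᵀ = x) (htr : ∀ x ∈ J, trace x ∈ (algebraMap k K).range)
    {a b c d : Matrix (Fin 3) (Fin 3) K} (ha : a ∈ J) (hb : b ∈ J) (hc : c ∈ J) (hd : d ∈ J) :
    axialVector (a * b - b * a) ⬝ᵥ axialVector (c * d - d * c) ∈ (algebraMap k K).range := by
  have h1 := trace_crossMatrix_mul (axialVector (a * b - b * a)) (axialVector (c * d - d * c))
  rw [crossMatrix_axialVector_commutator (hsym _ ha) (hsym _ hb),
    crossMatrix_axialVector_commutator (hsym _ hc) (hsym _ hd)] at h1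
  have hz := commutator_commutator_mem hJ ha hb hc
  have h2 : trace ((a * b - b * a) * (c * d - d * c)) =
      trace (((a * b - b * a) * c - c * (a * b - b * a)) * d) := by
    simp only [mul_sub, sub_mul, trace_sub, ← Matrix.mul_assoc]
    rw [trace_mul_comm (a * b * d), trace_mul_comm (b * a * d)]
    simp only [← Matrix.mul_assoc]
  obtain ⟨t, ht⟩ := htr _ (hJ _ hz d hd)
  rw [trace_add, trace_mul_comm d, ← h2, h1] at ht
  refine ⟨-(2⁻¹ * 2⁻¹) * t, ?_⟩
  have h2k : (2 : K) ≠ 0 := NeZero.ne _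
  rw [map_mul, ht, map_neg, map_mul, map_inv₀, map_ofNat]
  field_simp
  ring

end Submodule

end JordanForms

/-! ### Rank-one elements in Jordan algebras of symmetric matrices. -/

section JordanForms

open Matrix

variable {k K : Type*} [Field k] [Field K] [Algebra k K]

section Submodule

variable [NeZero (2 : k)] [NeZero (2 : K)] {J : Submodule k (Matrix (Fin 3) (Fin 3) K)}

/-- The square of the commutator is ssᵀ − (s · s)1, and s · s lies in k. -/
theorem vecMulVec_axialVector_mem (hJ : ∀ x ∈ J, ∀ y ∈ J, x * y + y * x ∈ J)
    (hsym : ∀ x ∈ J, xᵀ = x) (htr : ∀ x ∈ J, trace x ∈ (algebraMap k K).range) (h1 : 1 ∈ J)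
    {a b : Matrix (Fin 3) (Fin 3) K} (ha : a ∈ J) (hb : b ∈ J) :
    vecMulVec (axialVector (a * b - b * a)) (axialVector (a * b - b * a)) ∈ J := by
  have h := commutator_mul_self_mem hJ ha hb
  rw [← crossMatrix_axialVector_commutator (hsym _ ha) (hsym _ hb), crossMatrix_mul_self] at h
  obtain ⟨t, ht⟩ := dotProduct_axialVector_mem hJ hsym htr ha hb ha hb
  rw [← ht, algebraMap_smul] at h
  simpa using J.add_mem h (J.smul_mem t h1)

theorem vecMulVec_add_vecMulVec_mem (hJ : ∀ x ∈ J, ∀ y ∈ J, x * y + y * x ∈ J)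
    (hsym : ∀ x ∈ J, xᵀ = x) (htr : ∀ x ∈ J, trace x ∈ (algebraMap k K).range) (h1 : 1 ∈ J)
    {a b c d : Matrix (Fin 3) (Fin 3) K} (ha : a ∈ J) (hb : b ∈ J) (hc : c ∈ J) (hd : d ∈ J)
    {s t : Fin 3 → K} (hs : s = axialVector (a * b - b * a))
    (ht : t = axialVector (c * d - d * c)) (hst : s ⬝ᵥ t ≠ 0 ∨ t ⬝ᵥ t ≠ 0) :
    vecMulVec s t + vecMulVec t s ∈ J := by
  have hss := vecMulVec_axialVector_mem hJ hsym htr h1 ha hb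
  have htt := vecMulVec_axialVector_mem hJ hsym htr h1 hc hd
  obtain ⟨p, hp⟩ := dotProduct_axialVector_mem hJ hsym htr ha hb hc hd
  obtain ⟨q, hq⟩ := dotProduct_axialVector_mem hJ hsym htr hc hd hc hd
  rw [← hs] at hss hp
  rw [← ht] at htt hp hq
  have cancel : ∀ (r : k) (x : Matrix (Fin 3) (Fin 3) K), algebraMap k K r ≠ 0 →
      algebraMap k K r • x ∈ J → x ∈ J := by
    intro r x hr hx
    rw [algebraMap_smul] at hx
    have hr' : r ≠ 0 := by rintro rfl; exact hr (map_zero _)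
    simpa [smul_smul, hr'] using J.smul_mem r⁻¹ hx
  by_cases h : s ⬝ᵥ t = 0
  · have h' := hst.resolve_left (not_not.mpr h)
    have e := commutator_crossMatrix_vecMulVec s t
    rw [h, mul_zero, zero_smul, sub_zero, ← hq] at e
    refine cancel q _ (by rwa [hq]) ?_
    rw [← e, hs, ht, crossMatrix_axialVector_commutator (hsym _ ha) (hsym _ hb),
      crossMatrix_axialVector_commutator (hsym _ hc) (hsym _ hd), ← ht]
    exact commutator_commutator_mem hJ hc hd (commutator_commutator_mem hJ ha hb htt)
  · refine cancel p _ (by rwa [hp]) ?_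
    rw [hp, ← vecMulVec_mul_add_mul]
    exact hJ _ hss _ htt

/-- A Jordan algebra of symmetric matrices whose commutators span the alternating matrices contains
the products `Sᵀ Z S` with `Z` symmetric, for some `S` with `S Sᵀ` defined over the base field. -/
theorem exists_transpose_mul_mul_mem (hJ : ∀ x ∈ J, ∀ y ∈ J, x * y + y * x ∈ J)
    (hsym : ∀ x ∈ J, xᵀ = x) (htr : ∀ x ∈ J, trace x ∈ (algebraMap k K).range) (h1 : 1 ∈ J)
    (hspan : Submodule.span K {s | ∃ a ∈ J, ∃ b ∈ J, axialVector (a * b - b * a) = s} = ⊤) :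
    ∃ (S : Matrix (Fin 3) (Fin 3) K) (G : Matrix (Fin 3) (Fin 3) k), IsUnit S.det ∧ Gᵀ = G ∧
      S * Sᵀ = G.map (algebraMap k K) ∧
      ∀ Z : Matrix (Fin 3) (Fin 3) k, Zᵀ = Z → Sᵀ * Z.map (algebraMap k K) * S ∈ J := by
  have h3 : Module.finrank K (Submodule.span K
      {s : Fin 3 → K | ∃ a ∈ J, ∃ b ∈ J, axialVector (a * b - b * a) = s}) = 3 := by
    rw [hspan, finrank_top]; simp
  have hex := Submodule.exists_fun_fin_finrank_span_eq K
    {s : Fin 3 → K | ∃ a ∈ J, ∃ b ∈ J, axialVector (a * b - b * a) = s}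
  rw [h3] at hex
  obtain ⟨S, hS, -, hli⟩ := hex
  choose a ha b hb hab using hS
  have hdot : ∀ i j, S i ⬝ᵥ S j ∈ (algebraMap k K).range := by
    intro i j
    rw [← hab, ← hab]
    exact dotProduct_axialVector_mem hJ hsym htr (ha i) (hb i) (ha j) (hb j)
  choose G hG using hdot
  have hu : IsUnit (Matrix.of S).det := by
    rw [← Matrix.isUnit_iff_isUnit_det, ← Matrix.linearIndependent_rows_iff_isUnit]
    exact hli
  have hSS : Matrix.of S * (Matrix.of S)ᵀ = (Matrix.of G).map (algebraMap k K) := by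
    ext i j
    exact (hG i j).symm
  have hmem : ∀ i j, vecMulVec (S i) (S j) + vecMulVec (S j) (S i) ∈ J := by
    intro i j
    by_cases hij : i = j
    · subst hij
      have := vecMulVec_axialVector_mem hJ hsym htr h1 (ha i) (hb i)
      rw [hab] at this
      exact J.add_mem this this
    · by_cases hne : S i ⬝ᵥ S j ≠ 0 ∨ S j ⬝ᵥ S j ≠ 0
      · exact vecMulVec_add_vecMulVec_mem hJ hsym htr h1 (ha i) (hb i) (ha j) (hb j)
          (hab i).symm (hab j).symm hne
      · by_cases hne' : S i ⬝ᵥ S i ≠ 0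
        · rw [add_comm]
          exact vecMulVec_add_vecMulVec_mem hJ hsym htr h1 (ha j) (hb j) (ha i) (hb i)
            (hab j).symm (hab i).symm (Or.inr hne')
        -- In the remaining case the Gram matrix would vanish on a two-dimensional coordinate
        -- subspace of a three-dimensional space and so be singular, although S is invertible.
        · push Not at hne hne'
          exfalso
          have hd : (Matrix.of S * (Matrix.of S)ᵀ).det ≠ 0 := by
            rw [det_mul, det_transpose]
            exact mul_ne_zero hu.ne_zero hu.ne_zero
          apply hd
          have e : ∀ i j, (Matrix.of S * (Matrix.of S)ᵀ) i j = S i ⬝ᵥ S j := fun _ _ => rfl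
          have hji := hne.1
          rw [dotProduct_comm] at hji
          rw [det_fin_three]
          simp only [e]
          obtain ⟨hne1, hne2⟩ := hne
          clear * - hne1 hne2 hji hne' hij
          fin_cases i <;> fin_cases j <;> first | exact absurd rfl hij | skip
          all_goals
            simp only [Fin.zero_eta, Fin.mk_one, Fin.reduceFinMk] at hne1 hne2 hji hne'
            simp only [hne1, hne2, hji, hne']
            ring
  refine ⟨Matrix.of S, Matrix.of G, hu, ?_, hSS, ?_⟩
  · ext i j
    refine (algebraMap k K).injective ?_
    rw [transpose_apply, of_apply, of_apply, hG, hG, dotProduct_comm]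
  · intro Z hZ
    have hZ' : ∀ i j, Z i j = Z j i := fun i j => congrFun (congrFun hZ j) i
    have hsum : (Matrix.of S)ᵀ * Z.map (algebraMap k K) * Matrix.of S =
        ∑ i, ∑ j, Z i j • vecMulVec (S i) (S j) := by
      ext p q
      simp only [Matrix.mul_apply, Matrix.sum_apply, Matrix.smul_apply, vecMulVec_apply,
        transpose_apply, of_apply, map_apply, Finset.sum_mul]
      simp only [Algebra.smul_def]
      rw [Finset.sum_comm]
      refine Finset.sum_congr rfl fun i _ => Finset.sum_congr rfl fun j _ => ?_
      ring
    refine mem_of_two_smul_mem ?_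
    have hsum' : (2 : k) • ((Matrix.of S)ᵀ * Z.map (algebraMap k K) * Matrix.of S) =
        ∑ i, ∑ j, Z i j • (vecMulVec (S i) (S j) + vecMulVec (S j) (S i)) := by
      simp only [smul_add, Finset.sum_add_distrib]
      rw [two_smul, hsum]
      congr 1
      rw [Finset.sum_comm]
      refine Finset.sum_congr rfl fun i _ => Finset.sum_congr rfl fun j _ => ?_
      rw [hZ']
    rw [hsum']
    exact J.sum_mem fun i _ => J.sum_mem fun j _ => J.smul_mem _ (hmem i j)

end Submodule

/-- Products satisfy (SᵀZS)(SᵀZ'S) = Sᵀ(ZGZ')S with G = SSᵀ over k, so the symmetric Z over k form a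
Jordan algebra inside the image of f. Diagonalizing G identifies it with some H₃(k, Γ), and equality
of dimensions makes it the whole image. -/
theorem exists_algIso_H3k_of_range {k : Type u} {K A : Type*} [Field k] [NeZero (2 : k)] [Field K]
    [Algebra k K] [NonUnitalNonAssocRing A] [Module k A] (hA : Module.finrank k A = 6)
    (f : A →ₗ[k] Matrix (Fin 3) (Fin 3) K) (hf : Function.Injective f)
    (hmul : ∀ a b, f (a * b) = (2⁻¹ : k) • (f a * f b + f b * f a)) (hsym : ∀ a, (f a)ᵀ = f a)
    (htr : ∀ a, trace (f a) ∈ (algebraMap k K).range) (h1 : ∃ a, f a = 1)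
    (hspan : Submodule.span K {s | ∃ a b, axialVector (f a * f b - f b * f a) = s} = ⊤) :
    ∃ γ : Fin 3 → kˣ, AlgIso k A (H3k γ) := by
  have h2 := NeZero.ne (2 : k)
  have := neZero_ofNat_map (F := k) K 2
  obtain ⟨S, G, hS, hG, hSS, hmem⟩ := exists_transpose_mul_mul_mem (J := LinearMap.range f)
    (by
      rintro _ ⟨a, rfl⟩ _ ⟨b, rfl⟩
      exact ⟨(2 : k) • (a * b), by rw [map_smul, hmul, smul_smul, mul_inv_cancel₀ h2, one_smul]⟩)
    (by rintro _ ⟨a, rfl⟩; exact hsym a) (by rintro _ ⟨a, rfl⟩; exact htr a) h1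
    (by simpa using hspan)
  obtain ⟨R, d, hR, hd⟩ := exists_eq_mul_diagonal_mul_transpose G hG
  have hdu : IsUnit (diagonal d).det := by
    have h := congrArg det hSS
    rw [← RingHom.mapMatrix_apply, ← RingHom.map_det, hd, det_mul, det_mul, det_mul, det_transpose,
      det_transpose] at h
    have h' : algebraMap k K (R.det * (diagonal d).det * R.det) ≠ 0 := by
      rw [← h]
      exact mul_ne_zero hS.ne_zero hS.ne_zero
    rw [isUnit_iff_ne_zero]
    intro h0
    rw [h0] at h'
    simp at h'
  have hd0 : ∀ i, d i ≠ 0 := by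
    rw [det_diagonal] at hdu
    exact fun i => Finset.prod_ne_zero_iff.mp hdu.ne_zero i (Finset.mem_univ i)
  set γ : Fin 3 → kˣ := fun i => Units.mk0 (d i) (hd0 i)
  have hRt : IsUnit Rᵀ.det := by rwa [det_transpose]
  -- For G = R diag(d) Rᵀ the outer factors cancel G, so F is multiplicative. If X lies in H₃(k, Γ),
  -- then X diag(d)⁻¹ is symmetric, so F X has the form SᵀZS with Z symmetric.
  let F : Matrix (Fin 3) (Fin 3) k →ₗ[k] Matrix (Fin 3) (Fin 3) K :=
    { toFun := fun X => Sᵀ * ((Rᵀ)⁻¹ * X * (diagonal d)⁻¹ * R⁻¹).map (algebraMap k K) * S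
      map_add' := fun X Y => by
        simp only [Matrix.mul_add, Matrix.add_mul, Matrix.map_add _ (map_add (algebraMap k K))]
      map_smul' := fun c X => by
        have : ∀ Y : Matrix (Fin 3) (Fin 3) k, (c • Y).map (algebraMap k K) =
            c • Y.map (algebraMap k K) := fun Y => by
          ext i j
          rw [map_apply, Matrix.smul_apply, Matrix.smul_apply, map_apply, smul_eq_mul, map_mul,
            Algebra.smul_def]
        simp only [Matrix.mul_smul, Matrix.smul_mul, this, RingHom.id_apply] }
  have hF : ∀ X, F X = Sᵀ * ((Rᵀ)⁻¹ * X * (diagonal d)⁻¹ * R⁻¹).map (algebraMap k K) * S :=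
    fun _ => rfl
  have hFmul : ∀ X Y, F (X * Y) = F X * F Y := by
    intro X Y
    have e : (Rᵀ)⁻¹ * X * (diagonal d)⁻¹ * R⁻¹ * G * ((Rᵀ)⁻¹ * Y * (diagonal d)⁻¹ * R⁻¹) =
        (Rᵀ)⁻¹ * (X * Y) * (diagonal d)⁻¹ * R⁻¹ := by
      rw [hd]
      calc _ = (Rᵀ)⁻¹ * X * ((diagonal d)⁻¹ * (R⁻¹ * R) * diagonal d) * (Rᵀ * (Rᵀ)⁻¹) * Y *
          (diagonal d)⁻¹ * R⁻¹ := by simp only [Matrix.mul_assoc]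
        _ = _ := by
          rw [nonsing_inv_mul _ hR, mul_nonsing_inv _ hRt, Matrix.mul_one, Matrix.mul_one,
            nonsing_inv_mul _ hdu, Matrix.mul_one]
          simp only [Matrix.mul_assoc]
    rw [hF, hF, hF, ← e, Matrix.map_mul, Matrix.map_mul, ← hSS]
    simp only [Matrix.mul_assoc]
  have hFinj : Function.Injective F := by
    intro X Y hXY
    rw [hF, hF] at hXY
    have hSu : IsUnit S := (Matrix.isUnit_iff_isUnit_det S).mpr hS
    have hStu : IsUnit Sᵀ := (Matrix.isUnit_iff_isUnit_det _).mpr (by rwa [det_transpose])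
    have hRu : IsUnit R⁻¹ := (Matrix.isUnit_iff_isUnit_det _).mpr (isUnit_nonsing_inv_det _ hR)
    have hRtu : IsUnit (Rᵀ)⁻¹ := (Matrix.isUnit_iff_isUnit_det _).mpr (isUnit_nonsing_inv_det _ hRt)
    have hDu : IsUnit (diagonal d)⁻¹ :=
      (Matrix.isUnit_iff_isUnit_det _).mpr (isUnit_nonsing_inv_det _ hdu)
    exact hRtu.mul_left_cancel (hDu.mul_right_cancel (hRu.mul_right_cancel
      (Matrix.map_injective (algebraMap k K).injective
        (hStu.mul_left_cancel (hSu.mul_right_cancel hXY)))))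
  have hFmem : ∀ X : H3k γ, F X.1 ∈ LinearMap.range f := by
    intro X
    refine hmem _ ?_
    have hX : X.1ᵀ * diagonal d = diagonal d * X.1 := by
      have := (mem_H3k_iff_matrix γ one_ne_zero X.1).mp X.2
      simpa [γ] using this
    have hX' : (diagonal d)⁻¹ * X.1ᵀ = X.1 * (diagonal d)⁻¹ := by
      calc _ = (diagonal d)⁻¹ * (X.1ᵀ * diagonal d) * (diagonal d)⁻¹ := by
            rw [Matrix.mul_assoc, Matrix.mul_assoc, mul_nonsing_inv _ hdu, Matrix.mul_one]
        _ = _ := by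
            rw [hX, ← Matrix.mul_assoc, nonsing_inv_mul _ hdu, Matrix.one_mul]
    simp only [transpose_mul, transpose_nonsing_inv, transpose_transpose, diagonal_transpose]
    rw [← Matrix.mul_assoc (diagonal d)⁻¹, hX']
    simp only [Matrix.mul_assoc]
  let e : A ≃ₗ[k] LinearMap.range f := LinearEquiv.ofInjective f hf
  let φ : H3k γ →ₗ[k] A :=
    e.symm.toLinearMap ∘ₗ (F.comp (H3k γ).subtype).codRestrict (LinearMap.range f) hFmem
  have hφ : ∀ X, f (φ X) = F X.1 := fun X =>
    congrArg Subtype.val (e.apply_symm_apply ⟨F X.1, hFmem X⟩)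
  have hinj : Function.Injective φ := by
    intro X Y hXY
    apply Subtype.ext
    apply hFinj
    rw [← hφ, ← hφ, hXY]
  have : Module.Finite k A := Module.finite_of_finrank_pos (by rw [hA]; norm_num)
  refine ⟨γ, AlgIso.symm ⟨{ φ with
    map_zero' := map_zero φ
    map_mul' := fun X Y => hf ?_ }, hinj,
    (LinearMap.injective_iff_surjective_of_finrank_eq_finrank (by rw [finrank_H3k, hA])).mp hinj⟩⟩
  change f (φ (X * Y)) = f (φ X * φ Y)
  rw [hφ, hmul, hφ, hφ, coe_mul, map_smul, map_add, hFmul, hFmul]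

end JordanForms

/-! ### Freudenthal algebras of dimension six -/

section Freudenthal

open Matrix

section Reduced

variable {K : Type u} {C : Type*} [Field K] [NonAssocRing C] [Module K C]
  [IsScalarTower K C C] [SMulCommClass K C C] (N : QuadraticForm K C) [IsComposition N]

theorem conj_one : conj N (1 : C) = 1 := by
  rw [conj_apply, polar_one_one, two_smul, add_sub_cancel_right]

theorem conj_smul_one (c : K) : conj N (c • 1) = c • 1 := by
  rw [map_smul, conj_one]

/-- The element of `H₃(C, Γ)` with given diagonal and given entries above it. -/
def H3.mk (γ : Fin 3 → Kˣ) : (Fin 3 → K) × (Fin 3 → C) →ₗ[K] H3 N γ where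
  toFun p := ⟨!![p.1 0 • 1, p.2 0, p.2 1;
    ((γ 0 / γ 1 : Kˣ) : K) • conj N (p.2 0), p.1 1 • 1, p.2 2;
    ((γ 0 / γ 2 : Kˣ) : K) • conj N (p.2 1), ((γ 1 / γ 2 : Kˣ) : K) • conj N (p.2 2), p.1 2 • 1], by
    change starGamma N γ _ = _
    ext i j
    fin_cases i <;> fin_cases j <;>
      simp [starGamma, conj_one, conj_conj, smul_smul, div_eq_inv_mul]
    all_goals
      convert one_smul K _
      field_simp⟩
  map_add' p q := by
    apply Subtype.ext
    ext i j
    fin_cases i <;> fin_cases j <;> simp [add_smul]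
  map_smul' c p := by
    apply Subtype.ext
    ext i j
    fin_cases i <;> fin_cases j <;> simp [mul_smul, smul_comm c]

theorem H3.mk_injective (γ : Fin 3 → Kˣ) : Function.Injective (H3.mk N γ) := by
  have h1 : (1 : C) ≠ 0 := fun h => by
    have := map_one_eq N
    rw [h, QuadraticMap.map_zero] at this
    exact zero_ne_one this
  intro p q h
  have e : ∀ i j, (H3.mk N γ p).1 i j = (H3.mk N γ q).1 i j := fun i j => by rw [h]
  have hinj := smul_left_injective K h1
  refine Prod.ext (funext fun i => ?_) (funext fun i => ?_)
  · fin_cases i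
    · exact hinj (e 0 0)
    · exact hinj (e 1 1)
    · exact hinj (e 2 2)
  · fin_cases i
    · exact e 0 1
    · exact e 0 2
    · exact e 1 2

/-- Diagonal and upper entries are free, so 3 + 3 dim C ≤ 6, while C ≠ 0. -/
theorem finrank_eq_one_of_finrank_H3 {γ : Fin 3 → Kˣ} (h : Module.finrank K (H3 N γ) = 6) :
    Module.finrank K C = 1 := by
  have := IsComposition.nontrivial (N := N)
  have : Module.Finite K (H3 N γ) := Module.finite_of_finrank_pos (by rw [h]; norm_num)
  have hfin : Module.Finite K ((Fin 3 → K) × (Fin 3 → C)) :=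
    Module.Finite.of_injective _ (H3.mk_injective N γ)
  have : Module.Finite K C := Module.Finite.of_surjective
    ((LinearMap.proj 0).comp (LinearMap.snd K (Fin 3 → K) (Fin 3 → C)))
    fun c => ⟨(0, fun _ => c), rfl⟩
  have hle := LinearMap.finrank_le_finrank_of_injective (H3.mk_injective N γ)
  rw [h, Module.finrank_prod, Module.finrank_pi_fintype, Module.finrank_pi_fintype] at hle
  simp at hle
  have := Module.finrank_pos (R := K) (M := C)
  omega

theorem algIso_H3_H3k {γ : Fin 3 → Kˣ} [NeZero (2 : K)] (h : Module.finrank K (H3 N γ) = 6) :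
    AlgIso K (H3 N γ) (H3k γ) := by
  have h1 : (1 : C) ≠ 0 := fun h => by
    have := map_one_eq N
    rw [h, QuadraticMap.map_zero] at this
    exact zero_ne_one this
  have hone := (finrank_eq_one_iff_of_nonzero' (1 : C) h1).mp (finrank_eq_one_of_finrank_H3 N h)
  have hmem : ∀ X : H3k γ, Matrix.of (fun i j => X.1 i j • (1 : C)) ∈ H3 N γ := by
    intro X
    have hX : starGamma QuadraticMap.sq γ X.1 = X.1 := X.2
    change starGamma N γ _ = _
    ext i j
    have := congrFun (congrFun hX i) j
    simp only [starGamma, of_apply, conj_sq, smul_eq_mul] at this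
    simp only [starGamma, of_apply, conj_smul_one, smul_smul, this]
  let φ : H3k γ →ₙₐ[K] H3 N γ :=
    { toFun := fun X => ⟨Matrix.of fun i j => X.1 i j • (1 : C), hmem X⟩
      map_smul' := fun c X => by
        apply Subtype.ext
        ext i j
        simp [mul_smul]
      map_zero' := by
        apply Subtype.ext
        ext i j
        simp
      map_add' := fun X Y => by
        apply Subtype.ext
        ext i j
        simp [add_smul]
      map_mul' := fun X Y => by
        apply Subtype.ext
        ext i j
        simp only [coe_mul, of_apply, Matrix.smul_apply, Matrix.add_apply, Matrix.mul_apply,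
          smul_mul_smul_comm, mul_one, ← Finset.sum_smul, ← add_smul, smul_smul, smul_eq_mul] }
  refine AlgIso.symm ⟨φ, ?_, ?_⟩
  · intro X Y hXY
    apply Subtype.ext
    ext i j
    exact smul_left_injective K h1 (congrFun (congrFun (congrArg Subtype.val hXY) i) j)
  · intro Y
    choose X hX using fun i j => hone (Y.1 i j)
    refine ⟨⟨Matrix.of X, ?_⟩, ?_⟩
    · have hY : starGamma N γ Y.1 = Y.1 := Y.2
      change starGamma QuadraticMap.sq γ _ = _
      ext i j
      have := congrFun (congrFun hY i) j
      simp only [starGamma, of_apply, ← hX, conj_smul_one, smul_smul] at this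
      simp only [starGamma, of_apply, conj_sq, smul_eq_mul]
      exact smul_left_injective K h1 this
    · apply Subtype.ext
      ext i j
      exact hX i j

end Reduced

/-! ### Symmetric matrices over the algebraic closure. -/

section Split

variable {K : Type u} [Field K] [NeZero (2 : K)]

/-- Over an algebraic closure, `H₃(K, Γ)` embeds into the symmetric matrices. -/
theorem exists_linearMap_H3k_symmetric (γ : Fin 3 → Kˣ) :
    ∃ ψ : H3k γ →ₗ[K] Matrix (Fin 3) (Fin 3) (AlgebraicClosure K), Function.Injective ψ ∧
      (∀ X Y, ψ (X * Y) = (2⁻¹ : K) • (ψ X * ψ Y + ψ Y * ψ X)) ∧ (∀ X, (ψ X)ᵀ = ψ X) ∧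
      (∀ X, trace (ψ X) = algebraMap K _ (trace X.1)) ∧ (∀ X, X.1 = 1 → ψ X = 1) ∧
      Submodule.span (AlgebraicClosure K)
        {s | ∃ X Y, axialVector (ψ X * ψ Y - ψ Y * ψ X) = s} = ⊤ := by
  -- With Δᵢ² = γᵢ, conjugation by diag(Δ) turns self-adjointness for Γ into symmetry.
  choose Δ hΔ using fun i => IsAlgClosed.exists_pow_nat_eq
    (algebraMap K (AlgebraicClosure K) (γ i)) (n := 2) (by norm_num)
  have hΔ0 : ∀ i, Δ i ≠ 0 := by
    intro i h
    have := hΔ i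
    rw [h, zero_pow two_ne_zero] at this
    simpa using this.symm
  let ψ : H3k γ →ₗ[K] Matrix (Fin 3) (Fin 3) (AlgebraicClosure K) :=
    { toFun := fun X => Matrix.of fun i j => Δ i * algebraMap K _ (X.1 i j) * (Δ j)⁻¹
      map_add' := fun X Y => by
        ext i j
        simp [mul_add, add_mul]
      map_smul' := fun c X => by
        ext i j
        simp only [Submodule.coe_smul, of_apply, Matrix.smul_apply, smul_eq_mul, map_mul,
          Algebra.smul_def, RingHom.id_apply]
        ring }
  have hψ : ∀ X i j, ψ X i j = Δ i * algebraMap K _ (X.1 i j) * (Δ j)⁻¹ := fun _ _ _ => rfl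
  refine ⟨ψ, ?_, ?_, ?_, ?_, ?_, ?_⟩
  · intro X Y h
    apply Subtype.ext
    ext i j
    have := congrFun (congrFun h i) j
    rw [hψ, hψ] at this
    exact (algebraMap K (AlgebraicClosure K)).injective
      (mul_left_cancel₀ (hΔ0 i) (mul_right_cancel₀ (inv_ne_zero (hΔ0 j)) this))
  · have key : ∀ (X Y : H3k γ) i j, (ψ X * ψ Y) i j =
        Δ i * algebraMap K _ ((X.1 * Y.1) i j) * (Δ j)⁻¹ := by
      intro X Y i j
      simp only [Matrix.mul_apply, hψ, map_sum, map_mul, Finset.mul_sum, Finset.sum_mul]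
      refine Finset.sum_congr rfl fun l _ => ?_
      have := hΔ0 l
      field_simp
    intro X Y
    ext i j
    rw [Matrix.smul_apply, Matrix.add_apply, key, key, hψ, coe_mul, Matrix.smul_apply,
      Matrix.add_apply, smul_eq_mul, map_mul, map_add, Algebra.smul_def]
    ring
  · intro X
    ext i j
    have h := congrArg (algebraMap K (AlgebraicClosure K)) ((mem_H3k_iff γ X.1).mp X.2 i j)
    rw [map_mul, map_mul, ← hΔ, ← hΔ] at h
    rw [transpose_apply, hψ, hψ]
    have := hΔ0 i
    have := hΔ0 j
    field_simp
    linear_combination -h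
  · intro X
    simp only [trace, diag_apply, hψ, map_sum]
    refine Finset.sum_congr rfl fun i _ => ?_
    have := hΔ0 i
    field_simp
  · intro X hX
    ext i j
    rw [hψ, hX]
    by_cases hij : i = j
    · subst hij
      simp [hΔ0]
    · simp [hij]
  · rw [eq_top_iff, ← (Pi.basisFun (AlgebraicClosure K) (Fin 3)).span_eq, Submodule.span_le]
    -- Each standard basis vector is, up to a nonzero scalar, the axial vector of the commutator of
    -- a diagonal idempotent with an off-diagonal element.
    have key : ∀ (l : Fin 3) (c : AlgebraicClosure K) (p q : Fin 6 → K), c ≠ 0 →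
        axialVector (ψ ((h3Equiv γ).symm p) * ψ ((h3Equiv γ).symm q) -
          ψ ((h3Equiv γ).symm q) * ψ ((h3Equiv γ).symm p)) = c • Pi.single l 1 →
        Pi.single l 1 ∈ Submodule.span (AlgebraicClosure K)
          {s | ∃ X Y, axialVector (ψ X * ψ Y - ψ Y * ψ X) = s} := by
      intro l c p q hc h
      rw [← Submodule.smul_mem_iff _ hc, ← h]
      exact Submodule.subset_span ⟨_, _, rfl⟩
    rintro _ ⟨l, rfl⟩
    rw [Pi.basisFun_apply]
    fin_cases l
    · refine key _ (-(Δ 2 * algebraMap K _ (γ 1 / γ 2) * (Δ 1)⁻¹)) ![0, 1, 0, 0, 0, 0]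
        ![0, 0, 0, 1, 0, 0] (by simp [hΔ0]) ?_
      ext i
      fin_cases i <;> simp [axialVector_apply, Matrix.mul_apply, Fin.sum_univ_three, hψ,
        coe_h3Equiv_symm, hΔ0]
    · refine key _ (-(Δ 0 * algebraMap K _ (γ 2 / γ 0) * (Δ 2)⁻¹)) ![0, 0, 1, 0, 0, 0]
        ![0, 0, 0, 0, 1, 0] (by simp [hΔ0]) ?_
      ext i
      fin_cases i <;> simp [axialVector_apply, Matrix.mul_apply, Fin.sum_univ_three, hψ,
        coe_h3Equiv_symm, hΔ0]
    · refine key _ (-(Δ 1 * algebraMap K _ (γ 0 / γ 1) * (Δ 0)⁻¹)) ![1, 0, 0, 0, 0, 0]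
        ![0, 0, 0, 0, 0, 1] (by simp [hΔ0]) ?_
      ext i
      fin_cases i <;> simp [axialVector_apply, Matrix.mul_apply, Fin.sum_univ_three, hψ,
        coe_h3Equiv_symm, hΔ0]

end Split

end Freudenthal

/-! ### Descent to the base field. -/

section Descent

open Matrix

variable {k K : Type u} {A : Type v} [Field k] [Field K] [Algebra k K]
  [NonUnitalNonAssocRing A] [Module k A] [IsScalarTower k A A] [SMulCommClass k A A]

/-- A form of a unital algebra is unital. -/
theorem exists_forall_mul_eq_of_baseChange {u : K ⊗[k] A} (hu : ∀ a : A, u * 1 ⊗ₜ a = 1 ⊗ₜ a) :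
    ∃ e : A, ∀ a, e * a = a := by
  -- A k-linear retraction π of k → K induces K ⊗ A → A, which commutes with right multiplication by
  -- A; the image of u is then a left unit.
  obtain ⟨π, hπ⟩ := (Algebra.linearMap k K).exists_leftInverse_of_injective
    (LinearMap.ker_eq_bot.mpr (algebraMap k K).injective)
  have hπ1 : π 1 = 1 := by
    have := LinearMap.congr_fun hπ 1
    simpa using this
  let ρ : K ⊗[k] A →ₗ[k] A := TensorProduct.lid k A ∘ₗ LinearMap.rTensor A π
  have hρ : ∀ (c : K) (a : A), ρ (c ⊗ₜ a) = π c • a := fun c a => by simp [ρ]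
  have hmul : ∀ (z : K ⊗[k] A) (a : A), ρ (z * 1 ⊗ₜ a) = ρ z * a := by
    intro z a
    induction z using TensorProduct.induction_on with
    | zero => simp
    | tmul c b => rw [Algebra.TensorProduct.tmul_mul_tmul, mul_one, hρ, hρ, smul_mul_assoc]
    | add x y hx hy => rw [add_mul, map_add, map_add, hx, hy, add_mul]
  exact ⟨ρ u, fun a => by rw [← hmul, hu, hρ, hπ1, one_smul]⟩

theorem one_mem_H3k (γ : Fin 3 → Kˣ) : (1 : Matrix (Fin 3) (Fin 3) K) ∈ H3k γ := by
  rw [mem_H3k_iff]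
  intro i j
  by_cases h : i = j
  · rw [h]
  · rw [one_apply_ne h, one_apply_ne (Ne.symm h), mul_zero, mul_zero]

variable [NeZero (2 : k)] [NeZero (2 : K)]

/-- The composite A → K ⊗ A ≅ H₃(K, Γ) → symmetric matrices meets the hypotheses of
`exists_algIso_H3k_of_range`. In particular traces lie in k, since twice the matrix trace is the
trace of left multiplication, which is already defined over k. -/
theorem exists_algIso_H3k_of_baseChange (hA : Module.finrank k A = 6) {γ : Fin 3 → Kˣ}
    (h : AlgIso K (K ⊗[k] A) (H3k γ)) : ∃ δ : Fin 3 → kˣ, AlgIso k A (H3k δ) := by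
  have : Module.Finite k A := Module.finite_of_finrank_pos (by rw [hA]; norm_num)
  obtain ⟨g, hg⟩ := h
  obtain ⟨ψ, hψinj, hψmul, hψsym, hψtr, hψone, hψspan⟩ := exists_linearMap_H3k_symmetric γ
  let e : K ⊗[k] A ≃ₗ[K] H3k γ := LinearEquiv.ofBijective (g : K ⊗[k] A →ₗ[K] H3k γ) hg
  have he : ∀ z, e z = g z := fun _ => rfl
  let ι : A →ₗ[k] K ⊗[k] A := TensorProduct.mk k K A 1
  have hι : ∀ a, ι a = 1 ⊗ₜ a := fun _ => rfl
  have hιmul : ∀ a b, ι (a * b) = ι a * ι b := fun a b => by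
    rw [hι, hι, hι, Algebra.TensorProduct.tmul_mul_tmul, mul_one]
  have hιinj : Function.Injective ι :=
    Module.FaithfullyFlat.tensorProduct_mk_injective A
  have hspan : Submodule.span K (Set.range fun a => g (ι a)) = ⊤ := by
    rw [eq_top_iff]
    intro Y _
    obtain ⟨z, rfl⟩ := hg.2 Y
    induction z using TensorProduct.induction_on with
    | zero => rw [map_zero]; exact Submodule.zero_mem _
    | tmul c a =>
      have hca : c ⊗ₜ[k] a = c • ι a := by
        rw [hι, TensorProduct.smul_tmul', smul_eq_mul, mul_one]
      rw [hca, map_smul]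
      exact Submodule.smul_mem _ c (Submodule.subset_span ⟨a, rfl⟩)
    | add x y hx hy =>
      rw [map_add]
      exact Submodule.add_mem _ (hx trivial) (hy trivial)
  let f : A →ₗ[k] Matrix (Fin 3) (Fin 3) (AlgebraicClosure K) :=
    ψ.restrictScalars k ∘ₗ (g : K ⊗[k] A →ₗ[K] H3k γ).restrictScalars k ∘ₗ ι
  have hf : ∀ a, f a = ψ (g (ι a)) := fun _ => rfl
  refine exists_algIso_H3k_of_range hA f ?_ ?_ ?_ ?_ ?_ ?_
  · exact hψinj.comp (hg.1.comp hιinj)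
  · intro a b
    rw [hf, hιmul, map_mul, hψmul, ← hf, ← hf, ← algebraMap_smul K (2⁻¹ : k), map_inv₀, map_ofNat]
  · intro a
    exact hψsym _
  · intro a
    have htr : 2 * trace (g (ι a)).1 =
        algebraMap k K (LinearMap.trace k A (LinearMap.mulLeft k a)) := by
      rw [← trace_mulLeft_H3k, ← LinearMap.trace_baseChange, ← LinearMap.trace_conj' _ e]
      congr 1
      ext1 Z
      obtain ⟨Z, rfl⟩ := e.surjective Z
      simp only [LinearEquiv.conj_apply_apply, LinearEquiv.symm_apply_apply,
        LinearMap.mulLeft_apply]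
      rw [he, he, ← map_mul]
      congr 1
      induction Z using TensorProduct.induction_on with
      | zero => rw [map_zero, mul_zero]
      | tmul c b =>
        rw [LinearMap.baseChange_tmul, hι, Algebra.TensorProduct.tmul_mul_tmul, one_mul,
          LinearMap.mulLeft_apply]
      | add x y hx hy => rw [map_add, mul_add, hx, hy]
    refine ⟨2⁻¹ * LinearMap.trace k A (LinearMap.mulLeft k a), ?_⟩
    rw [hf, hψtr, IsScalarTower.algebraMap_apply k K (AlgebraicClosure K), map_mul, ← htr, map_inv₀,
      map_ofNat, inv_mul_cancel_left₀ (NeZero.ne _)]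
  · obtain ⟨u, hu⟩ := hg.2 ⟨1, one_mem_H3k γ⟩
    have hone : ∀ X : H3k γ, ⟨1, one_mem_H3k γ⟩ * X = X := by
      intro X
      apply Subtype.ext
      rw [coe_mul, Matrix.one_mul, Matrix.mul_one, ← two_smul K, smul_smul,
        inv_mul_cancel₀ (NeZero.ne _), one_smul]
    obtain ⟨c, hc⟩ := exists_forall_mul_eq_of_baseChange (u := u) fun a => hg.1 (by
      rw [map_mul, hu, hone])
    refine ⟨c, hψone _ ?_⟩
    -- Left multiplication by the image of c is the identity on a spanning set, hence everywhere;
    -- evaluation at 1 shows that this image is 1.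
    have hid : LinearMap.mulLeft K (g (ι c)) = LinearMap.id := by
      refine LinearMap.ext_on_range hspan fun a => ?_
      rw [LinearMap.mulLeft_apply, ← map_mul, ← hιmul, hc, LinearMap.id_apply]
    have h1 := LinearMap.congr_fun hid ⟨1, one_mem_H3k γ⟩
    have h1' := hone (g (ι c))
    have hcomm : g (ι c) * ⟨1, one_mem_H3k γ⟩ = ⟨1, one_mem_H3k γ⟩ * g (ι c) := by
      apply Subtype.ext
      rw [coe_mul, coe_mul, add_comm]
    rw [LinearMap.mulLeft_apply, hcomm, h1'] at h1
    exact congrArg Subtype.val h1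
  · set U := Submodule.span (AlgebraicClosure K)
      {s | ∃ a b, axialVector (f a * f b - f b * f a) = s} with hU
    -- The axial vector of a commutator is K-bilinear and alternating, and A spans over K, so the
    -- arguments can be extended from A one at a time.
    let B (Y : H3k γ) : H3k γ →ₗ[K] (Fin 3 → AlgebraicClosure K) :=
      axialVector.restrictScalars K ∘ₗ
        (LinearMap.mulRight K (ψ Y) - LinearMap.mulLeft K (ψ Y)) ∘ₗ ψ
    have hB : ∀ X Y, B Y X = axialVector (ψ X * ψ Y - ψ Y * ψ X) := fun _ _ => rfl
    have hBneg : ∀ X Y, B Y X = -B X Y := fun X Y => by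
      rw [hB, hB, ← map_neg, neg_sub]
    have hext : ∀ Y, (∀ a, B Y (g (ι a)) ∈ U) → ∀ X, B Y X ∈ U := by
      intro Y hY X
      have hle : Submodule.span K (Set.range fun a => g (ι a)) ≤
          (U.restrictScalars K).comap (B Y) := by
        rw [Submodule.span_le]
        rintro _ ⟨a, rfl⟩
        exact hY a
      rw [hspan] at hle
      exact hle (Submodule.mem_top (x := X))
    rw [eq_top_iff, ← hψspan, Submodule.span_le]
    rintro _ ⟨X, Y, rfl⟩
    refine hext Y (fun a => ?_) X
    rw [hBneg]
    refine U.neg_mem (hext _ (fun b => ?_) Y)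
    exact Submodule.subset_span ⟨b, a, rfl⟩

variable (A) in
theorem isFreudenthal_and_finrank_iff :
    (IsFreudenthal k A ∧ Module.finrank k A = 6) ↔ ∃ γ : Fin 3 → kˣ, AlgIso k A (H3k γ) := by
  constructor
  · rintro ⟨⟨K, _, _, C, _, _, _, _, N, _, γ, h⟩, hA⟩
    have := neZero_ofNat_map (F := k) K 2
    have h6 : Module.finrank K (H3 N γ) = 6 := by
      obtain ⟨g, hg⟩ := h
      rw [← (LinearEquiv.ofBijective (g : K ⊗[k] A →ₗ[K] H3 N γ) hg).finrank_eq,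
        Module.finrank_baseChange, hA]
    exact exists_algIso_H3k_of_baseChange hA (h.trans (algIso_H3_H3k N h6))
  · rintro ⟨γ, h⟩
    refine ⟨⟨k, _, _, k, _, _, inferInstance, inferInstance, QuadraticMap.sq, inferInstance, γ,
      AlgIso.trans ⟨{ TensorProduct.lid k A with
        map_smul' := fun c z => (TensorProduct.lid k A).map_smul c z
        map_zero' := (TensorProduct.lid k A).map_zero
        map_mul' := fun x y => ?_ }, (TensorProduct.lid k A).bijective⟩ h⟩, ?_⟩
    · change TensorProduct.lid k A (x * y) = TensorProduct.lid k A x * TensorProduct.lid k A y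
      induction x using TensorProduct.induction_on with
      | zero => simp
      | tmul c a =>
        induction y using TensorProduct.induction_on with
        | zero => simp
        | tmul d b => simp [smul_mul_smul_comm]
        | add x y hx hy => rw [mul_add, map_add, map_add, hx, hy, mul_add]
      | add x y hx hy => rw [add_mul, map_add, map_add, hx, hy, add_mul]
    · obtain ⟨f, hf⟩ := h
      rw [(LinearEquiv.ofBijective (f : A →ₗ[k] H3k γ) hf).finrank_eq, finrank_H3k]

end Descent

theorem theorem6p1 {k : Type u} [Field k] [NeZero (2 : k)] [NeZero (3 : k)] :
    (∃ (Φ : H3Classes k ≃ QuatClasses k) (Ψ : X2Orbits k ≃ QuatClasses k),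
      (∀ (γ : Fin 3 → kˣ) (Q : QuatAlg k),
        Φ (Quotient.mk (h3Setoid k) γ) = Quotient.mk (quatSetoid k) Q ↔
          QuadraticMap.Equivalent Q.norm
            (diagForm 1 ((γ 1 : k) / γ 2) ((γ 2 : k) / γ 0) ((γ 0 : k) / γ 1))) ∧
      (∀ a b c : kˣ, ∃ hx : diagElt (a : k) (b : k) (c : k) ∈ X2 k, ∀ Q : QuatAlg k,
        Ψ (Quotient.mk (x2Setoid k) ⟨diagElt (a : k) (b : k) (c : k), hx⟩) =
            Quotient.mk (quatSetoid k) Q ↔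
          QuadraticMap.Equivalent Q.norm (diagForm 1 ((b : k) * c) (c * a) (a * b)))) ∧
    (∀ (A : Type v) [NonUnitalNonAssocRing A] [Module k A] [IsScalarTower k A A]
        [SMulCommClass k A A],
      (IsFreudenthal k A ∧ Module.finrank k A = 6) ↔ ∃ γ : Fin 3 → kˣ, AlgIso k A (H3k γ)) := by
  obtain ⟨Φ, hΦ⟩ := exists_equiv_H3Classes (k := k)
  obtain ⟨Ψ, hΨ⟩ := exists_equiv_X2Orbits (k := k)
  exact ⟨⟨Φ, Ψ, hΦ, hΨ⟩, fun A _ _ _ _ => isFreudenthal_and_finrank_iff A⟩
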